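/- **Setting.** A theory is given by a finite set of field types with an involution $f\mapsto\bar f$ (a propagator joins half-edges of types $f$ and $\bar f$) and a finite set of interaction monomials, i.e. vertex types, each a multiset of at least three field types. Let $\mathcal R$ be the set consisting of the interaction monomials and of the propagator types $\{f,\bar f\}$. For a connected graph $\Gamma$ let $|\Gamma|$ be its number of loops and let $\mathrm{res}(\Gamma)$, its residue, be the multiset of types of its external legs. A 1PI graph is a connected Feynman graph of the theory without bridges that has at least one loop and at least two external legs. Let $\mathbb K$ be a field of characteristic $0$ and $\mathcal H$ the free commutative $\mathbb K$-algebra on the isomorphism classes of 1PI graphs, with the multiplicative coproduct $$\Delta(\Gamma)=\Gamma\otimes 1+1\otimes\Gamma+\sum_{\gamma\subset\Gamma}\gamma\otimes\Gamma/\gamma ,$$ the sum being over all nonempty proper subgraphs $\gamma$ that are disjoint unions of 1PI graphs with residues in $\mathcal R$, where $\Gamma/\gamma$ arises by shrinking each component of $\gamma$ to its residue (a vertex, or an edge if the component has two legs). Let $P_{\rm lin}$ be the projector of $\mathcal H$ onto the linear span of the generators and $P^{(2)}_{\rm lin}=(P_{\rm lin}\otimes P_{\rm lin})\Delta$; both are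 applied to series in $\alpha$ coefficientwise. For $r\in\mathcal R$ put $$\Gamma^r=1\pm\sum_{\Gamma\in\mathcal M_r}\alpha^{|\Gamma|}\frac{\Gamma}{\mathrm{sym}(\Gamma)},$$ with the sign $-$ if $r$ has two legs and $+$ otherwise, where $\mathcal M_r$ is the set of 1PI graphs whose external legs are labelled by the legs of $r$, up to isomorphism, and $\mathrm{sym}(\Gamma)$ is the number of automorphisms of $\Gamma$ that fix the external legs. For a 1PI graph $\gamma$ with $\mathrm{res}(\gamma)\in\mathcal R$ let $X_\gamma=\prod_v\Gamma^v/\prod_e\Gamma^e$, over the vertices $v$ and internal edges $e$ of $\gamma$. A skeleton graph is a 1PI graph with residue in $\mathcal R$ that is primitive in $\mathcal H$. Suppose that there is a one-loop skeleton graph; fix one, $\gamma$, and let $$Q^{n_r}=X_\gamma/\Gamma^{\mathrm{res}(\gamma)} .$$ In order that the charge be well-defined one divides $\mathcal H$ by the ideal $I$ generated by the coefficients of the relations $X_{\gamma'}=\Gamma^{\mathrm{res}(\gamma')}\,(X_{\gamma_1}/\Gamma^{\mathrm{res}(\gamma_1)})^{|\gamma'|}$, for all skeleton graphs $\gamma'$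 and all one-loop skeleton graphs $\gamma_1$ (for $|\gamma'|=1$: all one-loop skeleton graphs have the same charge). The linear span of the generators is divided accordingly by $P_{\rm lin}(I)$. **Theorem.** (i) For every $r\in\mathcal R$ the linearized coproduct is $$P^{(2)}_{\rm lin}\Gamma^r=P_{\rm lin}\Gamma^r\otimes P_{\rm lin}\Gamma^r+P_{\rm lin}Q^{n_r}\otimes\alpha\partial_\alpha\Gamma^r ,$$ an identity of the coefficients of each power of $\alpha$ modulo $P_{\rm lin}(I)$ in both tensor factors (hence an identity in $\mathcal H\otimes\mathcal H$ if the relations hold in $\mathcal H$ already). (ii) If $Q=\prod_v(\Gamma^v)^{n_v}/\prod_e(\Gamma^e)^{n_e/2}$ (over the vertex types $v$ and propagator types $e$ of the theory), so that its power with exponent $n_r\ne0$ is the monomial $Q^{n_r}$ above, then $$P_{\rm lin}Q^{n_r}=\beta_{\rm comb}:=n_r\Big(\sum_v n_v\,P_{\rm lin}\Gamma^v-\tfrac12\sum_e n_e\,P_{\rm lin}\Gamma^e\Big).$$ -/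

import Mathlib

open scoped TensorProduct Classical

/-- A graph built from half-edges, each carrying a field type from `F`. A block of `vert` is the set
of half-edges meeting at one vertex; a block of `line` is a line of the graph: two half-edges
(an internal edge) or one half-edge (an external leg). -/
structure FGraph (F : Type) where
  /-- the half-edges -/
  H : Type
  /-- there are finitely many half-edges -/
  fin : Fintype H
  /-- the field type of a half-edge -/
  field : H → F
  /-- "belong to the same vertex" -/
  vert : Setoid H
  /-- "belong to the same line" -/
  line : Setoid H

attribute [instance] FGraph.fin

namespace FGraph

variable {F : Type} (Γ : FGraph F)

/-- The multiset of field types in the block `q` of an equivalence relation on half-edges. -/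
noncomputable def block (s : Setoid Γ.H) (q : Quotient s) : Multiset F :=
  (Finset.univ.filter (fun h => Quotient.mk s h = q)).val.map Γ.field

/-- The type of a vertex: the field types of its half-edges. -/
noncomputable def vertexType (v : Quotient Γ.vert) : Multiset F := Γ.block Γ.vert v

/-- The type of a line: the field types of its half-edges. -/
noncomputable def lineType (e : Quotient Γ.line) : Multiset F := Γ.block Γ.line e

/-- The set `Γ^{[1]}_int` of internal edges. -/
noncomputable def internalEdges : Finset (Quotient Γ.line) :=
  Finset.univ.filter (fun e => (Γ.lineType e).card = 2)

/-- The half-edge `h` is an external leg: it is alone on its line. -/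
def IsLeg (h : Γ.H) : Prop := ∀ h', Γ.line h h' → h' = h

/-- The residue: all internal edges are shrunk to a point, which leaves a single vertex together
with the external legs. It is recorded by the field types of the external legs. -/
noncomputable def res : Multiset F := (Finset.univ.filter Γ.IsLeg).val.map Γ.field

/-- The number of independent loops, `(internal edges) - (vertices) + 1` for a connected graph. -/
noncomputable def loops : ℕ :=
  Γ.internalEdges.card + 1 - Fintype.card (Quotient Γ.vert)

/-- The relation "equal, or joined by a line that belongs to `S`": the lines outside `S` are cut
into two half-edges each. -/
def lineOn (S : Set (Quotient Γ.line)) : Setoid Γ.H where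
  r a b := a = b ∨ (Γ.line a b ∧ Quotient.mk Γ.line a ∈ S)
  iseqv :=
    { refl := fun _ => Or.inl rfl
      symm := by
        rintro a b (rfl | ⟨h, hS⟩)
        · exact Or.inl rfl
        · have hq : Quotient.mk Γ.line a = Quotient.mk Γ.line b := Quotient.sound h
          exact Or.inr ⟨Γ.line.symm' h, hq ▸ hS⟩
      trans := by
        rintro a b c (rfl | ⟨h, hS⟩) (rfl | ⟨h', hS'⟩)
        · exact Or.inl rfl
        · exact Or.inr ⟨h', hS'⟩
        · exact Or.inr ⟨h, hS⟩
        · exact Or.inr ⟨Γ.line.trans' h h', hS⟩ }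

/-- The graph is nonempty and connected. -/
def IsConnected : Prop := Nonempty Γ.H ∧ Γ.vert ⊔ Γ.line = ⊤

/-- The graph remains connected after removal of any one of its internal edges. -/
def IsBridgeless : Prop := ∀ e ∈ Γ.internalEdges, Γ.vert ⊔ Γ.lineOn {e}ᶜ = ⊤

/-! ### Subgraphs and contraction

A subgraph is given by a set `S` of internal edges, together with the vertices that they meet. -/

/-- Half-edges whose vertices are connected through the edges in `S`. -/
def comp (S : Set (Quotient Γ.line)) : Setoid Γ.H := Γ.vert ⊔ Γ.lineOn S

/-- A connected component for the edges in `S`, as a graph: its vertices with all their half-edges,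
its internal edges being those in `S`; all other half-edges are its external legs. A component that
meets no edge in `S` is a single vertex of `Γ`. -/
noncomputable def component (S : Set (Quotient Γ.line)) (c : Quotient (Γ.comp S)) : FGraph F where
  H := {h : Γ.H // Quotient.mk (Γ.comp S) h = c}
  fin := inferInstance
  field := fun h => Γ.field h.1
  vert := Γ.vert.comap Subtype.val
  line := (Γ.lineOn S).comap Subtype.val

/-- The components that contain an edge in `S`, that is, the connected components of the
subgraph. -/
noncomputable def components (S : Set (Quotient Γ.line)) : Finset (Quotient (Γ.comp S)) :=
  Finset.univ.filter (fun c => ∃ h, Quotient.mk (Γ.comp S) h = c ∧ Quotient.mk Γ.line h ∈ S)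

/-- The half-edge `h` lies in a component with exactly two external legs. -/
def IsBivalent (S : Set (Quotient Γ.line)) (h : Γ.H) : Prop :=
  (Γ.component S (Quotient.mk (Γ.comp S) h)).res.card = 2

/-- The relation "equal, or in the same component, this component having exactly two external
legs". -/
def through (S : Set (Quotient Γ.line)) : Setoid Γ.H where
  r a b := a = b ∨ (Γ.comp S a b ∧ Γ.IsBivalent S a)
  iseqv :=
    { refl := fun _ => Or.inl rfl
      symm := by
        rintro a b (rfl | ⟨h, hS⟩)
        · exact Or.inl rfl
        · have hq : Quotient.mk (Γ.comp S) a = Quotient.mk (Γ.comp S) b := Quotient.sound h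
          refine Or.inr ⟨(Γ.comp S).symm' h, ?_⟩
          unfold IsBivalent at hS ⊢
          rw [← hq]
          exact hS
      trans := by
        rintro a b c (rfl | ⟨h, hS⟩) (rfl | ⟨h', hS'⟩)
        · exact Or.inl rfl
        · exact Or.inr ⟨h', hS'⟩
        · exact Or.inr ⟨h, hS⟩
        · exact Or.inr ⟨(Γ.comp S).trans' h h', hS⟩ }

/-- The contracted graph `Γ/γ`, for the subgraph `γ` with edge set `S`: each component of `γ` is
shrunk to its residue. A component with at least three legs becomes a vertex, to which its legs are
attached; a component with two legs becomes (part of) a line, which joins the lines at its two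
legs. -/
noncomputable def contract (S : Set (Quotient Γ.line)) : FGraph F where
  H := {h : Γ.H // Quotient.mk Γ.line h ∉ S ∧ ¬ Γ.IsBivalent S h}
  fin := inferInstance
  field := fun h => Γ.field h.1
  vert := (Γ.comp S).comap Subtype.val
  line := (Γ.line ⊔ Γ.through S).comap Subtype.val

/-! ### Isomorphisms -/

/-- Isomorphisms of graphs: bijections of the half-edges that respect field types, vertices and
lines. -/
def Iso (Γ Γ' : FGraph F) : Type :=
  {φ : Γ.H ≃ Γ'.H // (∀ h, Γ'.field (φ h) = Γ.field h) ∧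
    (∀ a b, Γ'.vert (φ a) (φ b) ↔ Γ.vert a b) ∧ (∀ a b, Γ'.line (φ a) (φ b) ↔ Γ.line a b)}

/-- The identity. -/
def Iso.refl (Γ : FGraph F) : Iso Γ Γ :=
  ⟨Equiv.refl _, fun _ => rfl, fun _ _ => Iff.rfl, fun _ _ => Iff.rfl⟩

/-- The inverse. -/
def Iso.symm {Γ Γ' : FGraph F} (φ : Iso Γ Γ') : Iso Γ' Γ :=
  ⟨φ.1.symm, fun h => by rw [← φ.2.1, Equiv.apply_symm_apply],
    fun a b => by rw [← φ.2.2.1, Equiv.apply_symm_apply, Equiv.apply_symm_apply],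
    fun a b => by rw [← φ.2.2.2, Equiv.apply_symm_apply, Equiv.apply_symm_apply]⟩

/-- The composition. -/
def Iso.trans {Γ Γ' Γ'' : FGraph F} (φ : Iso Γ Γ') (ψ : Iso Γ' Γ'') : Iso Γ Γ'' :=
  ⟨φ.1.trans ψ.1, fun h => (ψ.2.1 _).trans (φ.2.1 h),
    fun a b => (ψ.2.2.1 _ _).trans (φ.2.2.1 a b),
    fun a b => (ψ.2.2.2 _ _).trans (φ.2.2.2 a b)⟩

end FGraph

/-- The combinatorial data of a quantum field theory: field types, the propagators, which join a
half-edge of type `f` to one of type `conj f` (`conj f = f` for a real field), and the interaction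
monomials of the Lagrangian, each given by the field types of its legs. -/
structure FeynmanTheory where
  /-- the field types (types of half-edges) -/
  FieldType : Type
  /-- there are finitely many field types -/
  fin : Fintype FieldType
  /-- a propagator joins `f` and `conj f` -/
  conj : FieldType → FieldType
  conj_conj : ∀ f, conj (conj f) = f
  /-- the interaction monomials (vertex types) -/
  interactions : Finset (Multiset FieldType)
  three_le_card : ∀ v ∈ interactions, 3 ≤ v.card

attribute [instance] FeynmanTheory.fin

namespace FeynmanTheory

variable (T : FeynmanTheory)

/-- The propagator types `{f, conj f}`, which are also the quadratic monomials of the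
Lagrangian. -/
noncomputable def edges : Finset (Multiset T.FieldType) :=
  Finset.univ.image (fun f => ({f, T.conj f} : Multiset T.FieldType))

/-- The set `R` of amplitudes that need renormalization: the monomials of the Lagrangian. -/
noncomputable def R : Finset (Multiset T.FieldType) := T.interactions ∪ T.edges

/-- `Γ` is a one-particle irreducible Feynman graph of the theory with at least one loop (and it is
neither a vacuum graph nor a tadpole graph). -/
structure IsOnePI (Γ : FGraph T.FieldType) : Prop where
  vertices : ∀ v, Γ.vertexType v ∈ T.interactions
  lines : ∀ e, (∃ f, Γ.lineType e = {f}) ∨ Γ.lineType e ∈ T.edges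
  connected : Γ.IsConnected
  bridgeless : Γ.IsBridgeless
  one_le_loops : 1 ≤ Γ.loops
  two_le_legs : 2 ≤ Γ.res.card

/-- Isomorphism of 1PI graphs. -/
def onePISetoid : Setoid {Γ : FGraph T.FieldType // T.IsOnePI Γ} where
  r Γ Γ' := Nonempty (FGraph.Iso Γ.1 Γ'.1)
  iseqv :=
    { refl := fun Γ => ⟨FGraph.Iso.refl Γ.1⟩
      symm := fun ⟨φ⟩ => ⟨φ.symm⟩
      trans := fun ⟨φ⟩ ⟨ψ⟩ => ⟨φ.trans ψ⟩ }

/-- The 1PI graphs of the theory, up to isomorphism. -/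
abbrev OnePI : Type 1 := Quotient T.onePISetoid

universe u

variable (K : Type u) [Field K]

/-- The algebra `𝓗`: the free commutative `K`-algebra on generators indexed by the 1PI graphs of the
theory. -/
abbrev Hopf : Type (max 1 u) := MvPolynomial T.OnePI K

/-- The generator of `𝓗` indexed by a graph (zero if the graph is not 1PI). -/
noncomputable def gen (Γ : FGraph T.FieldType) : T.Hopf K :=
  if h : T.IsOnePI Γ then MvPolynomial.X (Quotient.mk T.onePISetoid ⟨Γ, h⟩) else 0

/-- The edge sets of those subgraphs of `Γ` over which the coproduct sums: nonempty proper subgraphs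
all of whose connected components are 1PI graphs with residue in `R`. -/
noncomputable def divergentSubgraphs (Γ : FGraph T.FieldType) : Finset (Finset (Quotient Γ.line)) :=
  Γ.internalEdges.ssubsets.filter (fun S => S.Nonempty ∧ ∀ c ∈ Γ.components (S : Set (Quotient Γ.line)),
    T.IsOnePI (Γ.component (S : Set (Quotient Γ.line)) c) ∧ (Γ.component (S : Set (Quotient Γ.line)) c).res ∈ T.R)

/-- `Γ ⊗ 1 + 1 ⊗ Γ + ∑_γ γ ⊗ Γ/γ`. (The graphs `Γ/γ` that occur here are 1PI graphs if `Γ` is.) -/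
noncomputable def graphCoproduct (Γ : FGraph T.FieldType) : T.Hopf K ⊗[K] T.Hopf K :=
  T.gen K Γ ⊗ₜ[K] 1 + 1 ⊗ₜ[K] T.gen K Γ +
    ∑ S ∈ T.divergentSubgraphs Γ,
      (∏ c ∈ Γ.components (S : Set (Quotient Γ.line)), T.gen K (Γ.component (S : Set (Quotient Γ.line)) c)) ⊗ₜ[K]
        T.gen K (Γ.contract (S : Set (Quotient Γ.line)))

/-- The coproduct of `𝓗`, extended to products of graphs as a morphism of algebras. -/
noncomputable def coproduct : T.Hopf K →ₐ[K] T.Hopf K ⊗[K] T.Hopf K :=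
  MvPolynomial.aeval (fun x : T.OnePI => T.graphCoproduct K x.out.1)

/-- The projector `P_lin` onto the linear span of the generators. -/
noncomputable def Plin : T.Hopf K →ₗ[K] T.Hopf K := MvPolynomial.homogeneousComponent 1

/-- `P_lin^{(2)} = (P_lin ⊗ P_lin) Δ`. -/
noncomputable def Plin2 : T.Hopf K →ₗ[K] T.Hopf K ⊗[K] T.Hopf K :=
  TensorProduct.map (T.Plin K) (T.Plin K) ∘ₗ (T.coproduct K).toLinearMap

/-! ### The series of graphs -/

/-- A 1PI graph contributing to the amplitude `r`: its external legs are labelled by the legs of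
`r`. -/
structure Contribution (r : Multiset T.FieldType) where
  graph : FGraph T.FieldType
  onePI : T.IsOnePI graph
  leg : r.ToType → graph.H
  leg_injective : Function.Injective leg
  range_leg : ∀ h, graph.IsLeg h ↔ ∃ x, leg x = h
  field_leg : ∀ x, graph.field (leg x) = x.1

/-- Isomorphism of graphs with labelled external legs. -/
def contributionSetoid (r : Multiset T.FieldType) : Setoid (T.Contribution r) where
  r G G' := ∃ φ : FGraph.Iso G.graph G'.graph, ∀ x, φ.1 (G.leg x) = G'.leg x
  iseqv :=
    { refl := fun G => ⟨FGraph.Iso.refl G.graph, fun _ => rfl⟩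
      symm := by
        rintro G G' ⟨φ, h⟩
        refine ⟨φ.symm, fun x => ?_⟩
        rw [← h x]
        exact φ.1.symm_apply_apply _
      trans := by
        rintro G G' G'' ⟨φ, h⟩ ⟨ψ, h'⟩
        refine ⟨φ.trans ψ, fun x => ?_⟩
        rw [← h' x, ← h x]
        rfl }

/-- The symmetry factor `sym(Γ)`: the order of the group of automorphisms of `Γ`, the external legs
being fixed. -/
noncomputable def Contribution.sym {T : FeynmanTheory} {r : Multiset T.FieldType}
    (G : T.Contribution r) : ℕ :=
  Nat.card {φ : FGraph.Iso G.graph G.graph // ∀ x, φ.1 (G.leg x) = G.leg x}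

/-- The set `M_r` of 1PI graphs contributing to the amplitude `r`. -/
abbrev M (r : Multiset T.FieldType) : Type 1 := Quotient (T.contributionSetoid r)

/-- `c_k^r = ∑_{Γ ∈ M_r, |Γ| = k} Γ / sym(Γ)`. (There are finitely many such `Γ`, since all
vertices have at least three legs.) -/
noncomputable def c (r : Multiset T.FieldType) (k : ℕ) : T.Hopf K :=
  ∑ᶠ x : T.M r, if x.out.graph.loops = k then
    ((x.out.sym : K)⁻¹) • T.gen K x.out.graph else 0

/-- The series `Γ^r = 1 ± ∑_{k ≥ 1} α^k c_k^r`, with the minus sign if `r` has two legs and the plus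
sign otherwise. -/
noncomputable def green (r : Multiset T.FieldType) : PowerSeries (T.Hopf K) :=
  1 + (if r.card = 2 then -1 else 1) *
    PowerSeries.mk (fun k => if k = 0 then 0 else T.c K r k)

/-- The series `1 / Γ^r`. -/
noncomputable def greenInv (r : Multiset T.FieldType) : PowerSeries (T.Hopf K) :=
  PowerSeries.invOfUnit (T.green K r) 1

/-- `X_γ = ∏_v Γ^v / ∏_e Γ^e`, over the vertices `v` and the internal edges `e` of `γ`. -/
noncomputable def insertion (γ : FGraph T.FieldType) : PowerSeries (T.Hopf K) :=
  (∏ v : Quotient γ.vert, T.green K (γ.vertexType v)) *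
    ∏ e ∈ γ.internalEdges, T.greenInv K (γ.lineType e)

/-- `Q^{n_r} = (1 / Γ^{res γ}) (∏_v Γ^v / ∏_e Γ^e)`, as read off from the graph `γ`. -/
noncomputable def charge (γ : FGraph T.FieldType) : PowerSeries (T.Hopf K) :=
  T.greenInv K γ.res * T.insertion K γ

/-- `γ` is a skeleton graph for an amplitude in `R`: a 1PI graph with residue in `R` that is a
primitive element of `𝓗`. -/
structure IsSkeleton (γ : FGraph T.FieldType) : Prop where
  onePI : T.IsOnePI γ
  primitive : T.coproduct K (T.gen K γ) = T.gen K γ ⊗ₜ[K] 1 + 1 ⊗ₜ[K] T.gen K γ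
  res_mem : γ.res ∈ T.R

/-- The ideal of `𝓗` by which one divides in order to have a well-defined charge: it is generated by
the coefficients of the relations `X_γ = Γ^{res γ} (Q^{n_r})^{|γ|}`, for all skeleton graphs `γ`,
where `Q^{n_r}` may be read off from any one-loop skeleton graph `γ₁`. For `|γ| = 1` these relations
say that all one-loop skeleton graphs have the same charge. -/
noncomputable def chargeIdeal : Ideal (T.Hopf K) :=
  Ideal.span {x | ∃ γ γ₁ : FGraph T.FieldType, ∃ k : ℕ,
    T.IsSkeleton K γ ∧ T.IsSkeleton K γ₁ ∧ γ₁.loops = 1 ∧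
      x = PowerSeries.coeff k (T.insertion K γ - T.green K γ.res * T.charge K γ₁ ^ γ.loops)}

/-- The linear parts of the elements of the ideal. In the quotient of `𝓗` by the ideal, the linear
span of the generators is the span of the generators of `𝓗` modulo this subspace. -/
noncomputable def linRelations : Submodule K (T.Hopf K) :=
  ((T.chargeIdeal K).restrictScalars K).map (T.Plin K)

/-- The passage to the quotient in both tensor factors. -/
noncomputable def reduce : T.Hopf K ⊗[K] T.Hopf K →ₗ[K]
    (T.Hopf K ⧸ T.linRelations K) ⊗[K] (T.Hopf K ⧸ T.linRelations K) :=
  TensorProduct.map (T.linRelations K).mkQ (T.linRelations K).mkQ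

/-- `P_lin`, applied to a series coefficient by coefficient. -/
noncomputable def linPart (A : PowerSeries (T.Hopf K)) : PowerSeries (T.Hopf K) :=
  PowerSeries.mk (fun k => T.Plin K (PowerSeries.coeff k A))

/-- The coefficient of `α^k` in the tensor product `A ⊗ B` of two series. -/
noncomputable def tensorCoeff (A B : PowerSeries (T.Hopf K)) (k : ℕ) : T.Hopf K ⊗[K] T.Hopf K :=
  ∑ p ∈ Finset.HasAntidiagonal.antidiagonal k, PowerSeries.coeff p.1 A ⊗ₜ[K] PowerSeries.coeff p.2 B

/-- `α ∂_α A`. -/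
noncomputable def euler (A : PowerSeries (T.Hopf K)) : PowerSeries (T.Hopf K) :=
  PowerSeries.X * PowerSeries.derivative (T.Hopf K) A

/-- The formal monomial `Q = ∏_v (Γ^v)^{n_v} / ∏_e (Γ^e)^{n_e / 2}` (over the vertex types `v` and the
propagator types `e` of the theory) has as its `n`-th power the charge `Q^n` read off from `γ`. -/
structure IsChargeExponent (γ : FGraph T.FieldType) (n : ℤ) (nv ne : Multiset T.FieldType → ℚ) : Prop where
  ne_zero : n ≠ 0
  vertex : ∀ v ∈ T.interactions, (n : ℚ) * nv v =
    ((Finset.univ.filter (fun w : Quotient γ.vert => γ.vertexType w = v)).card : ℚ) -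
      (if γ.res = v then 1 else 0)
  edge : ∀ e ∈ T.edges, (n : ℚ) * (ne e / 2) =
    ((γ.internalEdges.filter (fun l => γ.lineType l = e)).card : ℚ) +
      (if γ.res = e then 1 else 0)

/-- The combinatorial `β`-function `β_comb = n (∑_v n_v P_lin Γ^v - (1/2) ∑_e n_e P_lin Γ^e)`. -/
noncomputable def betaComb (n : ℤ) (nv ne : Multiset T.FieldType → ℚ) : PowerSeries (T.Hopf K) :=
  (n : K) • (∑ v ∈ T.interactions, (nv v : K) • T.linPart K (T.green K v) -
    (1 / 2 : K) • ∑ e ∈ T.edges, (ne e : K) • T.linPart K (T.green K e))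

end FeynmanTheory

/-! The projector `Plin` kills `1` and all products of two or more generators. Hence `Plin2` keeps,
from the coproduct of a graph, exactly the terms `γ ⊗ Γ/γ` with `γ` a connected proper divergent
subgraph.

Summing over all graphs for the amplitude `r` with weights `1/sym` amounts to a double count of
gluings. A gluing of `Z` into the place `p` of `Y`, with result `G`, is a pair of maps from the
half-edges of `Y` and of `Z` into those of `G` that respect the labelled legs. For fixed `Y`, `p`,
`Z` these gluings are the isomorphisms from one fixed graph to `G`, so the sum of their numbers over
all `G`, weighted by `1/sym G`, is `1` (`sum_card_gluing`). For fixed `G` and a fixed connected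
divergent subgraph `S`, a gluing along `S` is an isomorphism of `Y` with the contracted graph
together with a compatible one of `Z` with the subgraph, so the sum over `Y`, `p`, `Z`, weighted by
`1/(sym Y · sym Z)`, is also `1` (`sum_card_gluingAt`). Both counts rest on uniqueness of the glued
graph, of the quotient, of the place and of the leg labelling. Exchanging the sums (`sum_Plin2_gen`)
turns the linearized coproduct of the `k`-loop sum into the sum over `Y` of (`Y` divided by its
symmetry factor) in the right factor and the sum over the places of `Y` of all graphs that fit there
in the left factor.

That left factor is the linear part of `X_Y = ∏ Γ^v / ∏ Γ^e` (`sum_place_c`): edges occur in the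
denominator, and this sign cancels the minus sign in the series of a propagator.

It remains to see that `P_lin X_Y = P_lin Γ^r + |Y| P_lin Q` modulo the linear parts of the
relations (`coeff_typeSum_mem_linRelations`). For a skeleton graph this is the linear part of a
generator of the ideal. The difference of the two sides is additive when a subgraph `γ` is
contracted: `P_lin X_Γ` is the sum over `Γ/γ` and `γ`, corrected by `P_lin Γ^{res γ}`
(`Glues.typeSum_add`), the loop numbers add up, and the residue of `Γ` is that of `Γ/γ`. Since every
graph without divergent subgraphs is primitive, induction on the number of loops covers all 1PI
graphs with residue in `R`. The factor `|Y|` becomes the derivation `α ∂_α` in the right tensor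
factor.

The second statement holds because all series involved have augmentation `1`, so that `Plin` turns
products into sums and inverses into negatives; it then only compares exponents. -/

theorem Setoid.sup_eq_top_iff_invariant {α : Type*} (s t : Setoid α) :
    s ⊔ t = ⊤ ↔ ∀ P : α → Prop, (∀ a b, s a b → P a → P b) → (∀ a b, t a b → P a → P b) →
      ∀ a b, P a → P b := by
  constructor
  · intro h P hs ht a b ha
    -- A predicate invariant under both relations is constant on the classes of their join.
    have hle : s ⊔ t ≤ Setoid.ker P := by
      refine sup_le ?_ ?_
      · intro x y hxy
        exact propext ⟨hs x y hxy, hs y x (s.symm' hxy)⟩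
      · intro x y hxy
        exact propext ⟨ht x y hxy, ht y x (t.symm' hxy)⟩
    have hab : (s ⊔ t) a b := by rw [h]; trivial
    have : P a = P b := hle hab
    exact this ▸ ha
  · intro h
    refine Setoid.eq_top_iff.2 ?_
    intro a b
    refine h (fun x => (s ⊔ t) a x) ?_ ?_ a b ((s ⊔ t).refl' a)
    · intro x y hxy hx
      exact (s ⊔ t).trans' hx ((le_sup_left : s ≤ s ⊔ t) hxy)
    · intro x y hxy hx
      exact (s ⊔ t).trans' hx ((le_sup_right : t ≤ s ⊔ t) hxy)

/-! ### Types of vertices and lines; connectedness in terms of cuts -/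

namespace FGraph

variable {F : Type}

section Blocks

/-- The multiset of types of the blocks that meet `U`. -/
noncomputable def blockTypes (Γ : FGraph F) (s : Setoid Γ.H) (U : Γ.H → Prop) :
    Multiset (Multiset F) :=
  (Finset.univ.filter (fun q : Quotient s => ∃ h, U h ∧ Quotient.mk s h = q)).val.map (Γ.block s)

theorem mem_blockTypes {Γ : FGraph F} {s : Setoid Γ.H} {U : Γ.H → Prop} {τ : Multiset F} :
    τ ∈ Γ.blockTypes s U ↔ ∃ h, U h ∧ Γ.block s (Quotient.mk s h) = τ := by
  simp only [blockTypes, Multiset.mem_map, Finset.mem_val, Finset.mem_filter, Finset.mem_univ,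
    true_and]
  constructor
  · rintro ⟨q, ⟨h, hU, rfl⟩, rfl⟩
    exact ⟨h, hU, rfl⟩
  · rintro ⟨h, hU, rfl⟩
    exact ⟨_, ⟨h, hU, rfl⟩, rfl⟩

theorem blockTypes_congr {Γ : FGraph F} {s : Setoid Γ.H} {U V : Γ.H → Prop}
    (h : ∀ x, U x ↔ V x) : Γ.blockTypes s U = Γ.blockTypes s V := by
  have : U = V := funext fun x => propext (h x)
  rw [this]

/-- The hypothesis excludes a block meeting both sets, which would be counted twice on the right. -/
theorem blockTypes_or {Γ : FGraph F} {s : Setoid Γ.H} {U V : Γ.H → Prop}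
    (h : ∀ x y, s x y → U x → ¬ V y) :
    Γ.blockTypes s (fun x => U x ∨ V x) = Γ.blockTypes s U + Γ.blockTypes s V := by
  unfold blockTypes
  rw [← Multiset.map_add]
  congr 1
  have hd : Disjoint (Finset.univ.filter (fun q : Quotient s => ∃ h, U h ∧ Quotient.mk s h = q))
      (Finset.univ.filter (fun q : Quotient s => ∃ h, V h ∧ Quotient.mk s h = q)) := by
    rw [Finset.disjoint_left]
    intro q hq hq'
    simp only [Finset.mem_filter, Finset.mem_univ, true_and] at hq hq'
    obtain ⟨x, hx, rfl⟩ := hq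
    obtain ⟨y, hy, hxy⟩ := hq'
    exact h x y (s.symm' (Quotient.exact hxy)) hx hy
  rw [← Finset.disjUnion_val _ _ hd]
  congr 1
  ext q
  simp only [Finset.mem_filter, Finset.mem_univ, true_and, Finset.mem_disjUnion]
  constructor
  · rintro ⟨x, hU | hV, hq⟩
    · exact Or.inl ⟨x, hU, hq⟩
    · exact Or.inr ⟨x, hV, hq⟩
  · rintro (⟨x, hU, hq⟩ | ⟨x, hU, hq⟩)
    · exact ⟨x, Or.inl hU, hq⟩
    · exact ⟨x, Or.inr hU, hq⟩

theorem blockTypes_eq_singleton {Γ : FGraph F} {s : Setoid Γ.H} {U : Γ.H → Prop}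
    (q : Quotient s) (h : ∀ x, U x ↔ Quotient.mk s x = q) : Γ.blockTypes s U = {Γ.block s q} := by
  unfold blockTypes
  have : (Finset.univ.filter (fun q : Quotient s => ∃ h, U h ∧ Quotient.mk s h = q)) = {q} := by
    ext q'
    simp only [Finset.mem_filter, Finset.mem_univ, true_and, Finset.mem_singleton]
    constructor
    · rintro ⟨x, hx, rfl⟩
      exact (h x).1 hx
    · rintro rfl
      obtain ⟨x, rfl⟩ := Quotient.exists_rep q'
      exact ⟨x, (h x).2 rfl, rfl⟩
  rw [this]
  simp

theorem block_transfer {Γ Γ' : FGraph F} {s : Setoid Γ.H} {t : Setoid Γ'.H} {i : Γ.H → Γ'.H}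
    {h : Γ.H} (hf : ∀ x, s h x → Γ'.field (i x) = Γ.field x)
    (hi : ∀ x y, s h x → s h y → i x = i y → x = y)
    (hr : ∀ y, t (i h) y ↔ ∃ x, i x = y ∧ s h x) :
    Γ'.block t (Quotient.mk t (i h)) = Γ.block s (Quotient.mk s h) := by
  unfold block
  symm
  refine Multiset.map_eq_map_of_bij_of_nodup _ _ (Finset.nodup _) (Finset.nodup _)
    (fun x _ => i x) ?_ ?_ ?_ ?_
  · intro x hx
    simp only [Finset.mem_val, Finset.mem_filter, Finset.mem_univ, true_and] at hx ⊢
    exact Quotient.sound (t.symm' ((hr _).2 ⟨x, rfl, s.symm' (Quotient.exact hx)⟩))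
  · intro x hx y hy hxy
    simp only [Finset.mem_val, Finset.mem_filter, Finset.mem_univ, true_and] at hx hy
    exact hi x y (s.symm' (Quotient.exact hx)) (s.symm' (Quotient.exact hy)) hxy
  · intro y hy
    simp only [Finset.mem_val, Finset.mem_filter, Finset.mem_univ, true_and] at hy
    obtain ⟨x, rfl, hx⟩ := (hr y).1 (t.symm' (Quotient.exact hy))
    refine ⟨x, ?_, rfl⟩
    simp only [Finset.mem_val, Finset.mem_filter, Finset.mem_univ, true_and]
    exact Quotient.sound (s.symm' hx)
  · intro x hx
    simp only [Finset.mem_val, Finset.mem_filter, Finset.mem_univ, true_and] at hx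
    exact (hf x (s.symm' (Quotient.exact hx))).symm

/-- Since `U` is a union of blocks and `i` carries the block of each of its points onto a block
inside the image `V`, it induces a type-preserving bijection of blocks. All later comparisons of the
vertices and lines of two graphs go through this. -/
theorem blockTypes_transfer {Γ Γ' : FGraph F} {s : Setoid Γ.H} {t : Setoid Γ'.H} {i : Γ.H → Γ'.H}
    {U : Γ.H → Prop} {V : Γ'.H → Prop} (hf : ∀ x, U x → Γ'.field (i x) = Γ.field x)
    (hi : ∀ x y, U x → U y → i x = i y → x = y)
    (hV : ∀ y, V y ↔ ∃ x, i x = y ∧ U x) (hU : ∀ x y, s x y → U x → U y)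
    (hr : ∀ x y, U x → (t (i x) y ↔ ∃ z, i z = y ∧ s x z)) :
    Γ'.blockTypes t V = Γ.blockTypes s U := by
  have key : ∀ x, U x → Γ'.block t (Quotient.mk t (i x)) = Γ.block s (Quotient.mk s x) := by
    intro x hx
    exact block_transfer (fun y hy => hf y (hU x y hy hx))
      (fun y z hy hz => hi y z (hU x y hy hx) (hU x z hz hx)) (fun y => hr x y hx)
  unfold blockTypes
  symm
  refine Multiset.map_eq_map_of_bij_of_nodup _ _ (Finset.nodup _) (Finset.nodup _)
    (fun q _ => Quotient.mk t (i q.out)) ?_ ?_ ?_ ?_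
  · intro q hq
    simp only [Finset.mem_val, Finset.mem_filter, Finset.mem_univ, true_and] at hq ⊢
    obtain ⟨x, hx, rfl⟩ := hq
    refine ⟨_, (hV _).2 ⟨_, rfl, hU _ _ (s.symm' (Quotient.exact (Quotient.out_eq _))) hx⟩, rfl⟩
  · intro q hq q' hq' h
    simp only [Finset.mem_val, Finset.mem_filter, Finset.mem_univ, true_and] at hq hq'
    obtain ⟨x, hx, rfl⟩ := hq
    obtain ⟨x', hx', rfl⟩ := hq'
    have h1 := hU _ _ (s.symm' (Quotient.exact (Quotient.out_eq (Quotient.mk s x)))) hx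
    have h2 := hU _ _ (s.symm' (Quotient.exact (Quotient.out_eq (Quotient.mk s x')))) hx'
    obtain ⟨z, hz, hz'⟩ := (hr _ _ h1).1 (Quotient.exact h)
    have := hi _ _ (hU _ _ hz' h1) h2 hz
    rw [← Quotient.out_eq (Quotient.mk s x), ← Quotient.out_eq (Quotient.mk s x'), ← this]
    exact Quotient.sound hz'
  · intro q hq
    simp only [Finset.mem_val, Finset.mem_filter, Finset.mem_univ, true_and] at hq
    obtain ⟨y, hy, rfl⟩ := hq
    obtain ⟨x, rfl, hx⟩ := (hV y).1 hy
    refine ⟨Quotient.mk s x, ?_, ?_⟩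
    · simp only [Finset.mem_val, Finset.mem_filter, Finset.mem_univ, true_and]
      exact ⟨x, hx, rfl⟩
    · refine Quotient.sound (t.symm' ((hr x _ hx).2 ⟨_, rfl, ?_⟩))
      exact s.symm' (Quotient.exact (Quotient.out_eq (Quotient.mk s x)))
  · intro q hq
    simp only [Finset.mem_val, Finset.mem_filter, Finset.mem_univ, true_and] at hq
    obtain ⟨x, hx, rfl⟩ := hq
    rw [key _ (hU _ _ (s.symm' (Quotient.exact (Quotient.out_eq _))) hx), Quotient.out_eq]

theorem card_block {Γ : FGraph F} {s : Setoid Γ.H} (h : Γ.H) :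
    (Γ.block s (Quotient.mk s h)).card = (Finset.univ.filter (fun x => s h x)).card := by
  unfold block
  rw [Multiset.card_map, Finset.card_val]
  congr 1
  ext x
  simp only [Finset.mem_filter, Finset.mem_univ, true_and]
  exact ⟨fun e => s.symm' (Quotient.exact e), fun e => Quotient.sound (s.symm' e)⟩

end Blocks

/-- The types of all vertices. -/
noncomputable def vertexTypes (Γ : FGraph F) : Multiset (Multiset F) :=
  Γ.blockTypes Γ.vert (fun _ => True)

/-- The types of the lines that are not external legs. -/
noncomputable def innerTypes (Γ : FGraph F) : Multiset (Multiset F) :=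
  Γ.blockTypes Γ.line (fun h => ¬ Γ.IsLeg h)

theorem vertexTypes_eq (Γ : FGraph F) : Γ.vertexTypes = Finset.univ.val.map Γ.vertexType := by
  unfold vertexTypes blockTypes vertexType
  congr 2
  ext q
  simp only [Finset.mem_filter, Finset.mem_univ, true_and, iff_true]
  exact Quotient.exists_rep q

theorem card_vertexTypes (Γ : FGraph F) :
    Γ.vertexTypes.card = Fintype.card (Quotient Γ.vert) := by
  rw [vertexTypes_eq, Multiset.card_map]
  rfl

theorem IsLeg.of_line {Γ : FGraph F} {a b : Γ.H} (h : Γ.IsLeg a) (hl : Γ.line a b) : Γ.IsLeg b := by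
  rwa [h b hl]

theorem lineType_of_isLeg {Γ : FGraph F} {h : Γ.H} (hl : Γ.IsLeg h) :
    Γ.lineType (Quotient.mk Γ.line h) = {Γ.field h} := by
  unfold lineType block
  have : Finset.univ.filter (fun x => Quotient.mk Γ.line x = Quotient.mk Γ.line h) = {h} := by
    ext x
    simp only [Finset.mem_filter, Finset.mem_univ, true_and, Finset.mem_singleton]
    constructor
    · intro e
      exact hl x (Γ.line.symm' (Quotient.exact e))
    · rintro rfl
      rfl
  rw [this]
  simp

theorem one_lt_card_lineType {Γ : FGraph F} {h : Γ.H} (hl : ¬ Γ.IsLeg h) :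
    1 < (Γ.lineType (Quotient.mk Γ.line h)).card := by
  unfold lineType
  rw [card_block, Finset.one_lt_card]
  unfold IsLeg at hl
  push Not at hl
  obtain ⟨h', h1, h2⟩ := hl
  exact ⟨h, by simp, h', by simp [h1], fun e => h2 e.symm⟩

theorem mk_mem_internalEdges_iff {Γ : FGraph F} {h : Γ.H} :
    Quotient.mk Γ.line h ∈ Γ.internalEdges ↔
      (Finset.univ.filter (fun x => Γ.line h x)).card = 2 := by
  rw [← card_block]
  simp only [internalEdges, Finset.mem_filter, Finset.mem_univ, true_and]
  rfl

/-- All lines which are not external legs consist of two half-edges. -/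
def InnerPairs (Γ : FGraph F) : Prop := ∀ τ ∈ Γ.innerTypes, τ.card = 2

/-- A leg is alone on its line and `InnerPairs` rules out lines with more than two half-edges, so
the two notions are complementary. -/
theorem InnerPairs.mem_internalEdges {Γ : FGraph F} (hΓ : Γ.InnerPairs) {h : Γ.H} :
    Quotient.mk Γ.line h ∈ Γ.internalEdges ↔ ¬ Γ.IsLeg h := by
  simp only [internalEdges, Finset.mem_filter, Finset.mem_univ, true_and]
  constructor
  · intro h2 hl
    rw [lineType_of_isLeg hl] at h2
    simp at h2
  · intro hl
    exact hΓ _ (mem_blockTypes.2 ⟨h, hl, rfl⟩)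

theorem InnerPairs.innerTypes_eq {Γ : FGraph F} (hΓ : Γ.InnerPairs) :
    Γ.innerTypes = Γ.internalEdges.val.map Γ.lineType := by
  unfold innerTypes blockTypes lineType
  congr 2
  ext q
  simp only [Finset.mem_filter, Finset.mem_univ, true_and]
  constructor
  · rintro ⟨h, hl, rfl⟩
    exact hΓ.mem_internalEdges.2 hl
  · obtain ⟨h, rfl⟩ := Quotient.exists_rep q
    intro hq
    exact ⟨h, hΓ.mem_internalEdges.1 hq, rfl⟩

theorem InnerPairs.card_innerTypes {Γ : FGraph F} (hΓ : Γ.InnerPairs) :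
    Γ.innerTypes.card = Γ.internalEdges.card := by
  rw [hΓ.innerTypes_eq, Multiset.card_map]
  rfl

theorem InnerPairs.exists_partner {Γ : FGraph F} (hΓ : Γ.InnerPairs) {h : Γ.H}
    (hl : ¬ Γ.IsLeg h) :
    ∃ h', h' ≠ h ∧ Γ.line h h' ∧ (∀ x, Γ.line h x → x = h ∨ x = h') ∧
      Γ.lineType (Quotient.mk Γ.line h) = {Γ.field h, Γ.field h'} := by
  have h2 : (Γ.lineType (Quotient.mk Γ.line h)).card = 2 := hΓ _ (mem_blockTypes.2 ⟨h, hl, rfl⟩)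
  have h3 := h2
  unfold lineType at h2
  rw [card_block] at h2
  have hl' := hl
  unfold IsLeg at hl
  push Not at hl
  obtain ⟨h', h1, hne⟩ := hl
  have hs : Finset.univ.filter (fun x => Γ.line h x) = {h, h'} := by
    symm
    apply Finset.eq_of_subset_of_card_le
    · intro x
      simp only [Finset.mem_insert, Finset.mem_singleton, Finset.mem_filter, Finset.mem_univ,
        true_and]
      rintro (rfl | rfl)
      · exact Γ.line.refl' _
      · exact h1
    · rw [h2, Finset.card_pair hne.symm]
  refine ⟨h', hne, h1, ?_, ?_⟩
  · intro x hx
    have : x ∈ Finset.univ.filter (fun x => Γ.line h x) := by simp [hx]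
    rw [hs] at this
    simpa using this
  · unfold lineType block
    have : Finset.univ.filter (fun x => Quotient.mk Γ.line x = Quotient.mk Γ.line h) = {h, h'} := by
      rw [← hs]
      ext x
      simp only [Finset.mem_filter, Finset.mem_univ, true_and]
      exact ⟨fun e => Γ.line.symm' (Quotient.exact e), fun e => Quotient.sound (Γ.line.symm' e)⟩
    rw [this, Finset.insert_val_of_notMem (by simpa using hne.symm)]
    simp

theorem InnerPairs.not_isLeg {Γ : FGraph F} {h h' : Γ.H} (hl : Γ.line h h') (hne : h' ≠ h) :
    ¬ Γ.IsLeg h := fun H => hne (H h' hl)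

/-- Connectedness, in terms of cuts. -/
def CutConnected (Γ : FGraph F) : Prop :=
  ∀ P : Γ.H → Prop, (∀ a b, Γ.vert a b → P a → P b) → (∀ a b, Γ.line a b → P a → P b) →
    ∀ a b, P a → P b

/-- Absence of bridges, in terms of cuts. -/
def CutBridgeless (Γ : FGraph F) : Prop :=
  ∀ h, ¬ Γ.IsLeg h → ∀ P : Γ.H → Prop, (∀ a b, Γ.vert a b → P a → P b) →
    (∀ a b, Γ.line a b → ¬ Γ.line h a → P a → P b) → ∀ a b, P a → P b

/-- In the form with predicates no path has to be followed through a gluing: a predicate on the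
large graph restricts to the two parts, and predicates on the parts extend to it. -/
theorem isConnected_iff (Γ : FGraph F) : Γ.IsConnected ↔ Nonempty Γ.H ∧ Γ.CutConnected := by
  unfold IsConnected CutConnected
  rw [Setoid.sup_eq_top_iff_invariant]

theorem InnerPairs.isBridgeless_iff {Γ : FGraph F} (hΓ : Γ.InnerPairs) :
    Γ.IsBridgeless ↔ Γ.CutBridgeless := by
  unfold IsBridgeless CutBridgeless
  constructor
  · intro H h hl P hv hP
    refine (Setoid.sup_eq_top_iff_invariant _ _).1 (H _ (hΓ.mem_internalEdges.2 hl)) P hv ?_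
    rintro a b (rfl | ⟨h1, h2⟩) ha
    · exact ha
    · exact hP a b h1 (fun e => h2 (Quotient.sound (Γ.line.symm' e))) ha
  · intro H e he
    obtain ⟨h, rfl⟩ := Quotient.exists_rep e
    rw [Setoid.sup_eq_top_iff_invariant]
    intro P hv hP
    refine H h (hΓ.mem_internalEdges.1 he) P hv ?_
    intro a b h1 h2 ha
    exact hP a b (Or.inr ⟨h1, fun e => h2 (Γ.line.symm' (Quotient.exact e))⟩) ha

/-! ### Invariance under isomorphisms -/

section Iso

variable {Γ Γ' : FGraph F}

theorem Iso.isLeg_iff (φ : Iso Γ Γ') (h : Γ.H) : Γ'.IsLeg (φ.1 h) ↔ Γ.IsLeg h := by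
  constructor
  · intro H x hx
    exact φ.1.injective (H _ ((φ.2.2.2 _ _).2 hx))
  · intro H y hy
    obtain ⟨x, rfl⟩ := φ.1.surjective y
    rw [H x ((φ.2.2.2 _ _).1 hy)]

theorem Iso.vertexTypes_eq (φ : Iso Γ Γ') : Γ'.vertexTypes = Γ.vertexTypes := by
  refine blockTypes_transfer (i := φ.1) (fun x _ => φ.2.1 x) (fun x y _ _ h => φ.1.injective h)
    ?_ (fun _ _ _ _ => trivial) ?_
  · intro y
    simp only [true_iff, and_true]
    exact φ.1.surjective y
  · intro x y _
    obtain ⟨y, rfl⟩ := φ.1.surjective y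
    simp [φ.2.2.1]

theorem Iso.innerTypes_eq (φ : Iso Γ Γ') : Γ'.innerTypes = Γ.innerTypes := by
  refine blockTypes_transfer (i := φ.1) (fun x _ => φ.2.1 x) (fun x y _ _ h => φ.1.injective h)
    ?_ (fun _ _ h h1 h2 => h1 (h2.of_line (Γ.line.symm' h))) ?_
  · intro y
    obtain ⟨y, rfl⟩ := φ.1.surjective y
    simp [φ.isLeg_iff]
  · intro x y _
    obtain ⟨y, rfl⟩ := φ.1.surjective y
    simp [φ.2.2.2]

theorem res_eq_of_legs {Γ Γ' : FGraph F} (i : Γ.H → Γ'.H)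
    (hf : ∀ x, Γ.IsLeg x → Γ'.field (i x) = Γ.field x)
    (hi : ∀ x y, Γ.IsLeg x → Γ.IsLeg y → i x = i y → x = y)
    (h : ∀ y, Γ'.IsLeg y ↔ ∃ x, i x = y ∧ Γ.IsLeg x) : Γ'.res = Γ.res := by
  unfold res
  symm
  refine Multiset.map_eq_map_of_bij_of_nodup _ _ (Finset.nodup _) (Finset.nodup _)
    (fun x _ => i x) ?_ ?_ ?_ ?_
  · intro x hx
    simp only [Finset.mem_val, Finset.mem_filter, Finset.mem_univ, true_and] at hx ⊢
    exact (h _).2 ⟨x, rfl, hx⟩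
  · intro x hx y hy hxy
    simp only [Finset.mem_val, Finset.mem_filter, Finset.mem_univ, true_and] at hx hy
    exact hi x y hx hy hxy
  · intro y hy
    simp only [Finset.mem_val, Finset.mem_filter, Finset.mem_univ, true_and] at hy
    obtain ⟨x, rfl, hx⟩ := (h y).1 hy
    refine ⟨x, ?_, rfl⟩
    simpa using hx
  · intro x hx
    simp only [Finset.mem_val, Finset.mem_filter, Finset.mem_univ, true_and] at hx
    exact (hf x hx).symm

theorem Iso.res_eq (φ : Iso Γ Γ') : Γ'.res = Γ.res := by
  refine res_eq_of_legs φ.1 (fun x _ => φ.2.1 x) (fun x y _ _ h => φ.1.injective h) ?_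
  intro y
  obtain ⟨y, rfl⟩ := φ.1.surjective y
  simp [φ.isLeg_iff]

theorem Iso.cutConnected (φ : Iso Γ Γ') (h : Γ.CutConnected) : Γ'.CutConnected := by
  intro P hv hl a b ha
  have := h (fun x => P (φ.1 x)) (fun a b e => hv _ _ ((φ.2.2.1 _ _).2 e))
    (fun a b e => hl _ _ ((φ.2.2.2 _ _).2 e)) (φ.1.symm a) (φ.1.symm b)
  simpa using this (by simpa using ha)

theorem Iso.cutBridgeless (φ : Iso Γ Γ') (h : Γ.CutBridgeless) : Γ'.CutBridgeless := by
  intro x hx P hv hl a b ha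
  obtain ⟨x, rfl⟩ := φ.1.surjective x
  rw [φ.isLeg_iff] at hx
  have := h x hx (fun x => P (φ.1 x)) (fun a b e => hv _ _ ((φ.2.2.1 _ _).2 e))
    (fun a b e e' => hl _ _ ((φ.2.2.2 _ _).2 e) (fun h => e' ((φ.2.2.2 _ _).1 h)))
    (φ.1.symm a) (φ.1.symm b)
  simpa using this (by simpa using ha)

end Iso

end FGraph

/-! ### 1PI graphs in terms of types and cuts -/

namespace FeynmanTheory

variable {T : FeynmanTheory}

theorem card_of_mem_edges {τ : Multiset T.FieldType} (h : τ ∈ T.edges) : τ.card = 2 := by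
  simp only [edges, Finset.mem_image, Finset.mem_univ, true_and] at h
  obtain ⟨f, rfl⟩ := h
  simp

/-- Every condition is expressed by data that can be computed for a glued graph: the multisets of
vertex and line types, cuts, and the residue. With truncated subtraction, `1 ≤ E + 1 - V` says `V ≤
E`. -/
theorem isOnePI_iff {Γ : FGraph T.FieldType} : T.IsOnePI Γ ↔
    (∀ τ ∈ Γ.vertexTypes, τ ∈ T.interactions) ∧ (∀ τ ∈ Γ.innerTypes, τ ∈ T.edges) ∧
    Nonempty Γ.H ∧ Γ.CutConnected ∧ Γ.CutBridgeless ∧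
    Γ.vertexTypes.card ≤ Γ.innerTypes.card ∧ 2 ≤ Γ.res.card := by
  have hpair : (∀ τ ∈ Γ.innerTypes, τ ∈ T.edges) → Γ.InnerPairs :=
    fun h τ hτ => card_of_mem_edges (h τ hτ)
  constructor
  · intro h
    have hE : ∀ τ ∈ Γ.innerTypes, τ ∈ T.edges := by
      intro τ hτ
      obtain ⟨x, hx, rfl⟩ := FGraph.mem_blockTypes.1 hτ
      rcases h.lines (Quotient.mk _ x) with ⟨f, hf⟩ | h2
      · have := FGraph.one_lt_card_lineType hx
        rw [hf] at this
        simp at this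
      · exact h2
    have hp := hpair hE
    refine ⟨?_, hE, h.connected.1, ((FGraph.isConnected_iff _).1 h.connected).2,
      hp.isBridgeless_iff.1 h.bridgeless, ?_, h.two_le_legs⟩
    · intro τ hτ
      obtain ⟨x, -, rfl⟩ := FGraph.mem_blockTypes.1 hτ
      exact h.vertices _
    · have := h.one_le_loops
      unfold FGraph.loops at this
      rw [hp.card_innerTypes, FGraph.card_vertexTypes]
      omega
  · rintro ⟨hV, hE, hne, hc, hb, hVE, hleg⟩
    have hp := hpair hE
    refine ⟨?_, ?_, (FGraph.isConnected_iff _).2 ⟨hne, hc⟩, hp.isBridgeless_iff.2 hb, ?_, hleg⟩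
    · intro v
      obtain ⟨x, rfl⟩ := Quotient.exists_rep v
      exact hV _ (FGraph.mem_blockTypes.2 ⟨x, trivial, rfl⟩)
    · intro e
      obtain ⟨x, rfl⟩ := Quotient.exists_rep e
      by_cases hx : Γ.IsLeg x
      · exact Or.inl ⟨_, FGraph.lineType_of_isLeg hx⟩
      · exact Or.inr (hE _ (FGraph.mem_blockTypes.2 ⟨x, hx, rfl⟩))
    · unfold FGraph.loops
      rw [hp.card_innerTypes, FGraph.card_vertexTypes] at hVE
      omega

section

variable {Γ Γ' : FGraph T.FieldType}

theorem IsOnePI.innerTypes_mem (h : T.IsOnePI Γ) : ∀ τ ∈ Γ.innerTypes, τ ∈ T.edges :=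
  (isOnePI_iff.1 h).2.1

theorem IsOnePI.vertexTypes_mem (h : T.IsOnePI Γ) : ∀ τ ∈ Γ.vertexTypes, τ ∈ T.interactions :=
  (isOnePI_iff.1 h).1

theorem IsOnePI.innerPairs (h : T.IsOnePI Γ) : Γ.InnerPairs :=
  fun τ hτ => card_of_mem_edges (h.innerTypes_mem τ hτ)

theorem IsOnePI.cutConnected (h : T.IsOnePI Γ) : Γ.CutConnected := (isOnePI_iff.1 h).2.2.2.1

theorem IsOnePI.cutBridgeless (h : T.IsOnePI Γ) : Γ.CutBridgeless := (isOnePI_iff.1 h).2.2.2.2.1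

theorem IsOnePI.card_vertexTypes_le (h : T.IsOnePI Γ) :
    Γ.vertexTypes.card ≤ Γ.innerTypes.card := (isOnePI_iff.1 h).2.2.2.2.2.1

/-- Since `V ≤ E`, the truncated subtraction in the definition of the loop number is exact. -/
theorem IsOnePI.loops_add (h : T.IsOnePI Γ) :
    Γ.loops + Γ.vertexTypes.card = Γ.innerTypes.card + 1 := by
  have h1 := h.card_vertexTypes_le
  unfold FGraph.loops
  rw [h.innerPairs.card_innerTypes, FGraph.card_vertexTypes] at *
  omega

/-- There is a vertex, and at least as many inner lines as vertices. -/
theorem IsOnePI.exists_not_isLeg (h : T.IsOnePI Γ) : ∃ x, ¬ Γ.IsLeg x := by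
  by_contra! H
  have h1 := h.card_vertexTypes_le
  obtain ⟨x⟩ := h.connected.1
  have h2 : Γ.innerTypes = 0 := by
    rw [Multiset.eq_zero_iff_forall_notMem]
    intro τ hτ
    obtain ⟨y, hy, -⟩ := FGraph.mem_blockTypes.1 hτ
    exact hy (H y)
  have h3 : Γ.vertexTypes = 0 := by
    rw [← Multiset.card_eq_zero]
    rw [h2] at h1
    simpa using h1
  have : Γ.block Γ.vert (Quotient.mk _ x) ∈ Γ.vertexTypes :=
    FGraph.mem_blockTypes.2 ⟨x, trivial, rfl⟩
  rw [h3] at this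
  simp at this

theorem IsOnePI.three_le_card_vertex (h : T.IsOnePI Γ) (x : Γ.H) :
    3 ≤ (Finset.univ.filter (fun y => Γ.vert x y)).card := by
  rw [← FGraph.card_block]
  exact T.three_le_card _ (h.vertices _)

theorem IsOnePI.of_iso (φ : FGraph.Iso Γ Γ') (h : T.IsOnePI Γ) : T.IsOnePI Γ' := by
  obtain ⟨h1, h2, ⟨x⟩, h4, h5, h6, h7⟩ := isOnePI_iff.1 h
  refine isOnePI_iff.2 ⟨?_, ?_, ⟨φ.1 x⟩, φ.cutConnected h4, φ.cutBridgeless h5, ?_, ?_⟩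
  · rwa [φ.vertexTypes_eq]
  · rwa [φ.innerTypes_eq]
  · rwa [φ.vertexTypes_eq, φ.innerTypes_eq]
  · rwa [φ.res_eq]

theorem IsOnePI.loops_eq_of_iso (φ : FGraph.Iso Γ Γ') (h : T.IsOnePI Γ) :
    Γ'.loops = Γ.loops := by
  have h1 := h.loops_add
  have h2 := (h.of_iso φ).loops_add
  rw [φ.vertexTypes_eq, φ.innerTypes_eq] at h2
  omega

theorem gen_eq_of_iso {K : Type*} [Field K] (φ : FGraph.Iso Γ Γ') :
    T.gen K Γ = T.gen K Γ' := by
  unfold gen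
  by_cases h : T.IsOnePI Γ
  · have h' := h.of_iso φ
    rw [dif_pos h, dif_pos h']
    congr 1
    exact Quotient.sound ⟨φ⟩
  · have h' : ¬ T.IsOnePI Γ' := fun h' => h (h'.of_iso φ.symm)
    rw [dif_neg h, dif_neg h']

end

end FeynmanTheory

/-! ### Subgraphs as embedded graphs -/

namespace FGraph

variable {F : Type}

/-- `j` identifies `γ` with a subgraph of `Γ`: vertices with all their half-edges, and some of the
lines between them. -/
structure Embeds (γ Γ : FGraph F) (j : γ.H → Γ.H) : Prop where
  inj : Function.Injective j
  field : ∀ b, Γ.field (j b) = γ.field b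
  vert : ∀ b h, Γ.vert (j b) h ↔ ∃ b', j b' = h ∧ γ.vert b b'
  line : ∀ b, ¬ γ.IsLeg b → ∀ h, (Γ.line (j b) h ↔ ∃ b', j b' = h ∧ γ.line b b')

/-- The lines of `Γ` that come from the inner lines of `γ`. -/
noncomputable def edgeSet {γ Γ : FGraph F} (j : γ.H → Γ.H) : Finset (Quotient Γ.line) :=
  Finset.univ.filter (fun q => ∃ b, ¬ γ.IsLeg b ∧ Quotient.mk Γ.line (j b) = q)

namespace Embeds

variable {γ Γ : FGraph F} {j : γ.H → Γ.H} (hj : Embeds γ Γ j)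

include hj

theorem vert_iff (b b' : γ.H) : Γ.vert (j b) (j b') ↔ γ.vert b b' := by
  rw [hj.vert]
  constructor
  · rintro ⟨c, hc, h⟩
    rwa [← hj.inj hc]
  · exact fun h => ⟨b', rfl, h⟩

theorem line_iff {b : γ.H} (hb : ¬ γ.IsLeg b) (b' : γ.H) :
    Γ.line (j b) (j b') ↔ γ.line b b' := by
  rw [hj.line b hb]
  constructor
  · rintro ⟨c, hc, h⟩
    rwa [← hj.inj hc]
  · exact fun h => ⟨b', rfl, h⟩

theorem line_of_line {b b' : γ.H} (h : γ.line b b') : Γ.line (j b) (j b') := by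
  by_cases hb : γ.IsLeg b
  · rw [hb b' h]
  · exact (hj.line_iff hb b').2 h

theorem not_isLeg {b : γ.H} (hb : ¬ γ.IsLeg b) : ¬ Γ.IsLeg (j b) := by
  intro H
  refine hb fun b' h => ?_
  exact hj.inj (H _ (hj.line_of_line h))

theorem mk_mem_edgeSet (h : Γ.H) :
    Quotient.mk Γ.line h ∈ edgeSet j ↔ ∃ b, j b = h ∧ ¬ γ.IsLeg b := by
  simp only [edgeSet, Finset.mem_filter, Finset.mem_univ, true_and]
  constructor
  · rintro ⟨b, hb, hq⟩
    obtain ⟨b', rfl, h⟩ := (hj.line b hb h).1 (Quotient.exact hq)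
    exact ⟨b', rfl, fun hl => hb (hl.of_line (γ.line.symm' h))⟩
  · rintro ⟨b, rfl, hb⟩
    exact ⟨b, hb, rfl⟩

/-- The edges of a connected `γ` fuse its vertices into one class and leave every other vertex
alone. This partition, written as a relation `E`, contains both generating relations; conversely,
cut-connectedness of `γ` shows that its half-edges form a single class. -/
theorem comp_iff (hc : γ.CutConnected) (h h' : Γ.H) :
    Γ.comp (edgeSet j : Set (Quotient Γ.line)) h h' ↔
      ((∃ b, j b = h) ∧ ∃ b, j b = h') ∨ ((¬ ∃ b, j b = h) ∧ Γ.vert h h') := by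
  constructor
  · let E : Setoid Γ.H :=
      { r := fun h h' => ((∃ b, j b = h) ∧ ∃ b, j b = h') ∨
          ((¬ ∃ b, j b = h) ∧ (¬ ∃ b, j b = h') ∧ Γ.vert h h')
        iseqv :=
          { refl := fun h => by
              by_cases H : ∃ b, j b = h
              · exact Or.inl ⟨H, H⟩
              · exact Or.inr ⟨H, H, Γ.vert.refl' h⟩
            symm := by
              rintro x y (⟨h1, h2⟩ | ⟨h1, h2, h3⟩)
              · exact Or.inl ⟨h2, h1⟩
              · exact Or.inr ⟨h2, h1, Γ.vert.symm' h3⟩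
            trans := by
              rintro x y z (⟨h1, h2⟩ | ⟨h1, h2, h3⟩) (⟨h4, h5⟩ | ⟨h4, h5, h6⟩)
              · exact Or.inl ⟨h1, h5⟩
              · exact absurd h2 h4
              · exact absurd h4 h2
              · exact Or.inr ⟨h1, h5, Γ.vert.trans' h3 h6⟩ } }
    have hle : Γ.comp (edgeSet j : Set (Quotient Γ.line)) ≤ E := by
      refine sup_le ?_ ?_
      · intro x y hxy
        by_cases H : ∃ b, j b = x
        · refine Or.inl ⟨H, ?_⟩
          obtain ⟨b, rfl⟩ := H
          obtain ⟨b', hb', -⟩ := (hj.vert b y).1 hxy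
          exact ⟨b', hb'⟩
        · refine Or.inr ⟨H, ?_, hxy⟩
          rintro ⟨b, rfl⟩
          obtain ⟨b', hb', -⟩ := (hj.vert b x).1 (Γ.vert.symm' hxy)
          exact H ⟨b', hb'⟩
      · rintro x y (rfl | ⟨h1, h2⟩)
        · exact E.refl' _
        · obtain ⟨b, rfl, hb⟩ := (hj.mk_mem_edgeSet x).1 h2
          obtain ⟨b', hb', -⟩ := (hj.line b hb y).1 h1
          exact Or.inl ⟨⟨b, rfl⟩, b', hb'⟩
    intro H
    rcases hle H with h1 | h1
    · exact Or.inl h1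
    · exact Or.inr ⟨h1.1, h1.2.2⟩
  · rintro (⟨⟨b, rfl⟩, b', rfl⟩ | ⟨-, h2⟩)
    · refine hc (fun x => Γ.comp (edgeSet j : Set (Quotient Γ.line)) (j b) (j x)) ?_ ?_ b b'
        (Setoid.refl' _ _)
      · intro x y hxy hx
        refine Setoid.trans' _ hx ?_
        exact (le_sup_left : Γ.vert ≤ Γ.comp _) ((hj.vert_iff x y).2 hxy)
      · intro x y hxy hx
        by_cases hl : γ.IsLeg x
        · rwa [hl y hxy]
        · refine Setoid.trans' _ hx ?_
          refine (le_sup_right : Γ.lineOn _ ≤ Γ.comp _) (Or.inr ⟨(hj.line_iff hl y).2 hxy, ?_⟩)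
          exact (hj.mk_mem_edgeSet _).2 ⟨x, rfl, hl⟩
    · exact (le_sup_left : Γ.vert ≤ Γ.comp _) h2

/-- Cutting the lines outside the edge set restores the lines of `γ`, even where two legs of `γ` lie
on a common line of `Γ`. -/
theorem lineOn_edgeSet_iff (b b' : γ.H) :
    Γ.lineOn (edgeSet j : Set (Quotient Γ.line)) (j b) (j b') ↔ γ.line b b' := by
  by_cases hb : γ.IsLeg b
  · constructor
    · rintro (h | ⟨-, h⟩)
      · rw [hj.inj h]
      · obtain ⟨b'', h1, h2⟩ := (hj.mk_mem_edgeSet (j b)).1 h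
        exact absurd (hj.inj h1 ▸ hb) h2
    · intro h
      exact Or.inl (by rw [hb b' h])
  · rw [← hj.line_iff hb]
    constructor
    · rintro (h | ⟨h, -⟩)
      · rw [h]
      · exact h
    · intro h
      exact Or.inr ⟨h, (hj.mk_mem_edgeSet _).2 ⟨b, rfl, hb⟩⟩

/-- The subgraph is isomorphic to the corresponding component. -/
theorem exists_component_iso (hc : γ.CutConnected) (b₀ : γ.H) :
    ∃ φ : Iso γ (Γ.component (edgeSet j : Set (Quotient Γ.line))
      (Quotient.mk (Γ.comp (edgeSet j : Set (Quotient Γ.line))) (j b₀))),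
      ∀ b, (φ.1 b).1 = j b := by
  have hmem : ∀ b, Quotient.mk (Γ.comp (edgeSet j : Set (Quotient Γ.line))) (j b) =
      Quotient.mk _ (j b₀) := fun b =>
    Quotient.sound ((hj.comp_iff hc _ _).2 (Or.inl ⟨⟨b, rfl⟩, b₀, rfl⟩))
  refine ⟨⟨Equiv.ofBijective (fun b => ⟨j b, hmem b⟩) ⟨?_, ?_⟩, ?_, ?_, ?_⟩, ?_⟩
  · intro b b' h
    exact hj.inj (congrArg Subtype.val h)
  · rintro ⟨h, hh⟩
    rcases (hj.comp_iff hc _ _).1 (Setoid.symm' _ (Quotient.exact hh)) with ⟨-, b, rfl⟩ | ⟨h1, -⟩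
    · exact ⟨b, rfl⟩
    · exact absurd ⟨b₀, rfl⟩ h1
  · intro b
    exact hj.field b
  · intro b b'
    exact hj.vert_iff b b'
  · intro b b'
    exact hj.lineOn_edgeSet_iff b b'
  · intro b
    rfl

theorem components_eq (hc : γ.CutConnected) {b₀ : γ.H} (hb₀ : ¬ γ.IsLeg b₀) :
    Γ.components (edgeSet j : Set (Quotient Γ.line)) =
      {Quotient.mk (Γ.comp (edgeSet j : Set (Quotient Γ.line))) (j b₀)} := by
  ext c
  simp only [components, Finset.mem_filter, Finset.mem_univ, true_and, Finset.mem_singleton]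
  constructor
  · rintro ⟨h, rfl, hh⟩
    obtain ⟨b, rfl, -⟩ := (hj.mk_mem_edgeSet h).1 hh
    exact Quotient.sound ((hj.comp_iff hc _ _).2 (Or.inl ⟨⟨b, rfl⟩, b₀, rfl⟩))
  · rintro rfl
    exact ⟨j b₀, rfl, (hj.mk_mem_edgeSet _).2 ⟨b₀, rfl, hb₀⟩⟩

/-- A component outside `γ` is a single vertex of `Γ` whose half-edges are all legs. There are at
least three of them, so only the component `γ` itself can have two legs. -/
theorem isBivalent_iff (hc : γ.CutConnected)
    (hΓ : ∀ x, 3 ≤ (Finset.univ.filter (fun y => Γ.vert x y)).card) (h : Γ.H) :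
    Γ.IsBivalent (edgeSet j : Set (Quotient Γ.line)) h ↔ (∃ b, j b = h) ∧ γ.res.card = 2 := by
  unfold IsBivalent
  by_cases H : ∃ b, j b = h
  · obtain ⟨b, rfl⟩ := H
    obtain ⟨φ, -⟩ := hj.exists_component_iso hc b
    rw [φ.res_eq]
    simp
  · refine iff_of_false ?_ (fun h => H h.1)
    have h1 := hΓ h
    intro h2
    unfold res at h2
    rw [Multiset.card_map, Finset.card_val] at h2
    have : (Finset.univ.filter (fun y => Γ.vert h y)).card ≤ 2 := by
      rw [← h2]
      refine Finset.card_le_card_of_surjOn Subtype.val ?_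
      intro y hy
      simp only [Finset.coe_filter, Finset.mem_univ, true_and, Set.mem_ofPred_eq] at hy
      have hy' : Γ.comp (edgeSet j : Set (Quotient Γ.line)) y h :=
        Setoid.symm' _ ((hj.comp_iff hc _ _).2 (Or.inr ⟨H, hy⟩))
      refine ⟨⟨y, Quotient.sound hy'⟩, ?_, rfl⟩
      simp only [Finset.coe_filter, Finset.mem_univ, true_and]
      rintro ⟨z, hz⟩ (hz' | ⟨-, hz'⟩)
      · exact Subtype.ext hz'.symm
      · obtain ⟨b, hb, -⟩ := (hj.mk_mem_edgeSet _).1 hz'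
        obtain ⟨b', hb', -⟩ := (hj.vert b h).1 (by rw [hb]; exact Γ.vert.symm' hy)
        exact absurd ⟨b', hb'⟩ H
    omega

end Embeds

/-- A component of a subgraph is a subgraph. -/
theorem embeds_component {Γ : FGraph F} (S : Set (Quotient Γ.line)) (c : Quotient (Γ.comp S)) :
    Embeds (Γ.component S c) Γ Subtype.val := by
  refine ⟨Subtype.val_injective, fun _ => rfl, ?_, ?_⟩
  · rintro ⟨b, hb⟩ h
    constructor
    · intro e
      have hc : Γ.comp S b h := (le_sup_left : Γ.vert ≤ Γ.comp S) e
      exact ⟨⟨h, by rw [← hb]; exact Quotient.sound (Setoid.symm' _ hc)⟩, rfl, e⟩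
    · rintro ⟨b', rfl, e⟩
      exact e
  · rintro ⟨b, hb⟩ hl h
    have hbS : Quotient.mk Γ.line b ∈ S := by
      by_contra H
      refine hl ?_
      rintro ⟨b', hb'⟩ (e | ⟨-, e⟩)
      · exact Subtype.ext e.symm
      · exact absurd e H
    constructor
    · intro e
      have e' : Γ.lineOn S b h := Or.inr ⟨e, hbS⟩
      have hc : Γ.comp S b h := (le_sup_right : Γ.lineOn S ≤ Γ.comp S) e'
      exact ⟨⟨h, by rw [← hb]; exact Quotient.sound (Setoid.symm' _ hc)⟩, rfl, e'⟩
    · rintro ⟨b', rfl, e | ⟨e, -⟩⟩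
      · have e : b = b'.1 := e
        exact e ▸ Γ.line.refl' b
      · exact e

theorem not_isLeg_component_iff {Γ : FGraph F} {S : Set (Quotient Γ.line)}
    (hS : ∀ h, Quotient.mk Γ.line h ∈ S → ¬ Γ.IsLeg h) (c : Quotient (Γ.comp S))
    (b : (Γ.component S c).H) :
    ¬ (Γ.component S c).IsLeg b ↔ Quotient.mk Γ.line b.1 ∈ S := by
  obtain ⟨b, hb⟩ := b
  constructor
  · intro hl
    by_contra H
    refine hl ?_
    rintro ⟨b', hb'⟩ (e | ⟨-, e⟩)
    · exact Subtype.ext e.symm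
    · exact absurd e H
  · intro h hl
    refine hS b h fun b' hb' => ?_
    have e' : Γ.lineOn S b b' := Or.inr ⟨hb', h⟩
    have hc : Γ.comp S b b' := (le_sup_right : Γ.lineOn S ≤ Γ.comp S) e'
    exact congrArg Subtype.val
      (hl ⟨b', by rw [← hb]; exact Quotient.sound (Setoid.symm' _ hc)⟩ e')

theorem mk_mem_edgeSet_component {Γ : FGraph F} {S : Set (Quotient Γ.line)}
    (hS : ∀ h, Quotient.mk Γ.line h ∈ S → ¬ Γ.IsLeg h) (c : Quotient (Γ.comp S)) (h : Γ.H) :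
    Quotient.mk Γ.line h ∈ edgeSet (γ := Γ.component S c) (Γ := Γ) Subtype.val ↔
      Quotient.mk (Γ.comp S) h = c ∧ Quotient.mk Γ.line h ∈ S := by
  rw [(embeds_component S c).mk_mem_edgeSet]
  constructor
  · rintro ⟨b, rfl, hb⟩
    exact ⟨b.2, (not_isLeg_component_iff hS c b).1 hb⟩
  · rintro ⟨h1, h2⟩
    exact ⟨⟨h, h1⟩, rfl, (not_isLeg_component_iff hS c _).2 h2⟩

/-- A subgraph is determined by its half-edges and its edges. -/
theorem Embeds.exists_iso {γ γ' Γ : FGraph F} {j : γ.H → Γ.H} {j' : γ'.H → Γ.H}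
    (hj : Embeds γ Γ j) (hj' : Embeds γ' Γ j') (hr : ∀ h, (∃ b, j b = h) ↔ ∃ b, j' b = h)
    (he : edgeSet j = edgeSet j') : ∃ φ : Iso γ γ', ∀ b, j' (φ.1 b) = j b := by
  choose f hf using fun b => (hr (j b)).1 ⟨b, rfl⟩
  -- Whether a half-edge is a leg of the subgraph can be read off from the edge set: its line must
  -- not belong to it.
  have hleg : ∀ b, γ'.IsLeg (f b) ↔ γ.IsLeg b := by
    intro b
    rw [← not_iff_not]
    have h1 := hj.mk_mem_edgeSet (j b)
    have h2 := hj'.mk_mem_edgeSet (j b)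
    rw [he, h2] at h1
    constructor
    · intro H
      obtain ⟨b', e, hb'⟩ := h1.1 ⟨f b, hf b, H⟩
      rwa [← hj.inj e]
    · intro H
      obtain ⟨b', e, hb'⟩ := h1.2 ⟨b, rfl, H⟩
      rwa [← hj'.inj (e.trans (hf b).symm)]
  refine ⟨⟨Equiv.ofBijective f ⟨?_, ?_⟩, ?_, ?_, ?_⟩, hf⟩
  · intro b b' h
    exact hj.inj (by rw [← hf, ← hf, h])
  · intro b'
    obtain ⟨b, hb⟩ := (hr (j' b')).2 ⟨b', rfl⟩
    exact ⟨b, hj'.inj (by rw [hf, hb])⟩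
  · intro b
    change γ'.field (f b) = _
    rw [← hj'.field, hf, hj.field]
  · intro b b'
    change γ'.vert (f b) (f b') ↔ _
    rw [← hj'.vert_iff, hf, hf, hj.vert_iff]
  · intro b b'
    change γ'.line (f b) (f b') ↔ _
    by_cases hb : γ.IsLeg b
    · constructor
      · intro h
        have := (hleg b).2 hb _ h
        have e : j b' = j b := by rw [← hf, ← hf, this]
        rw [hj.inj e]
      · intro h
        rw [hb b' h]
    · rw [← hj'.line_iff (fun h => hb ((hleg b).1 h)), hf, hf, hj.line_iff hb]

end FGraph

/-! ### Gluing a graph into a vertex or a line -/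

namespace FGraph

variable {F : Type}

/-- The places at which a graph can be inserted: vertices and internal edges. -/
abbrev Place (Γ : FGraph F) : Type := Quotient Γ.vert ⊕ {e : Quotient Γ.line // e ∈ Γ.internalEdges}

/-- The half-edge `h` belongs to the place. -/
def Place.Has {Γ : FGraph F} : Γ.Place → Γ.H → Prop
  | Sum.inl v, h => Quotient.mk Γ.vert h = v
  | Sum.inr e, h => Quotient.mk Γ.line h = e.1

/-- The type of a place. -/
noncomputable def Place.type {Γ : FGraph F} : Γ.Place → Multiset F
  | Sum.inl v => Γ.vertexType v
  | Sum.inr e => Γ.lineType e.1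

theorem map_filter_eq_block {Γ : FGraph F} {s : Setoid Γ.H} (q : Quotient s) {U : Γ.H → Prop}
    {_ : DecidablePred U} (h : ∀ x, U x ↔ Quotient.mk s x = q) :
    (Finset.univ.filter U).val.map Γ.field = Γ.block s q := by
  unfold block
  congr 2
  ext x
  simp [h]

theorem Place.type_eq {Γ : FGraph F} (p : Γ.Place) :
    p.type = (Finset.univ.filter p.Has).val.map Γ.field := by
  rcases p with v | e
  · exact (map_filter_eq_block _ fun _ => Iff.rfl).symm
  · exact (map_filter_eq_block _ fun _ => Iff.rfl).symm

/-- The common part of the two ways to glue `γ` into `Γ'`, at the half-edges in `U`. The half-edges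
`a x` of `Γ'` correspond to the legs `l x` of `γ`. -/
structure GluesCore (Γ Γ' γ : FGraph F) {X : Type} (U : Γ'.H → Prop) (a : X → Γ'.H) (l : X → γ.H)
    (i : Γ'.H → Γ.H) (j : γ.H → Γ.H) : Prop where
  embeds : Embeds γ Γ j
  a_inj : Function.Injective a
  a_range : ∀ h, U h ↔ ∃ x, a x = h
  l_inj : Function.Injective l
  l_range : ∀ b, γ.IsLeg b ↔ ∃ x, l x = b
  l_field : ∀ x, γ.field (l x) = Γ'.field (a x)
  i_inj : Function.Injective i
  i_field : ∀ h, Γ.field (i h) = Γ'.field h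
  cover : ∀ h, (∃ b, j b = h) ∨ ∃ h', i h' = h
  i_vert : ∀ h h', (∀ b, j b ≠ i h) → (∀ b, j b ≠ i h') → (Γ.vert (i h) (i h') ↔ Γ'.vert h h')

/-- `Γ` arises from `Γ'` by replacing the vertex `v` by `γ`. -/
structure GluesVertex (Γ Γ' γ : FGraph F) {X : Type} (v : Quotient Γ'.vert) (a : X → Γ'.H)
    (l : X → γ.H) (i : Γ'.H → Γ.H) (j : γ.H → Γ.H) : Prop extends
    GluesCore Γ Γ' γ (fun h => Quotient.mk Γ'.vert h = v) a l i j where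
  res_card : γ.res.card ≠ 2
  glue : ∀ x, i (a x) = j (l x)
  meet : ∀ h b, i h = j b → ∃ x, a x = h
  i_line : ∀ h h', Γ.line (i h) (i h') ↔ Γ'.line h h'

/-- `Γ` arises from `Γ'` by inserting `γ` into the line `e`. -/
structure GluesEdge (Γ Γ' γ : FGraph F) {X : Type} (e : Quotient Γ'.line) (a : X → Γ'.H)
    (l : X → γ.H) (i : Γ'.H → Γ.H) (j : γ.H → Γ.H) : Prop extends
    GluesCore Γ Γ' γ (fun h => Quotient.mk Γ'.line h = e) a l i j where
  res_card : γ.res.card = 2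
  disj : ∀ h b, i h ≠ j b
  -- The labels match by field type: the leg with label `y` has the type of `a y`. It must be joined
  -- to the half-edge of conjugate type, which is the other half-edge of the line; hence `x ≠ y`.
  cross : ∀ h b, Γ.line (i h) (j b) ↔ ∃ x y, x ≠ y ∧ a x = h ∧ l y = b
  leg_line : ∀ x y, Γ.line (j (l x)) (j (l y)) → x = y
  i_line : ∀ h h', Γ.line (i h) (i h') ↔ h = h' ∨ ((∀ x, a x ≠ h) ∧ Γ'.line h h')

/-- `Γ` arises from `Γ'` by inserting `γ` at the place `p`. -/
def Glues (Γ Γ' γ : FGraph F) {X : Type} (p : Γ'.Place) (a : X → Γ'.H) (l : X → γ.H)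
    (i : Γ'.H → Γ.H) (j : γ.H → Γ.H) : Prop :=
  match p with
  | Sum.inl v => GluesVertex Γ Γ' γ v a l i j
  | Sum.inr e => GluesEdge Γ Γ' γ e.1 a l i j

variable {Γ Γ' γ : FGraph F} {X : Type}

theorem Glues.core {p : Γ'.Place} {a : X → Γ'.H} {l : X → γ.H} {i : Γ'.H → Γ.H} {j : γ.H → Γ.H}
    (h : Glues Γ Γ' γ p a l i j) : GluesCore Γ Γ' γ p.Has a l i j := by
  rcases p with v | e
  · exact GluesVertex.toGluesCore h
  · exact GluesEdge.toGluesCore h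

section Core

variable {U : Γ'.H → Prop} {a : X → Γ'.H} {l : X → γ.H} {i : Γ'.H → Γ.H} {j : γ.H → Γ.H}

theorem GluesCore.res_eq (h : GluesCore Γ Γ' γ U a l i j) :
    γ.res = (Finset.univ.filter U).val.map Γ'.field := by
  unfold res
  have hb : ∀ b : γ.H, b ∈ (Finset.univ.filter γ.IsLeg).val → ∃ x, l x = b := by
    intro b hb
    simp only [Finset.mem_val, Finset.mem_filter, Finset.mem_univ, true_and] at hb
    exact (h.l_range b).1 hb
  refine Multiset.map_eq_map_of_bij_of_nodup _ _ (Finset.nodup _) (Finset.nodup _)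
    (fun b hb' => a (hb b hb').choose) ?_ ?_ ?_ ?_
  · intro b hb'
    simp only [Finset.mem_val, Finset.mem_filter, Finset.mem_univ, true_and]
    exact (h.a_range _).2 ⟨_, rfl⟩
  · intro b hb1 b' hb2 e
    rw [← (hb b hb1).choose_spec, ← (hb b' hb2).choose_spec, h.a_inj e]
  · intro c hc
    simp only [Finset.mem_val, Finset.mem_filter, Finset.mem_univ, true_and] at hc
    obtain ⟨x, rfl⟩ := (h.a_range c).1 hc
    have hx : l x ∈ (Finset.univ.filter γ.IsLeg).val := by
      simpa using (h.l_range _).2 ⟨x, rfl⟩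
    exact ⟨l x, hx, by rw [h.l_inj (hb _ hx).choose_spec]⟩
  · intro b hb'
    rw [← h.l_field, (hb b hb').choose_spec]

theorem exists_pair_of_legs {l : X → γ.H} (l_inj : Function.Injective l)
    (l_range : ∀ b, γ.IsLeg b ↔ ∃ x, l x = b) (h2 : γ.res.card = 2) :
    ∃ x y : X, x ≠ y ∧ ∀ z, z = x ∨ z = y := by
  unfold res at h2
  rw [Multiset.card_map, Finset.card_val, Finset.card_eq_two] at h2
  obtain ⟨b, b', hne, hs⟩ := h2
  have hm : ∀ c, γ.IsLeg c ↔ c = b ∨ c = b' := by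
    intro c
    have : c ∈ Finset.univ.filter γ.IsLeg ↔ c ∈ ({b, b'} : Finset γ.H) := by rw [hs]
    simpa using this
  obtain ⟨x, rfl⟩ := (l_range b).1 ((hm b).2 (Or.inl rfl))
  obtain ⟨y, rfl⟩ := (l_range b').1 ((hm b').2 (Or.inr rfl))
  refine ⟨x, y, fun e => hne (by rw [e]), fun z => ?_⟩
  rcases (hm (l z)).1 ((l_range _).2 ⟨z, rfl⟩) with e | e
  · exact Or.inl (l_inj e)
  · exact Or.inr (l_inj e)

theorem GluesCore.exists_pair (h : GluesCore Γ Γ' γ U a l i j) (h2 : γ.res.card = 2) :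
    ∃ x y : X, x ≠ y ∧ ∀ z, z = x ∨ z = y :=
  exists_pair_of_legs h.l_inj h.l_range h2

theorem GluesEdge.exists_other {e : Quotient Γ'.line} (h : GluesEdge Γ Γ' γ e a l i j) (x : X) :
    ∃ y, x ≠ y ∧ ∀ z, z ≠ x → z = y := by
  obtain ⟨u, v, hne, huv⟩ := h.exists_pair h.res_card
  rcases huv x with rfl | rfl
  · exact ⟨v, hne, fun z hz => (huv z).resolve_left hz⟩
  · exact ⟨u, hne.symm, fun z hz => (huv z).resolve_right hz⟩

theorem GluesVertex.isLeg_iff {v : Quotient Γ'.vert} (h : GluesVertex Γ Γ' γ v a l i j) (y : Γ.H) :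
    Γ.IsLeg y ↔ ∃ x, i x = y ∧ Γ'.IsLeg x := by
  constructor
  · intro hy
    have : ∃ x, i x = y := by
      rcases h.cover y with ⟨b, rfl⟩ | H
      · by_cases hb : γ.IsLeg b
        · obtain ⟨x, rfl⟩ := (h.l_range b).1 hb
          exact ⟨a x, h.glue x⟩
        · exact absurd hy (h.embeds.not_isLeg hb)
      · exact H
    obtain ⟨x, rfl⟩ := this
    exact ⟨x, rfl, fun x' hx' => h.i_inj (hy _ ((h.i_line _ _).2 hx'))⟩
  · rintro ⟨x, rfl, hx⟩ y hy
    have : ∃ x, i x = y := by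
      rcases h.cover y with ⟨b, rfl⟩ | H
      · by_cases hb : γ.IsLeg b
        · obtain ⟨z, rfl⟩ := (h.l_range b).1 hb
          exact ⟨a z, h.glue z⟩
        · obtain ⟨b', e, hb'⟩ := (h.embeds.line b hb _).1 (Γ.line.symm' hy)
          obtain ⟨z, rfl⟩ := h.meet x b' e.symm
          have : l z = b' := h.embeds.inj (by rw [e, h.glue])
          exact absurd (((h.l_range b').2 ⟨z, this⟩).of_line (γ.line.symm' hb')) hb
      · exact H
    obtain ⟨x', rfl⟩ := this
    rw [hx _ ((h.i_line _ _).1 hy)]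

theorem GluesEdge.not_isLeg_a {e : Quotient Γ'.line} (h : GluesEdge Γ Γ' γ e a l i j) (x : X) :
    ¬ Γ'.IsLeg (a x) := by
  intro H
  obtain ⟨y, hxy, -⟩ := h.exists_other x
  refine hxy (h.a_inj (H (a y) (Quotient.exact ?_))).symm
  rw [(h.a_range (a x)).2 ⟨x, rfl⟩, (h.a_range (a y)).2 ⟨y, rfl⟩]

theorem GluesEdge.isLeg_iff {e : Quotient Γ'.line} (h : GluesEdge Γ Γ' γ e a l i j) (y : Γ.H) :
    Γ.IsLeg y ↔ ∃ x, i x = y ∧ Γ'.IsLeg x := by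
  have hcross : ∀ x y, x ≠ y → Γ.line (i (a x)) (j (l y)) :=
    fun x y hxy => (h.cross _ _).2 ⟨x, y, hxy, rfl, rfl⟩
  constructor
  · intro hy
    rcases h.cover y with ⟨b, rfl⟩ | ⟨x, rfl⟩
    · by_cases hb : γ.IsLeg b
      · obtain ⟨x, rfl⟩ := (h.l_range b).1 hb
        obtain ⟨y, hxy, -⟩ := h.exists_other x
        exact absurd (hy _ (Γ.line.symm' (hcross y x hxy.symm))) (h.disj _ _)
      · exact absurd hy (h.embeds.not_isLeg hb)
    · refine ⟨x, rfl, fun x' hx' => h.i_inj (hy _ ((h.i_line _ _).2 (Or.inr ⟨?_, hx'⟩)))⟩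
      rintro z rfl
      obtain ⟨y, hxy, -⟩ := h.exists_other z
      exact h.disj _ _ (hy _ (hcross z y hxy)).symm
  · rintro ⟨x, rfl, hx⟩ y hy
    rcases h.cover y with ⟨b, rfl⟩ | ⟨x', rfl⟩
    · obtain ⟨z, z', -, rfl, rfl⟩ := (h.cross _ _).1 hy
      exact absurd hx (h.not_isLeg_a z)
    · rcases (h.i_line _ _).1 hy with rfl | ⟨-, h2⟩
      · rfl
      · rw [hx _ h2]

/-- The vertices of `Γ` are those of `γ` and those of `Γ'` other than `v`; the type of `v` stands on
the left to avoid a subtraction of multisets. -/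
theorem GluesVertex.vertexTypes_add {v : Quotient Γ'.vert} (h : GluesVertex Γ Γ' γ v a l i j) :
    Γ.vertexTypes + {Γ'.vertexType v} = Γ'.vertexTypes + γ.vertexTypes := by
  have hj := h.embeds
  have hir : ∀ x, (∀ b, j b ≠ i x) ↔ Quotient.mk Γ'.vert x ≠ v := by
    intro x
    constructor
    · intro H hx
      obtain ⟨z, rfl⟩ := (h.a_range x).1 hx
      exact H (l z) (h.glue z).symm
    · intro H b hb
      obtain ⟨z, rfl⟩ := h.meet x b hb.symm
      exact H ((h.a_range _).2 ⟨z, rfl⟩)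
  have e1 : Γ.vertexTypes = Γ.blockTypes Γ.vert (fun h => ∃ b, j b = h) +
      Γ.blockTypes Γ.vert (fun h => ¬ ∃ b, j b = h) := by
    rw [← blockTypes_or]
    · exact blockTypes_congr fun x => by simp only [true_iff]; exact em _
    · rintro x y hxy ⟨b, rfl⟩ H
      obtain ⟨b', hb', -⟩ := (hj.vert b y).1 hxy
      exact H ⟨b', hb'⟩
  have e2 : Γ'.vertexTypes = Γ'.blockTypes Γ'.vert (fun h => Quotient.mk Γ'.vert h = v) +
      Γ'.blockTypes Γ'.vert (fun h => ¬ Quotient.mk Γ'.vert h = v) := by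
    rw [← blockTypes_or]
    · exact blockTypes_congr fun x => by simp [em]
    · rintro x y hxy rfl H
      exact H (Quotient.sound (Γ'.vert.symm' hxy))
  have e3 : Γ.blockTypes Γ.vert (fun h => ∃ b, j b = h) = γ.vertexTypes := by
    refine blockTypes_transfer (i := j) (fun x _ => hj.field x) (fun x y _ _ e => hj.inj e) ?_
      (fun _ _ _ _ => trivial) (fun x y _ => hj.vert x y)
    simp
  have e4 : Γ.blockTypes Γ.vert (fun h => ¬ ∃ b, j b = h) =
      Γ'.blockTypes Γ'.vert (fun h => ¬ Quotient.mk Γ'.vert h = v) := by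
    refine blockTypes_transfer (i := i) (fun x _ => h.i_field x) (fun x y _ _ e => h.i_inj e) ?_
      ?_ ?_
    · intro y
      constructor
      · intro hy
        obtain ⟨x, rfl⟩ := (h.cover y).resolve_left hy
        exact ⟨x, rfl, (hir x).1 fun b hb => hy ⟨b, hb⟩⟩
      · rintro ⟨x, rfl, hx⟩ ⟨b, hb⟩
        exact (hir x).2 hx b hb
    · rintro x y hxy hx rfl
      exact hx (Quotient.sound hxy)
    · intro x y hx
      constructor
      · intro hxy
        have hy : ¬ ∃ b, j b = y := by
          rintro ⟨b, rfl⟩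
          obtain ⟨b', hb', -⟩ := (hj.vert b _).1 (Γ.vert.symm' hxy)
          exact (hir x).2 hx b' hb'
        obtain ⟨z, rfl⟩ := (h.cover y).resolve_left hy
        exact ⟨z, rfl, (h.i_vert x z ((hir x).2 hx) fun b hb => hy ⟨b, hb⟩).1 hxy⟩
      · rintro ⟨z, rfl, hz⟩
        refine (h.i_vert x z ((hir x).2 hx) ((hir z).2 ?_)).2 hz
        rintro rfl
        exact hx (Quotient.sound hz)
  rw [e1, e2, e3, e4, blockTypes_eq_singleton v fun x => Iff.rfl]
  change _ + {Γ'.block Γ'.vert v} = _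
  abel

theorem GluesVertex.innerTypes_eq {v : Quotient Γ'.vert} (h : GluesVertex Γ Γ' γ v a l i j) :
    Γ.innerTypes = Γ'.innerTypes + γ.innerTypes := by
  have hj := h.embeds
  have hi : ∀ x b, ¬ γ.IsLeg b → ¬ Γ.line (i x) (j b) := by
    intro x b hb H
    obtain ⟨b', e, hb'⟩ := (hj.line b hb _).1 (Γ.line.symm' H)
    obtain ⟨z, rfl⟩ := h.meet x b' e.symm
    have : l z = b' := hj.inj (by rw [e, h.glue])
    exact absurd (((h.l_range b').2 ⟨z, this⟩).of_line (γ.line.symm' hb')) hb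
  have e1 : Γ.innerTypes = Γ.blockTypes Γ.line (fun y => ∃ x, i x = y ∧ ¬ Γ'.IsLeg x) +
      Γ.blockTypes Γ.line (fun y => ∃ b, j b = y ∧ ¬ γ.IsLeg b) := by
    rw [← blockTypes_or]
    · refine blockTypes_congr fun y => ?_
      constructor
      · intro hy
        rcases h.cover y with ⟨b, rfl⟩ | ⟨x, rfl⟩
        · by_cases hb : γ.IsLeg b
          · obtain ⟨x, rfl⟩ := (h.l_range b).1 hb
            refine Or.inl ⟨a x, h.glue x, fun H => hy ((h.isLeg_iff _).2 ⟨_, h.glue x, H⟩)⟩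
          · exact Or.inr ⟨b, rfl, hb⟩
        · exact Or.inl ⟨x, rfl, fun H => hy ((h.isLeg_iff _).2 ⟨_, rfl, H⟩)⟩
      · rintro (⟨x, rfl, hx⟩ | ⟨b, rfl, hb⟩)
        · intro H
          obtain ⟨x', e, hx'⟩ := (h.isLeg_iff _).1 H
          exact hx (h.i_inj e ▸ hx')
        · exact hj.not_isLeg hb
    · rintro _ _ hxy ⟨x, rfl, hx⟩ ⟨b, rfl, hb⟩
      exact hi x b hb hxy
  rw [e1]
  congr 1
  · refine blockTypes_transfer (i := i) (fun x _ => h.i_field x) (fun x y _ _ e => h.i_inj e)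
      (fun _ => Iff.rfl) (fun x y hxy hx hy => hx (hy.of_line (Γ'.line.symm' hxy))) ?_
    intro x y hx
    constructor
    · intro hxy
      rcases h.cover y with ⟨b, rfl⟩ | ⟨z, rfl⟩
      · by_cases hb : γ.IsLeg b
        · obtain ⟨z, rfl⟩ := (h.l_range b).1 hb
          rw [← h.glue] at hxy
          exact ⟨_, h.glue z, (h.i_line _ _).1 hxy⟩
        · exact absurd hxy (hi x b hb)
      · exact ⟨z, rfl, (h.i_line _ _).1 hxy⟩
    · rintro ⟨z, rfl, hz⟩
      exact (h.i_line _ _).2 hz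
  · exact blockTypes_transfer (i := j) (fun x _ => hj.field x) (fun x y _ _ e => hj.inj e)
      (fun _ => Iff.rfl) (fun x y hxy hx hy => hx (hy.of_line (γ.line.symm' hxy)))
      (fun x y hx => hj.line x hx y)

theorem GluesEdge.vertexTypes_eq {e : Quotient Γ'.line} (h : GluesEdge Γ Γ' γ e a l i j) :
    Γ.vertexTypes = Γ'.vertexTypes + γ.vertexTypes := by
  have hj := h.embeds
  have e1 : Γ.vertexTypes = Γ.blockTypes Γ.vert (fun h => ∃ x, i x = h) +
      Γ.blockTypes Γ.vert (fun h => ∃ b, j b = h) := by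
    rw [← blockTypes_or]
    · exact blockTypes_congr fun x => by simpa [or_comm] using h.cover x
    · rintro _ _ hxy ⟨x, rfl⟩ ⟨b, rfl⟩
      obtain ⟨b', hb', -⟩ := (hj.vert b _).1 (Γ.vert.symm' hxy)
      exact h.disj _ _ hb'.symm
  rw [e1]
  congr 1
  · refine blockTypes_transfer (i := i) (fun x _ => h.i_field x) (fun x y _ _ e => h.i_inj e)
      (by simp) (fun _ _ _ _ => trivial) ?_
    intro x y _
    constructor
    · intro hxy
      rcases h.cover y with ⟨b, rfl⟩ | ⟨z, rfl⟩
      · obtain ⟨b', hb', -⟩ := (hj.vert b _).1 (Γ.vert.symm' hxy)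
        exact absurd hb'.symm (h.disj _ _)
      · exact ⟨z, rfl, (h.i_vert _ _ (fun b => (h.disj _ _).symm) fun b => (h.disj _ _).symm).1 hxy⟩
    · rintro ⟨z, rfl, hz⟩
      exact (h.i_vert _ _ (fun b => (h.disj _ _).symm) fun b => (h.disj _ _).symm).2 hz
  · exact blockTypes_transfer (i := j) (fun x _ => hj.field x) (fun x y _ _ e => hj.inj e) (by simp)
      (fun _ _ _ _ => trivial) (fun x y _ => hj.vert x y)

theorem GluesEdge.line_a_iff {e : Quotient Γ'.line} (h : GluesEdge Γ Γ' γ e a l i j) {x y : X}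
    (hxy : x ≠ y) (z : Γ.H) : Γ.line (i (a x)) z ↔ z = i (a x) ∨ z = j (l y) := by
  constructor
  · intro hz
    rcases h.cover z with ⟨b, rfl⟩ | ⟨w, rfl⟩
    · obtain ⟨x', y', hne, e1, rfl⟩ := (h.cross _ _).1 hz
      obtain rfl := h.a_inj e1
      obtain ⟨w, -, hw⟩ := h.exists_other x'
      rw [hw y' hne.symm, hw y hxy.symm]
      exact Or.inr rfl
    · rcases (h.i_line _ _).1 hz with rfl | ⟨h1, -⟩
      · exact Or.inl rfl
      · exact absurd rfl (h1 x)
  · rintro (rfl | rfl)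
    · exact Γ.line.refl' _
    · exact (h.cross _ _).2 ⟨x, y, hxy, rfl, rfl⟩

/-- The new line at `a x` ends in the leg `l y` with the other label, which has the type of `a y`.
So both new lines have the type of the original line `e`, that is, of the residue of `γ`. -/
theorem GluesEdge.lineType_a {e : Quotient Γ'.line} (h : GluesEdge Γ Γ' γ e a l i j) (x : X) :
    Γ.lineType (Quotient.mk Γ.line (i (a x))) = γ.res := by
  obtain ⟨y, hxy, hy⟩ := h.exists_other x
  have h1 : Finset.univ.filter (fun z => Quotient.mk Γ.line z = Quotient.mk Γ.line (i (a x))) =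
      {i (a x), j (l y)} := by
    ext z
    simp only [Finset.mem_filter, Finset.mem_univ, true_and, Finset.mem_insert,
      Finset.mem_singleton]
    rw [← h.line_a_iff hxy]
    exact ⟨fun e => Γ.line.symm' (Quotient.exact e), fun e => Quotient.sound (Γ.line.symm' e)⟩
  have h2 : (Finset.univ.filter (fun z => Quotient.mk Γ'.line z = e)) = {a x, a y} := by
    ext z
    simp only [Finset.mem_filter, Finset.mem_univ, true_and, Finset.mem_insert,
      Finset.mem_singleton]
    rw [h.a_range]
    constructor
    · rintro ⟨w, rfl⟩
      by_cases hw : w = x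
      · exact Or.inl (by rw [hw])
      · exact Or.inr (by rw [hy w hw])
    · rintro (rfl | rfl)
      · exact ⟨_, rfl⟩
      · exact ⟨_, rfl⟩
  rw [h.res_eq, map_filter_eq_block e (U := fun z => Quotient.mk _ z = e) fun _ => Iff.rfl]
  unfold lineType block
  rw [h1, h2, Finset.insert_val_of_notMem (by simpa using h.disj _ _),
    Finset.insert_val_of_notMem (by simpa using fun e => hxy (h.a_inj e))]
  simp [h.i_field, h.embeds.field, h.l_field]

/-- Insertion replaces the line `e` by two lines of the same type, so one additional line of type
`γ.res` appears. -/
theorem GluesEdge.innerTypes_eq {e : Quotient Γ'.line} (h : GluesEdge Γ Γ' γ e a l i j) :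
    Γ.innerTypes = Γ'.innerTypes + γ.innerTypes + {γ.res} := by
  have hj := h.embeds
  obtain ⟨x₁, x₂, h12, hX⟩ := h.exists_pair h.res_card
  have ha : ∀ x y, Γ'.line (a x) y → ∃ z, a z = y := by
    intro x y hxy
    refine (h.a_range y).1 ?_
    rw [← (h.a_range (a x)).2 ⟨x, rfl⟩]
    exact Quotient.sound (Γ'.line.symm' hxy)
  have e2 : Γ'.innerTypes = Γ'.blockTypes Γ'.line (fun y => Quotient.mk Γ'.line y = e) +
      Γ'.blockTypes Γ'.line (fun y => ¬ Γ'.IsLeg y ∧ ∀ x, a x ≠ y) := by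
    rw [← blockTypes_or]
    · refine blockTypes_congr fun y => ?_
      rw [h.a_range]
      constructor
      · intro hy
        by_cases H : ∃ x, a x = y
        · exact Or.inl H
        · exact Or.inr ⟨hy, fun x hx => H ⟨x, hx⟩⟩
      · rintro (⟨x, rfl⟩ | h2)
        · exact h.not_isLeg_a x
        · exact h2.1
    · rintro x y hxy rfl ⟨-, H⟩
      obtain ⟨z, rfl⟩ := (h.a_range x).1 rfl
      obtain ⟨w, rfl⟩ := ha z y hxy
      exact H w rfl
  have e3 : Γ'.blockTypes Γ'.line (fun y => Quotient.mk Γ'.line y = e) = {γ.res} := by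
    rw [blockTypes_eq_singleton e fun x => Iff.rfl, h.res_eq,
      map_filter_eq_block e (U := fun z => Quotient.mk _ z = e) fun _ => Iff.rfl]
  have e4 : ∀ x, Γ.blockTypes Γ.line (fun z => Quotient.mk Γ.line z =
      Quotient.mk Γ.line (i (a x))) = {γ.res} := by
    intro x
    rw [blockTypes_eq_singleton _ fun x => Iff.rfl, ← h.lineType_a x]
    rfl
  have hsplit : ∀ x y : X, x ≠ y → ∀ z, Quotient.mk Γ.line z = Quotient.mk Γ.line (i (a x)) ↔
      z = i (a x) ∨ z = j (l y) := by
    intro x y hxy z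
    rw [← h.line_a_iff hxy]
    exact ⟨fun e => Γ.line.symm' (Quotient.exact e), fun e => Quotient.sound (Γ.line.symm' e)⟩
  have e1 : Γ.innerTypes =
      Γ.blockTypes Γ.line (fun y => ∃ x, i x = y ∧ ¬ Γ'.IsLeg x ∧ ∀ z, a z ≠ x) +
      Γ.blockTypes Γ.line (fun y => ∃ b, j b = y ∧ ¬ γ.IsLeg b) +
      (Γ.blockTypes Γ.line (fun z => Quotient.mk Γ.line z = Quotient.mk Γ.line (i (a x₁))) +
      Γ.blockTypes Γ.line (fun z => Quotient.mk Γ.line z = Quotient.mk Γ.line (i (a x₂)))) := by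
    rw [← blockTypes_or, ← blockTypes_or, ← blockTypes_or]
    · refine blockTypes_congr fun y => ?_
      rw [hsplit x₁ x₂ h12, hsplit x₂ x₁ h12.symm]
      constructor
      · intro hy
        rcases h.cover y with ⟨b, rfl⟩ | ⟨x, rfl⟩
        · by_cases hb : γ.IsLeg b
          · obtain ⟨x, rfl⟩ := (h.l_range b).1 hb
            rcases hX x with rfl | rfl
            · exact Or.inr (Or.inr (Or.inr rfl))
            · exact Or.inr (Or.inl (Or.inr rfl))
          · exact Or.inl (Or.inr ⟨b, rfl, hb⟩)
        · by_cases hx : ∃ z, a z = x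
          · obtain ⟨z, rfl⟩ := hx
            rcases hX z with rfl | rfl
            · exact Or.inr (Or.inl (Or.inl rfl))
            · exact Or.inr (Or.inr (Or.inl rfl))
          · exact Or.inl (Or.inl ⟨x, rfl, fun H => hy ((h.isLeg_iff _).2 ⟨_, rfl, H⟩),
              fun z hz => hx ⟨z, hz⟩⟩)
      · intro H hy
        obtain ⟨x, rfl, hx⟩ := (h.isLeg_iff _).1 hy
        rcases H with (⟨x', e, hx', -⟩ | ⟨b, e, -⟩) | (H | H) | (H | H)
        · exact hx' (h.i_inj e ▸ hx)
        · exact h.disj _ _ e.symm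
        · exact h.not_isLeg_a _ (h.i_inj H ▸ hx)
        · exact h.disj _ _ H
        · exact h.not_isLeg_a _ (h.i_inj H ▸ hx)
        · exact h.disj _ _ H
    · have key : ∀ z z', Γ.line z z' → ((∃ x, i x = z ∧ ¬ Γ'.IsLeg x ∧ ∀ z, a z ≠ x) ∨
          ∃ b, j b = z ∧ ¬ γ.IsLeg b) → ∀ x y, x ≠ y →
          ¬ Quotient.mk Γ.line z' = Quotient.mk Γ.line (i (a x)) := by
        intro z z' hzz H x y hxy hz
        rw [← (Quotient.sound hzz : Quotient.mk Γ.line z = Quotient.mk Γ.line z'),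
          hsplit x y hxy] at hz
        rcases H with ⟨w, rfl, -, hw⟩ | ⟨b, rfl, hb⟩
        · rcases hz with hz | hz
          · exact hw _ (h.i_inj hz.symm)
          · exact h.disj _ _ hz
        · rcases hz with hz | hz
          · exact h.disj _ _ hz.symm
          · exact hb (h.embeds.inj hz ▸ (h.l_range _).2 ⟨_, rfl⟩)
      intro z z' hzz H
      rintro (H' | H')
      · exact key z z' hzz H _ _ h12 H'
      · exact key z z' hzz H _ _ h12.symm H'
    · intro z z' hzz hz hz'
      rw [(Quotient.sound hzz : Quotient.mk Γ.line z = Quotient.mk Γ.line z')] at hz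
      rw [hz] at hz'
      rcases (hsplit x₂ x₁ h12.symm _).1 hz' with H | H
      · exact h12 (h.a_inj (h.i_inj H))
      · exact h.disj _ _ H
    · rintro _ _ hxy ⟨x, rfl, hx, -⟩ ⟨b, rfl, hb⟩
      obtain ⟨x', y', -, -, rfl⟩ := (h.cross _ _).1 hxy
      exact hb ((h.l_range _).2 ⟨_, rfl⟩)
  rw [e1, e2, e3, e4, e4]
  have e5 : Γ.blockTypes Γ.line (fun y => ∃ x, i x = y ∧ ¬ Γ'.IsLeg x ∧ ∀ z, a z ≠ x) =
      Γ'.blockTypes Γ'.line (fun y => ¬ Γ'.IsLeg y ∧ ∀ x, a x ≠ y) := by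
    refine blockTypes_transfer (i := i) (fun x _ => h.i_field x) (fun x y _ _ e => h.i_inj e)
      (fun _ => Iff.rfl) ?_ ?_
    · rintro x y hxy ⟨h1, h2⟩
      refine ⟨fun H => h1 (H.of_line (Γ'.line.symm' hxy)), ?_⟩
      rintro z rfl
      obtain ⟨w, hw⟩ := ha z x (Γ'.line.symm' hxy)
      exact h2 w hw
    · rintro x y ⟨h1, h2⟩
      constructor
      · intro hxy
        rcases h.cover y with ⟨b, rfl⟩ | ⟨z, rfl⟩
        · obtain ⟨x', y', -, rfl, -⟩ := (h.cross _ _).1 hxy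
          exact absurd rfl (h2 x')
        · rcases (h.i_line _ _).1 hxy with rfl | h3
          · exact ⟨_, rfl, Γ'.line.refl' _⟩
          · exact ⟨z, rfl, h3.2⟩
      · rintro ⟨z, rfl, hz⟩
        exact (h.i_line _ _).2 (Or.inr ⟨h2, hz⟩)
  have e6 : Γ.blockTypes Γ.line (fun y => ∃ b, j b = y ∧ ¬ γ.IsLeg b) = γ.innerTypes :=
    blockTypes_transfer (i := j) (fun x _ => hj.field x) (fun x y _ _ e => hj.inj e)
      (fun _ => Iff.rfl) (fun x y hxy hx hy => hx (hy.of_line (γ.line.symm' hxy)))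
      (fun x y hx => hj.line x hx y)
  rw [e5, e6]
  abel

end Core

section

variable {p : Γ'.Place} {a : X → Γ'.H} {l : X → γ.H} {i : Γ'.H → Γ.H} {j : γ.H → Γ.H}

theorem Glues.res_eq_type (h : Glues Γ Γ' γ p a l i j) : γ.res = p.type := by
  rw [h.core.res_eq, Place.type_eq]

theorem Glues.isLeg_iff (h : Glues Γ Γ' γ p a l i j) (y : Γ.H) :
    Γ.IsLeg y ↔ ∃ x, i x = y ∧ Γ'.IsLeg x := by
  rcases p with v | e
  · exact GluesVertex.isLeg_iff h y
  · exact GluesEdge.isLeg_iff h y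

theorem Glues.isLeg_i_iff (h : Glues Γ Γ' γ p a l i j) (x : Γ'.H) :
    Γ.IsLeg (i x) ↔ Γ'.IsLeg x := by
  rw [h.isLeg_iff]
  constructor
  · rintro ⟨y, e, hy⟩
    rwa [← h.core.i_inj e]
  · exact fun hx => ⟨x, rfl, hx⟩

theorem Glues.res_eq (h : Glues Γ Γ' γ p a l i j) : Γ.res = Γ'.res :=
  res_eq_of_legs i (fun x _ => h.core.i_field x) (fun _ _ _ _ e => h.core.i_inj e) h.isLeg_iff

/-- The sum of `f` over the types of the vertices, minus that over the types of the inner lines. -/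
noncomputable def typeSum {A : Type*} [AddCommGroup A] (Γ : FGraph F) (f : Multiset F → A) : A :=
  (Γ.vertexTypes.map f).sum - (Γ.innerTypes.map f).sum

/-- Insertion at a vertex loses a vertex of type `γ.res`, insertion into a line gains a line of that
type; both change the difference by `-f γ.res`. The constant function `1` yields additivity of loop
numbers, and `f = P_lin Γ^τ` yields the behaviour of `P_lin X_Γ` under contraction. -/
theorem Glues.typeSum_add {A : Type*} [AddCommGroup A] (h : Glues Γ Γ' γ p a l i j)
    (f : Multiset F → A) : Γ.typeSum f + f γ.res = Γ'.typeSum f + γ.typeSum f := by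
  unfold typeSum
  rcases p with v | e
  · have h1 := congrArg (fun s => (s.map f).sum) (GluesVertex.vertexTypes_add h)
    have h2 := GluesVertex.innerTypes_eq h
    have h3 : γ.res = Γ'.vertexType v := h.res_eq_type
    simp only [Multiset.map_add, Multiset.sum_add, Multiset.map_singleton,
      Multiset.sum_singleton] at h1
    rw [h2, h3, Multiset.map_add, Multiset.sum_add]
    calc _ = ((Γ.vertexTypes.map f).sum + f (Γ'.vertexType v)) -
          ((Γ'.innerTypes.map f).sum + (γ.innerTypes.map f).sum) := by abel
      _ = _ := by rw [h1]; abel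
  · have h1 := GluesEdge.vertexTypes_eq h
    have h2 := GluesEdge.innerTypes_eq h
    rw [h2, h1]
    simp only [Multiset.map_add, Multiset.sum_add, Multiset.map_singleton,
      Multiset.sum_singleton]
    abel

theorem Iso.typeSum_eq {A : Type*} [AddCommGroup A] (φ : Iso Γ Γ') (f : Multiset F → A) :
    Γ'.typeSum f = Γ.typeSum f := by
  unfold typeSum
  rw [φ.vertexTypes_eq, φ.innerTypes_eq]

end

end FGraph

/-! ### Loops of bridgeless graphs -/

namespace FGraph

variable {F : Type}

/-- A connected graph without bridges that has an inner line contains a loop. -/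
theorem card_vertexTypes_le_of_bridgeless {Γ : FGraph F} (hp : Γ.InnerPairs)
    (hb : Γ.CutBridgeless) (h₀ : Γ.H) (hl : ¬ Γ.IsLeg h₀) :
    Γ.vertexTypes.card ≤ Γ.innerTypes.card := by
  -- The lines other than that of `h₀` still connect all vertices, so this simple graph has at least
  -- `V - 1` edges. Together with the line of `h₀` there are at least `V` inner lines.
  let G : SimpleGraph (Quotient Γ.vert) :=
    { Adj := fun u v => u ≠ v ∧ ∃ h h', Γ.line h h' ∧ ¬ Γ.line h₀ h ∧
        Quotient.mk _ h = u ∧ Quotient.mk _ h' = v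
      symm := ⟨by
        rintro u v ⟨hne, h, h', h1, h2, rfl, rfl⟩
        exact ⟨hne.symm, h', h, Γ.line.symm' h1,
          fun e => h2 (Γ.line.trans' e (Γ.line.symm' h1)), rfl, rfl⟩⟩
      loopless := ⟨fun u h => h.1 rfl⟩ }
  have hG : G.Connected := by
    have hpre : G.Preconnected := by
      intro u v
      obtain ⟨x, rfl⟩ := Quotient.exists_rep u
      obtain ⟨y, rfl⟩ := Quotient.exists_rep v
      refine hb h₀ hl (fun z => G.Reachable (Quotient.mk _ x) (Quotient.mk _ z)) ?_ ?_ x y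
        (SimpleGraph.Reachable.refl _)
      · intro a b hab ha
        rwa [(Quotient.sound hab : Quotient.mk Γ.vert a = Quotient.mk Γ.vert b)] at ha
      · intro a b hab hn ha
        by_cases e : Quotient.mk Γ.vert a = Quotient.mk Γ.vert b
        · rwa [e] at ha
        · refine ha.trans (SimpleGraph.Adj.reachable ?_)
          exact ⟨e, a, b, hab, hn, rfl, rfl⟩
    exact { preconnected := hpre, nonempty := ⟨Quotient.mk _ h₀⟩ }
  have h1 := hG.card_vert_le_card_edgeSet_add_one
  have hex : ∀ e : G.edgeSet, ∃ h h', Γ.line h h' ∧ ¬ Γ.line h₀ h ∧ h ≠ h' ∧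
      e.1 = s(Quotient.mk Γ.vert h, Quotient.mk Γ.vert h') := by
    rintro ⟨e, he⟩
    induction e with
    | _ u v =>
      obtain ⟨hne, h, h', h1, h2, e1, e2⟩ := he
      exact ⟨h, h', h1, h2, fun e => hne (e1.symm.trans ((congrArg _ e).trans e2)),
        congrArg₂ (fun u v => s(u, v)) e1.symm e2.symm⟩
  choose f g hfg hf hne he using hex
  -- Choosing a line for every edge of `G` is injective because a line has only two half-edges and
  -- thus determines its end vertices.
  have h2 : Nat.card G.edgeSet ≤ (Γ.internalEdges.erase (Quotient.mk _ h₀)).card := by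
    have hl' : ∀ e, ¬ Γ.IsLeg (f e) := fun e H => hne e (H _ (hfg e)).symm
    rw [← Fintype.card_coe, ← Nat.card_eq_fintype_card]
    refine Nat.card_le_card_of_injective (fun e => ⟨Quotient.mk _ (f e), Finset.mem_erase.2
      ⟨fun H => hf e (Γ.line.symm' (Quotient.exact H)), hp.mem_internalEdges.2 (hl' e)⟩⟩) ?_
    intro e e' h
    have h3 : Γ.line (f e) (f e') := Quotient.exact (congrArg Subtype.val h)
    obtain ⟨q, -, -, hq, -⟩ := hp.exists_partner (hl' e)
    have hge := (hq _ (hfg e)).resolve_left (hne e).symm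
    have hge' := hq _ (Γ.line.trans' h3 (hfg e'))
    apply Subtype.ext
    rw [he, he]
    rcases hq _ h3 with h4 | h4
    · rw [h4, hge, hge'.resolve_left (fun H => hne e' (h4.trans H.symm))]
    · rw [h4, hge, hge'.resolve_right (fun H => hne e' (h4.trans H.symm))]
      exact Sym2.eq_swap
  rw [hp.card_innerTypes, card_vertexTypes]
  rw [Finset.card_erase_of_mem (hp.mem_internalEdges.2 hl)] at h2
  have h3 : 0 < Γ.internalEdges.card := Finset.card_pos.2 ⟨_, hp.mem_internalEdges.2 hl⟩
  rw [Nat.card_eq_fintype_card] at h1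
  omega

/-! ### Transport of gluings along isomorphisms -/

section Transport

variable {Γ Γ' γ Γ₁ Γ₁' γ₁ : FGraph F}

theorem Embeds.transport {j : γ.H → Γ.H} (h : Embeds γ Γ j) (θ : Iso Γ Γ₁) (ψ : Iso γ γ₁) :
    Embeds γ₁ Γ₁ (fun b => θ.1 (j (ψ.1.symm b))) := by
  refine ⟨fun b b' e => ψ.1.symm.injective (h.inj (θ.1.injective e)), ?_, ?_, ?_⟩
  · intro b
    obtain ⟨b, rfl⟩ := ψ.1.surjective b
    rw [θ.2.1, h.field, ψ.2.1, Equiv.symm_apply_apply]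
  · intro b y
    obtain ⟨b, rfl⟩ := ψ.1.surjective b
    obtain ⟨y, rfl⟩ := θ.1.surjective y
    rw [θ.2.2.1, Equiv.symm_apply_apply, h.vert]
    constructor
    · rintro ⟨b', rfl, hb'⟩
      exact ⟨ψ.1 b', by simp, (ψ.2.2.1 _ _).2 hb'⟩
    · rintro ⟨b', e, hb'⟩
      obtain ⟨b', rfl⟩ := ψ.1.surjective b'
      exact ⟨b', by simpa using e, (ψ.2.2.1 _ _).1 hb'⟩
  · intro b hb y
    obtain ⟨b, rfl⟩ := ψ.1.surjective b
    obtain ⟨y, rfl⟩ := θ.1.surjective y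
    rw [ψ.isLeg_iff] at hb
    rw [θ.2.2.2, Equiv.symm_apply_apply, h.line b hb]
    constructor
    · rintro ⟨b', rfl, hb'⟩
      exact ⟨ψ.1 b', by simp, (ψ.2.2.2 _ _).2 hb'⟩
    · rintro ⟨b', e, hb'⟩
      obtain ⟨b', rfl⟩ := ψ.1.surjective b'
      exact ⟨b', by simpa using e, (ψ.2.2.2 _ _).1 hb'⟩

theorem GluesCore.transport {X : Type} {U : Γ'.H → Prop} {a : X → Γ'.H} {l : X → γ.H}
    {i : Γ'.H → Γ.H} {j : γ.H → Γ.H} (h : GluesCore Γ Γ' γ U a l i j) (θ : Iso Γ Γ₁)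
    (φ : Iso Γ' Γ₁') (ψ : Iso γ γ₁) {U₁ : Γ₁'.H → Prop} (hU : ∀ x, U₁ (φ.1 x) ↔ U x) :
    GluesCore Γ₁ Γ₁' γ₁ U₁ (fun x => φ.1 (a x)) (fun x => ψ.1 (l x))
      (fun x => θ.1 (i (φ.1.symm x))) (fun b => θ.1 (j (ψ.1.symm b))) where
  embeds := h.embeds.transport θ ψ
  a_inj := φ.1.injective.comp h.a_inj
  a_range x := by
    obtain ⟨x, rfl⟩ := φ.1.surjective x
    rw [hU, h.a_range]
    simp
  l_inj := ψ.1.injective.comp h.l_inj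
  l_range b := by
    obtain ⟨b, rfl⟩ := ψ.1.surjective b
    rw [ψ.isLeg_iff, h.l_range]
    simp
  l_field x := by rw [ψ.2.1, φ.2.1, h.l_field]
  i_inj := θ.1.injective.comp (h.i_inj.comp φ.1.symm.injective)
  i_field x := by
    obtain ⟨x, rfl⟩ := φ.1.surjective x
    rw [θ.2.1, h.i_field, φ.2.1, Equiv.symm_apply_apply]
  cover y := by
    obtain ⟨y, rfl⟩ := θ.1.surjective y
    rcases h.cover y with ⟨b, rfl⟩ | ⟨x, rfl⟩
    · exact Or.inl ⟨ψ.1 b, by simp⟩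
    · exact Or.inr ⟨φ.1 x, by simp⟩
  i_vert x y hx hy := by
    obtain ⟨x, rfl⟩ := φ.1.surjective x
    obtain ⟨y, rfl⟩ := φ.1.surjective y
    rw [θ.2.2.1, φ.2.2.1, Equiv.symm_apply_apply, Equiv.symm_apply_apply, h.i_vert]
    · intro b hb
      exact hx (ψ.1 b) (by simp [hb])
    · intro b hb
      exact hy (ψ.1 b) (by simp [hb])

/-- The image of a place under an isomorphism. -/
def Place.map (φ : Iso Γ Γ') : Γ.Place → Γ'.Place
  | Sum.inl v => Sum.inl (Quotient.map φ.1 (fun a b h => (φ.2.2.1 a b).2 h) v)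
  | Sum.inr e => Sum.inr ⟨Quotient.map φ.1 (fun a b h => (φ.2.2.2 a b).2 h) e.1, by
      obtain ⟨e, he⟩ := e
      obtain ⟨x, rfl⟩ := Quotient.exists_rep e
      simp only [internalEdges, Finset.mem_filter, Finset.mem_univ, true_and] at he ⊢
      rw [← he]
      change (Γ'.block Γ'.line (Quotient.mk _ (φ.1 x))).card = _
      congr 1
      refine block_transfer (fun x _ => φ.2.1 x) (fun x y _ _ e => φ.1.injective e) ?_
      intro y
      obtain ⟨y, rfl⟩ := φ.1.surjective y
      simp [φ.2.2.2]⟩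

theorem Place.has_map (φ : Iso Γ Γ') (p : Γ.Place) (x : Γ.H) :
    (p.map φ).Has (φ.1 x) ↔ p.Has x := by
  rcases p with v | ⟨e, he⟩
  · obtain ⟨y, rfl⟩ := Quotient.exists_rep v
    change Quotient.mk Γ'.vert (φ.1 x) = Quotient.mk Γ'.vert (φ.1 y) ↔
      Quotient.mk Γ.vert x = Quotient.mk Γ.vert y
    rw [Quotient.eq, Quotient.eq]
    exact φ.2.2.1 x y
  · obtain ⟨y, rfl⟩ := Quotient.exists_rep e
    change Quotient.mk Γ'.line (φ.1 x) = Quotient.mk Γ'.line (φ.1 y) ↔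
      Quotient.mk Γ.line x = Quotient.mk Γ.line y
    rw [Quotient.eq, Quotient.eq]
    exact φ.2.2.2 x y

theorem Glues.transport {X : Type} {p : Γ'.Place} {a : X → Γ'.H} {l : X → γ.H}
    {i : Γ'.H → Γ.H} {j : γ.H → Γ.H} (h : Glues Γ Γ' γ p a l i j) (θ : Iso Γ Γ₁)
    (φ : Iso Γ' Γ₁') (ψ : Iso γ γ₁) :
    Glues Γ₁ Γ₁' γ₁ (p.map φ) (fun x => φ.1 (a x)) (fun x => ψ.1 (l x))
      (fun x => θ.1 (i (φ.1.symm x))) (fun b => θ.1 (j (ψ.1.symm b))) := by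
  have hc := h.core.transport θ φ ψ (fun x => Place.has_map φ p x)
  rcases p with v | e
  · have h : GluesVertex Γ Γ' γ v a l i j := h
    refine GluesVertex.mk hc ?_ ?_ ?_ ?_
    · rw [ψ.res_eq]
      exact h.res_card
    · intro x
      simp [h.glue]
    · intro x b e
      obtain ⟨x, rfl⟩ := φ.1.surjective x
      obtain ⟨z, rfl⟩ := h.meet x (ψ.1.symm b) (by simpa using θ.1.injective e)
      exact ⟨z, rfl⟩
    · intro x y
      obtain ⟨x, rfl⟩ := φ.1.surjective x
      obtain ⟨y, rfl⟩ := φ.1.surjective y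
      rw [θ.2.2.2, φ.2.2.2, Equiv.symm_apply_apply, Equiv.symm_apply_apply, h.i_line]
  · have h : GluesEdge Γ Γ' γ e.1 a l i j := h
    refine GluesEdge.mk hc ?_ ?_ ?_ ?_ ?_
    · rw [ψ.res_eq]
      exact h.res_card
    · intro x b e
      exact h.disj _ _ (θ.1.injective e)
    · intro x b
      obtain ⟨x, rfl⟩ := φ.1.surjective x
      obtain ⟨b, rfl⟩ := ψ.1.surjective b
      rw [θ.2.2.2, Equiv.symm_apply_apply, Equiv.symm_apply_apply, h.cross]
      simp
    · intro x y e
      rw [θ.2.2.2, Equiv.symm_apply_apply, Equiv.symm_apply_apply] at e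
      exact h.leg_line _ _ e
    · intro x y
      obtain ⟨x, rfl⟩ := φ.1.surjective x
      obtain ⟨y, rfl⟩ := φ.1.surjective y
      rw [θ.2.2.2, φ.2.2.2, Equiv.symm_apply_apply, Equiv.symm_apply_apply, h.i_line]
      simp

end Transport

/-! ### Uniqueness of the glued graph, the quotient, the place and the labels -/

section Determination

variable {X : Type} {Γ Γ' γ : FGraph F}

/-- The maps `i` and `j` cover `Γ` and meet only along the labels, where `i₁` and `j₁` agree too; so
they induce a map. Vertices and lines of `Γ` are determined by the parts, hence preserved.
Exchanging the two graphs gives the inverse. -/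
theorem GluesVertex.exists_hom {Γ₁ : FGraph F} {v : Quotient Γ'.vert} {a : X → Γ'.H} {l : X → γ.H}
    {i : Γ'.H → Γ.H} {j : γ.H → Γ.H} {i₁ : Γ'.H → Γ₁.H} {j₁ : γ.H → Γ₁.H}
    (h : GluesVertex Γ Γ' γ v a l i j) (h₁ : GluesVertex Γ₁ Γ' γ v a l i₁ j₁) :
    ∃ f : Γ.H → Γ₁.H, (∀ x, f (i x) = i₁ x) ∧ (∀ b, f (j b) = j₁ b) ∧
      (∀ x y, Γ.vert x y → Γ₁.vert (f x) (f y)) ∧ ∀ x y, Γ.line x y → Γ₁.line (f x) (f y) := by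
  have hc : ∀ y, ∃ z, (∀ x, i x = y → z = i₁ x) ∧ ∀ b, j b = y → z = j₁ b := by
    have hk : ∀ x b, i x = j b → i₁ x = j₁ b := by
      intro x b e
      obtain ⟨z, rfl⟩ := h.meet x b e
      rw [h.glue] at e
      rw [h₁.glue, h.embeds.inj e]
    intro y
    rcases h.cover y with ⟨b, rfl⟩ | ⟨x, rfl⟩
    · exact ⟨j₁ b, fun x e => (hk x b e).symm, fun b' e => by rw [h.embeds.inj e]⟩
    · exact ⟨i₁ x, fun x' e => by rw [h.i_inj e], fun b' e => hk x b' e.symm⟩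
  choose f hfi hfj using hc
  have hi : ∀ x, f (i x) = i₁ x := fun x => hfi _ x rfl
  have hj : ∀ b, f (j b) = j₁ b := fun b => hfj _ b rfl
  refine ⟨f, hi, hj, ?_, ?_⟩
  · intro x y hxy
    by_cases hx : ∃ b, j b = x
    · obtain ⟨b, rfl⟩ := hx
      obtain ⟨b', rfl, hb'⟩ := (h.embeds.vert _ _).1 hxy
      rw [hj, hj, h₁.embeds.vert_iff]
      exact hb'
    · have hy : ¬ ∃ b, j b = y := by
        rintro ⟨b, rfl⟩
        obtain ⟨b', hb, -⟩ := (h.embeds.vert _ _).1 (Γ.vert.symm' hxy)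
        exact hx ⟨b', hb⟩
      obtain ⟨x, rfl⟩ := (h.cover x).resolve_left hx
      obtain ⟨y, rfl⟩ := (h.cover y).resolve_left hy
      have h1 := (h.i_vert x y (fun b e => hx ⟨b, e⟩) (fun b e => hy ⟨b, e⟩)).1 hxy
      have hout : ∀ x, (¬ ∃ b, j b = i x) → ∀ b, j₁ b ≠ i₁ x := by
        rintro x hx b e
        obtain ⟨z, rfl⟩ := h₁.meet _ _ e.symm
        exact hx ⟨l z, (h.glue z).symm⟩
      rw [hi, hi]
      exact (h₁.i_vert x y (hout x hx) (hout y hy)).2 h1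
  · have key : ∀ b, ¬ γ.IsLeg b → ∀ y, Γ.line (j b) y → Γ₁.line (f (j b)) (f y) := by
      intro b hb y hy
      obtain ⟨b', rfl, hb'⟩ := (h.embeds.line b hb y).1 hy
      rw [hj, hj]
      exact h₁.embeds.line_of_line hb'
    have hcov : ∀ y, (∃ b, ¬ γ.IsLeg b ∧ j b = y) ∨ ∃ x, i x = y := by
      intro y
      rcases h.cover y with ⟨b, rfl⟩ | H
      · by_cases hb : γ.IsLeg b
        · obtain ⟨z, rfl⟩ := (h.l_range b).1 hb
          exact Or.inr ⟨_, h.glue z⟩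
        · exact Or.inl ⟨b, hb, rfl⟩
      · exact Or.inr H
    intro x y hxy
    rcases hcov x with ⟨b, hb, rfl⟩ | ⟨x, rfl⟩
    · exact key b hb y hxy
    · rcases hcov y with ⟨b, hb, rfl⟩ | ⟨y, rfl⟩
      · exact Γ₁.line.symm' (key b hb _ (Γ.line.symm' hxy))
      · rw [hi, hi, h₁.i_line, ← h.i_line]
        exact hxy

theorem GluesEdge.exists_hom {Γ₁ : FGraph F} {e : Quotient Γ'.line} {a : X → Γ'.H} {l : X → γ.H}
    {i : Γ'.H → Γ.H} {j : γ.H → Γ.H} {i₁ : Γ'.H → Γ₁.H} {j₁ : γ.H → Γ₁.H}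
    (h : GluesEdge Γ Γ' γ e a l i j) (h₁ : GluesEdge Γ₁ Γ' γ e a l i₁ j₁) :
    ∃ f : Γ.H → Γ₁.H, (∀ x, f (i x) = i₁ x) ∧ (∀ b, f (j b) = j₁ b) ∧
      (∀ x y, Γ.vert x y → Γ₁.vert (f x) (f y)) ∧ ∀ x y, Γ.line x y → Γ₁.line (f x) (f y) := by
  have hc : ∀ y, ∃ z, (∀ x, i x = y → z = i₁ x) ∧ ∀ b, j b = y → z = j₁ b := by
    intro y
    rcases h.cover y with ⟨b, rfl⟩ | ⟨x, rfl⟩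
    · exact ⟨j₁ b, fun x e => absurd e (h.disj _ _), fun b' e => by rw [h.embeds.inj e]⟩
    · exact ⟨i₁ x, fun x' e => by rw [h.i_inj e], fun b' e => absurd e.symm (h.disj _ _)⟩
  choose f hfi hfj using hc
  have hi : ∀ x, f (i x) = i₁ x := fun x => hfi _ x rfl
  have hj : ∀ b, f (j b) = j₁ b := fun b => hfj _ b rfl
  refine ⟨f, hi, hj, ?_, ?_⟩
  · intro x y hxy
    rcases h.cover x with ⟨b, rfl⟩ | ⟨x, rfl⟩
    · obtain ⟨b', rfl, hb'⟩ := (h.embeds.vert _ _).1 hxy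
      rw [hj, hj, h₁.embeds.vert_iff]
      exact hb'
    · rcases h.cover y with ⟨b, rfl⟩ | ⟨y, rfl⟩
      · obtain ⟨b', e, -⟩ := (h.embeds.vert _ _).1 (Γ.vert.symm' hxy)
        exact absurd e.symm (h.disj _ _)
      · rw [hi, hi, h₁.i_vert _ _ (fun b => (h₁.disj _ _).symm) fun b => (h₁.disj _ _).symm]
        exact (h.i_vert _ _ (fun b => (h.disj _ _).symm) fun b => (h.disj _ _).symm).1 hxy
  · have key : ∀ b y, Γ.line (j b) y → Γ₁.line (f (j b)) (f y) := by
      intro b y hxy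
      rcases h.cover y with ⟨b', rfl⟩ | ⟨y, rfl⟩
      · rw [hj, hj]
        by_cases hb : γ.IsLeg b
        · by_cases hb' : γ.IsLeg b'
          · obtain ⟨x, rfl⟩ := (h.l_range b).1 hb
            obtain ⟨y, rfl⟩ := (h.l_range b').1 hb'
            rw [h.leg_line x y hxy]
          · exact h₁.embeds.line_of_line
              (γ.line.symm' ((h.embeds.line_iff hb' b).1 (Γ.line.symm' hxy)))
        · exact h₁.embeds.line_of_line ((h.embeds.line_iff hb b').1 hxy)
      · rw [hj, hi]
        exact Γ₁.line.symm' ((h₁.cross _ _).2 ((h.cross _ _).1 (Γ.line.symm' hxy)))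
    intro x y hxy
    rcases h.cover x with ⟨b, rfl⟩ | ⟨x, rfl⟩
    · exact key b y hxy
    · rcases h.cover y with ⟨b, rfl⟩ | ⟨y, rfl⟩
      · exact Γ₁.line.symm' (key b _ (Γ.line.symm' hxy))
      · rw [hi, hi, h₁.i_line, ← h.i_line]
        exact hxy

/-- The graph that arises by gluing is unique up to isomorphism. -/
theorem Glues.exists_iso {Γ₁ : FGraph F} {p : Γ'.Place} {a : X → Γ'.H} {l : X → γ.H}
    {i : Γ'.H → Γ.H} {j : γ.H → Γ.H} {i₁ : Γ'.H → Γ₁.H} {j₁ : γ.H → Γ₁.H}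
    (h : Glues Γ Γ' γ p a l i j) (h₁ : Glues Γ₁ Γ' γ p a l i₁ j₁) :
    ∃ θ : Iso Γ Γ₁, (∀ x, θ.1 (i x) = i₁ x) ∧ ∀ b, θ.1 (j b) = j₁ b := by
  have key : ∀ {Γ Γ₁ : FGraph F} {i : Γ'.H → Γ.H} {j : γ.H → Γ.H} {i₁ : Γ'.H → Γ₁.H}
      {j₁ : γ.H → Γ₁.H}, Glues Γ Γ' γ p a l i j → Glues Γ₁ Γ' γ p a l i₁ j₁ →
      ∃ f : Γ.H → Γ₁.H, (∀ x, f (i x) = i₁ x) ∧ (∀ b, f (j b) = j₁ b) ∧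
      (∀ x y, Γ.vert x y → Γ₁.vert (f x) (f y)) ∧ ∀ x y, Γ.line x y → Γ₁.line (f x) (f y) := by
    intro Γ Γ₁ i j i₁ j₁ h h₁
    rcases p with v | e
    · exact GluesVertex.exists_hom h h₁
    · exact GluesEdge.exists_hom h h₁
  obtain ⟨f, fi, fj, fv, fl⟩ := key h h₁
  obtain ⟨g, gi, gj, gv, gl⟩ := key h₁ h
  have hgf : ∀ y, g (f y) = y := by
    intro y
    rcases h.core.cover y with ⟨b, rfl⟩ | ⟨x, rfl⟩
    · rw [fj, gj]
    · rw [fi, gi]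
  have hfg : ∀ y, f (g y) = y := by
    intro y
    rcases h₁.core.cover y with ⟨b, rfl⟩ | ⟨x, rfl⟩
    · rw [gj, fj]
    · rw [gi, fi]
  refine ⟨⟨⟨f, g, hgf, hfg⟩, ?_, ?_, ?_⟩, fi, fj⟩
  · intro y
    change Γ₁.field (f y) = _
    rcases h.core.cover y with ⟨b, rfl⟩ | ⟨x, rfl⟩
    · rw [fj, h.core.embeds.field, h₁.core.embeds.field]
    · rw [fi, h.core.i_field, h₁.core.i_field]
  · intro x y
    refine ⟨fun e => ?_, fv x y⟩
    have := gv _ _ e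
    rwa [Equiv.coe_fn_mk, hgf, hgf] at this
  · intro x y
    refine ⟨fun e => ?_, fl x y⟩
    have := gl _ _ e
    rwa [Equiv.coe_fn_mk, hgf, hgf] at this

/-- The right-hand side does not involve the labels `a` and `l`, so the place can be recovered from
the position of the two parts in `Γ`. `GluesEdge.has_iff` plays the same role for lines. -/
theorem GluesVertex.has_iff {v : Quotient Γ'.vert} {a : X → Γ'.H} {l : X → γ.H}
    {i : Γ'.H → Γ.H} {j : γ.H → Γ.H} (h : GluesVertex Γ Γ' γ v a l i j) (x : Γ'.H) :
    Quotient.mk _ x = v ↔ ∃ b, j b = i x := by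
  rw [h.a_range]
  constructor
  · rintro ⟨z, rfl⟩
    exact ⟨_, (h.glue z).symm⟩
  · rintro ⟨b, hb⟩
    exact h.meet _ _ hb.symm

theorem GluesEdge.has_iff {e : Quotient Γ'.line} {a : X → Γ'.H} {l : X → γ.H}
    {i : Γ'.H → Γ.H} {j : γ.H → Γ.H} (h : GluesEdge Γ Γ' γ e a l i j) (x : Γ'.H) :
    Quotient.mk _ x = e ↔ ∃ b, Γ.line (i x) (j b) := by
  rw [h.a_range]
  constructor
  · rintro ⟨z, rfl⟩
    obtain ⟨y, hzy, -⟩ := h.exists_other z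
    exact ⟨_, (h.cross _ _).2 ⟨z, y, hzy, rfl, rfl⟩⟩
  · rintro ⟨b, hb⟩
    obtain ⟨z, -, -, rfl, -⟩ := (h.cross _ _).1 hb
    exact ⟨z, rfl⟩

/-- The embedding `j` determines which half-edges of `Γ` come from the quotient: those outside `γ`
and, for a vertex, also the legs of `γ`. The number of legs of `γ` decides between vertex and line,
so the mixed cases do not occur. -/
theorem Glues.exists_quotient_hom {X₁ : Type} {Γ₁' : FGraph F} {p : Γ'.Place} {a : X → Γ'.H}
    {l : X → γ.H} {i : Γ'.H → Γ.H} {j : γ.H → Γ.H} {p₁ : Γ₁'.Place} {a₁ : X₁ → Γ₁'.H}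
    {l₁ : X₁ → γ.H} {i₁ : Γ₁'.H → Γ.H} (h : Glues Γ Γ' γ p a l i j)
    (h₁ : Glues Γ Γ₁' γ p₁ a₁ l₁ i₁ j) :
    ∃ f : Γ'.H → Γ₁'.H, (∀ x, i₁ (f x) = i x) ∧ (∀ x, p.Has x ↔ p₁.Has (f x)) ∧
      (∀ x y, Γ'.vert x y → Γ₁'.vert (f x) (f y)) ∧ ∀ x y, Γ'.line x y → Γ₁'.line (f x) (f y) := by
  rcases p with v | e <;> rcases p₁ with v₁ | e₁
  · have h : GluesVertex Γ Γ' γ v a l i j := h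
    have h₁ : GluesVertex Γ Γ₁' γ v₁ a₁ l₁ i₁ j := h₁
    have hr : ∀ x, ∃ x', i₁ x' = i x := by
      intro x
      rcases h₁.cover (i x) with ⟨b, hb⟩ | H
      · obtain ⟨z, rfl⟩ := h.meet x b hb.symm
        have : γ.IsLeg b := (h.l_range b).2 ⟨z, h.embeds.inj (by rw [hb, h.glue])⟩
        obtain ⟨z', rfl⟩ := (h₁.l_range b).1 this
        exact ⟨a₁ z', by rw [h₁.glue, hb]⟩
      · exact H
    choose f hf using hr
    have hhas : ∀ x, Quotient.mk _ x = v ↔ Quotient.mk _ (f x) = v₁ := by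
      intro x
      rw [h.has_iff, h₁.has_iff, hf]
    refine ⟨f, hf, hhas, ?_, ?_⟩
    · intro x y hxy
      by_cases hx : Quotient.mk _ x = v
      · have hy : Quotient.mk _ y = v := by
          rw [← hx]
          exact Quotient.sound (Γ'.vert.symm' hxy)
        exact Quotient.exact (((hhas x).1 hx).trans ((hhas y).1 hy).symm)
      · have hy : ¬ Quotient.mk _ y = v := by
          intro hy
          refine hx ?_
          rw [← hy]
          exact Quotient.sound hxy
        have hout : ∀ x, ¬ Quotient.mk _ x = v → ∀ b, j b ≠ i x := fun x hx b hb =>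
          hx ((h.has_iff x).2 ⟨b, hb⟩)
        rw [← h₁.i_vert _ _ (by rw [hf]; exact hout x hx) (by rw [hf]; exact hout y hy), hf, hf]
        exact (h.i_vert _ _ (hout x hx) (hout y hy)).2 hxy
    · intro x y hxy
      rw [← h₁.i_line, hf, hf, h.i_line]
      exact hxy
  · exact absurd (GluesEdge.res_card h₁) (GluesVertex.res_card h)
  · exact absurd (GluesEdge.res_card h) (GluesVertex.res_card h₁)
  · have h : GluesEdge Γ Γ' γ e.1 a l i j := h
    have h₁ : GluesEdge Γ Γ₁' γ e₁.1 a₁ l₁ i₁ j := h₁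
    have hr : ∀ x, ∃ x', i₁ x' = i x := by
      intro x
      rcases h₁.cover (i x) with ⟨b, hb⟩ | H
      · exact absurd hb.symm (h.disj _ _)
      · exact H
    choose f hf using hr
    have hhas : ∀ x, Quotient.mk _ x = e.1 ↔ Quotient.mk _ (f x) = e₁.1 := by
      intro x
      rw [h.has_iff, h₁.has_iff, hf]
    refine ⟨f, hf, hhas, ?_, ?_⟩
    · intro x y hxy
      rw [← h₁.i_vert _ _ (fun b => (h₁.disj _ _).symm) fun b => (h₁.disj _ _).symm, hf, hf]
      exact (h.i_vert _ _ (fun b => (h.disj _ _).symm) fun b => (h.disj _ _).symm).2 hxy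
    · intro x y hxy
      by_cases hx : Quotient.mk _ x = e.1
      · have hy : Quotient.mk _ y = e.1 := by
          rw [← hx]
          exact Quotient.sound (Γ'.line.symm' hxy)
        exact Quotient.exact (((hhas x).1 hx).trans ((hhas y).1 hy).symm)
      · have h2 : Γ.line (i x) (i y) := (h.i_line _ _).2 (Or.inr ⟨fun z hz => hx
          ((h.a_range x).2 ⟨z, hz⟩), hxy⟩)
        rw [← hf, ← hf, h₁.i_line] at h2
        rcases h2 with h2 | h2
        · rw [h2]
        · exact h2.2

/-- The contracted graph is determined by the subgraph. -/
theorem Glues.exists_quotient_iso {X₁ : Type} {Γ₁' : FGraph F} {p : Γ'.Place} {a : X → Γ'.H}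
    {l : X → γ.H} {i : Γ'.H → Γ.H} {j : γ.H → Γ.H} {p₁ : Γ₁'.Place} {a₁ : X₁ → Γ₁'.H}
    {l₁ : X₁ → γ.H} {i₁ : Γ₁'.H → Γ.H} (h : Glues Γ Γ' γ p a l i j)
    (h₁ : Glues Γ Γ₁' γ p₁ a₁ l₁ i₁ j) :
    ∃ φ : Iso Γ' Γ₁', (∀ x, i₁ (φ.1 x) = i x) ∧ (∀ x, p.Has x ↔ p₁.Has (φ.1 x)) := by
  obtain ⟨f, fi, fp, fv, fl⟩ := h.exists_quotient_hom h₁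
  obtain ⟨g, gi, gp, gv, gl⟩ := h₁.exists_quotient_hom h
  have hgf : ∀ y, g (f y) = y := fun y => h.core.i_inj (by rw [gi, fi])
  have hfg : ∀ y, f (g y) = y := fun y => h₁.core.i_inj (by rw [fi, gi])
  refine ⟨⟨⟨f, g, hgf, hfg⟩, ?_, ?_, ?_⟩, fi, fp⟩
  · intro y
    change Γ₁'.field (f y) = _
    rw [← h₁.core.i_field, fi, h.core.i_field]
  · intro x y
    refine ⟨fun e => ?_, fv x y⟩
    have := gv _ _ e
    rwa [Equiv.coe_fn_mk, hgf, hgf] at this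
  · intro x y
    refine ⟨fun e => ?_, fl x y⟩
    have := gl _ _ e
    rwa [Equiv.coe_fn_mk, hgf, hgf] at this

/-- The place of the insertion is determined by the subgraph. -/
theorem Glues.place_eq {X₁ : Type} {p p₁ : Γ'.Place} {a : X → Γ'.H} {l : X → γ.H}
    {i : Γ'.H → Γ.H} {j : γ.H → Γ.H} {a₁ : X₁ → Γ'.H} {l₁ : X₁ → γ.H}
    (h : Glues Γ Γ' γ p a l i j) (h₁ : Glues Γ Γ' γ p₁ a₁ l₁ i j) : p = p₁ := by
  obtain ⟨φ, hφ, hp⟩ := h.exists_quotient_iso h₁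
  have hp' : ∀ x, p.Has x ↔ p₁.Has x := by
    intro x
    rw [hp x, h.core.i_inj (hφ x)]
  rcases p with v | e <;> rcases p₁ with v₁ | e₁
  · obtain ⟨x, rfl⟩ := Quotient.exists_rep v
    exact congrArg Sum.inl ((hp' x).1 rfl)
  · exact absurd (GluesEdge.res_card h₁) (GluesVertex.res_card h)
  · exact absurd (GluesEdge.res_card h) (GluesVertex.res_card h₁)
  · obtain ⟨e, he⟩ := e
    obtain ⟨x, rfl⟩ := Quotient.exists_rep e
    exact congrArg Sum.inr (Subtype.ext ((hp' x).1 rfl))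

/-- For a vertex, `l x` is the half-edge identified with `a x`; for a line, it is the leg joined to
the half-edge `a y` with `y ≠ x`. In both cases it is visible in `Γ`. -/
theorem Glues.label_eq {p : Γ'.Place} {a : X → Γ'.H} {l l₁ : X → γ.H}
    {i : Γ'.H → Γ.H} {j : γ.H → Γ.H}
    (h : Glues Γ Γ' γ p a l i j) (h₁ : Glues Γ Γ' γ p a l₁ i j) (x : X) : l x = l₁ x := by
  rcases p with v | e
  · have h : GluesVertex Γ Γ' γ v a l i j := h
    have h₁ : GluesVertex Γ Γ' γ v a l₁ i j := h₁
    exact h.embeds.inj (by rw [← h.glue, ← h₁.glue])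
  · have h : GluesEdge Γ Γ' γ e.1 a l i j := h
    have h₁ : GluesEdge Γ Γ' γ e.1 a l₁ i j := h₁
    obtain ⟨y, hxy, -⟩ := h.exists_other x
    obtain ⟨y', x', hne, e1, e2⟩ := (h₁.cross _ _).1 ((h.cross _ _).2 ⟨y, x, hxy.symm, rfl, rfl⟩)
    obtain rfl := h.a_inj e1
    obtain ⟨w, -, hw⟩ := h.exists_other y'
    rw [hw x hxy, ← hw x' hne.symm, e2]
    rw [hw x' hne.symm, hw x hxy]

end Determination

end FGraph

/-! ### Connectedness and bridges under gluing and contraction -/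

namespace FGraph

variable {F : Type} {X : Type} {Γ Γ' γ : FGraph F}

section Cuts

theorem GluesCore.forall_of_parts {U : Γ'.H → Prop} {a : X → Γ'.H} {l : X → γ.H}
    {i : Γ'.H → Γ.H} {j : γ.H → Γ.H} (h : GluesCore Γ Γ' γ U a l i j) {P : Γ.H → Prop}
    (hj : ∀ b b', P (j b) → P (j b')) (hi : ∀ x x', P (i x) → P (i x')) {u : Γ'.H} {w : γ.H}
    (huw : P (i u) ↔ P (j w)) : ∀ y y', P y → P y' := by
  have key : ∀ y, P y ↔ P (j w) := by
    intro y
    rcases h.cover y with ⟨b, rfl⟩ | ⟨x, rfl⟩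
    · exact ⟨hj _ _, hj _ _⟩
    · rw [← huw]
      exact ⟨hi _ _, hi _ _⟩
  intro y y' hy
  rwa [key, ← key y]

theorem GluesVertex.vert_step {v : Quotient Γ'.vert} {a : X → Γ'.H} {l : X → γ.H}
    {i : Γ'.H → Γ.H} {j : γ.H → Γ.H} (h : GluesVertex Γ Γ' γ v a l i j) {P : Γ.H → Prop}
    (hP : ∀ x y, Γ.vert x y → P x → P y) (hj : ∀ b b', P (j b) → P (j b')) :
    ∀ x y, Γ'.vert x y → P (i x) → P (i y) := by
  intro x y hxy hx
  by_cases H : Quotient.mk _ x = v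
  · have H' : Quotient.mk _ y = v := by
      rw [← H]
      exact Quotient.sound (Γ'.vert.symm' hxy)
    obtain ⟨b, hb⟩ := (h.has_iff x).1 H
    obtain ⟨b', hb'⟩ := (h.has_iff y).1 H'
    rw [← hb] at hx
    rw [← hb']
    exact hj _ _ hx
  · have H' : ¬ Quotient.mk _ y = v := by
      intro H'
      exact H (by rw [← H']; exact Quotient.sound hxy)
    refine hP _ _ ((h.i_vert x y ?_ ?_).2 hxy) hx
    · intro b hb
      exact H ((h.has_iff x).2 ⟨b, hb⟩)
    · intro b hb
      exact H' ((h.has_iff y).2 ⟨b, hb⟩)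

theorem GluesVertex.not_line {v : Quotient Γ'.vert} {a : X → Γ'.H} {l : X → γ.H}
    {i : Γ'.H → Γ.H} {j : γ.H → Γ.H} (h : GluesVertex Γ Γ' γ v a l i j) {b : γ.H}
    (hb : ¬ γ.IsLeg b) (x : Γ'.H) : ¬ Γ.line (j b) (i x) := by
  intro H
  obtain ⟨b', e, hb'⟩ := (h.embeds.line b hb _).1 H
  obtain ⟨z, rfl⟩ := h.meet x b' e.symm
  have : l z = b' := h.embeds.inj (by rw [e, h.glue])
  exact absurd (((h.l_range b').2 ⟨z, this⟩).of_line (γ.line.symm' hb')) hb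

theorem GluesEdge.not_line {e : Quotient Γ'.line} {a : X → Γ'.H} {l : X → γ.H}
    {i : Γ'.H → Γ.H} {j : γ.H → Γ.H} (h : GluesEdge Γ Γ' γ e a l i j) {b : γ.H}
    (hb : ¬ γ.IsLeg b) (x : Γ'.H) : ¬ Γ.line (j b) (i x) := by
  intro H
  obtain ⟨-, y, -, -, rfl⟩ := (h.cross _ _).1 (Γ.line.symm' H)
  exact hb ((h.l_range _).2 ⟨y, rfl⟩)

/-- An invariant predicate on `Γ` is pulled back to `γ` and to `Γ'`. A removed line comes from
exactly one of them: bridgelessness is used there and connectedness on the other, and the constant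
values agree at a glued half-edge. -/
theorem GluesVertex.cuts {v : Quotient Γ'.vert} {a : X → Γ'.H} {l : X → γ.H}
    {i : Γ'.H → Γ.H} {j : γ.H → Γ.H} (h : GluesVertex Γ Γ' γ v a l i j)
    (hγ : γ.CutConnected) (hγ' : γ.CutBridgeless) (x₀ : X)
    (hΓ : Γ'.CutConnected) (hΓ' : Γ'.CutBridgeless) : Γ.CutConnected ∧ Γ.CutBridgeless := by
  constructor
  · intro P hv hl
    have hj : ∀ b b', P (j b) → P (j b') := hγ (fun b => P (j b))
      (fun b b' e => hv _ _ ((h.embeds.vert_iff _ _).2 e))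
      (fun b b' e => hl _ _ (h.embeds.line_of_line e))
    have hi : ∀ x x', P (i x) → P (i x') := hΓ (fun x => P (i x)) (h.vert_step hv hj)
      (fun x y e => hl _ _ ((h.i_line _ _).2 e))
    exact h.forall_of_parts hj hi (u := a x₀) (w := l x₀) (by rw [h.glue])
  · intro y hy P hv hl
    have hcov : (∃ b, ¬ γ.IsLeg b ∧ j b = y) ∨ ∃ x, i x = y := by
      rcases h.cover y with ⟨b, rfl⟩ | H
      · by_cases hb : γ.IsLeg b
        · obtain ⟨z, rfl⟩ := (h.l_range b).1 hb
          exact Or.inr ⟨_, h.glue z⟩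
        · exact Or.inl ⟨b, hb, rfl⟩
      · exact Or.inr H
    rcases hcov with ⟨b₀, hb₀, rfl⟩ | ⟨g₀, rfl⟩
    · have hj : ∀ b b', P (j b) → P (j b') := hγ' b₀ hb₀ (fun b => P (j b))
        (fun b b' e => hv _ _ ((h.embeds.vert_iff _ _).2 e))
        (fun b b' e hn => hl _ _ (h.embeds.line_of_line e)
          fun H => hn ((h.embeds.line_iff hb₀ b).1 H))
      have hi : ∀ x x', P (i x) → P (i x') := hΓ (fun x => P (i x)) (h.vert_step hv hj)
        (fun x y e => hl _ _ ((h.i_line _ _).2 e) (h.not_line hb₀ x))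
      exact h.forall_of_parts hj hi (u := a x₀) (w := l x₀) (by rw [h.glue])
    · have hj : ∀ b b', P (j b) → P (j b') := by
        refine hγ (fun b => P (j b)) (fun b b' e => hv _ _ ((h.embeds.vert_iff _ _).2 e)) ?_
        intro b b' e
        by_cases hb : γ.IsLeg b
        · rw [hb _ e]
          exact id
        · exact hl _ _ (h.embeds.line_of_line e) fun H => h.not_line hb g₀ (Γ.line.symm' H)
      have hg₀ : ¬ Γ'.IsLeg g₀ := fun H => hy ((h.isLeg_iff _).2 ⟨g₀, rfl, H⟩)
      have hi : ∀ x x', P (i x) → P (i x') := hΓ' g₀ hg₀ (fun x => P (i x)) (h.vert_step hv hj)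
        (fun x y e hn => hl _ _ ((h.i_line _ _).2 e) fun H => hn ((h.i_line _ _).1 H))
      exact h.forall_of_parts hj hi (u := a x₀) (w := l x₀) (by rw [h.glue])

theorem GluesEdge.cuts {e : Quotient Γ'.line} {a : X → Γ'.H} {l : X → γ.H}
    {i : Γ'.H → Γ.H} {j : γ.H → Γ.H} (h : GluesEdge Γ Γ' γ e a l i j)
    (hγ : γ.CutConnected) (hγ' : γ.CutBridgeless)
    (hΓ : Γ'.CutConnected) (hΓ' : Γ'.CutBridgeless) : Γ.CutConnected ∧ Γ.CutBridgeless := by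
  have hv' : ∀ P : Γ.H → Prop, (∀ x y, Γ.vert x y → P x → P y) → ∀ x y, Γ'.vert x y →
      P (i x) → P (i y) := fun P hv x y hxy => hv _ _
    ((h.i_vert x y (fun b => (h.disj _ _).symm) (fun b => (h.disj _ _).symm)).2 hxy)
  have hline : ∀ x y, Γ'.line x y → (∃ z, a z = x) → ∃ z, a z = y := by
    intro x y hxy hx
    rw [← h.a_range] at hx ⊢
    rw [← hx]
    exact Quotient.sound (Γ'.line.symm' hxy)
  have hcr : ∀ x y, x ≠ y → Γ.line (i (a x)) (j (l y)) :=
    fun x y hxy => (h.cross _ _).2 ⟨x, y, hxy, rfl, rfl⟩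
  obtain ⟨x₁, x₂, h12, hX⟩ := h.exists_pair h.res_card
  -- passing through the line that carries the inserted graph
  have hi' : ∀ P : Γ.H → Prop, (∀ b b', P (j b) → P (j b')) →
      (∀ x y, x ≠ y → (P (i (a x)) ↔ P (j (l y)))) →
      ∀ x y, Γ'.line x y → (∃ z, a z = x) → P (i x) → P (i y) := by
    rintro P hj hc x y hxy ⟨z, rfl⟩ hx
    obtain ⟨z', rfl⟩ := hline _ _ hxy ⟨z, rfl⟩
    obtain ⟨w, hw, -⟩ := h.exists_other z
    obtain ⟨w', hw', -⟩ := h.exists_other z'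
    rw [hc _ _ hw] at hx
    rw [hc _ _ hw']
    exact hj _ _ hx
  constructor
  · intro P hv hl
    have hj : ∀ b b', P (j b) → P (j b') := hγ (fun b => P (j b))
      (fun b b' e => hv _ _ ((h.embeds.vert_iff _ _).2 e))
      (fun b b' e => hl _ _ (h.embeds.line_of_line e))
    have hc : ∀ x y, x ≠ y → (P (i (a x)) ↔ P (j (l y))) := fun x y hxy =>
      ⟨hl _ _ (hcr x y hxy), hl _ _ (Γ.line.symm' (hcr x y hxy))⟩
    have hi : ∀ x x', P (i x) → P (i x') := by
      refine hΓ (fun x => P (i x)) (hv' P hv) ?_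
      intro x y hxy
      by_cases hx : ∃ z, a z = x
      · exact hi' P hj hc x y hxy hx
      · exact hl _ _ ((h.i_line _ _).2 (Or.inr ⟨fun z hz => hx ⟨z, hz⟩, hxy⟩))
    exact h.forall_of_parts hj hi (hc x₁ x₂ h12)
  · intro y hy P hv hl
    by_cases hb : ∃ b, ¬ γ.IsLeg b ∧ j b = y
    · obtain ⟨b₀, hb₀, rfl⟩ := hb
      have hj : ∀ b b', P (j b) → P (j b') := hγ' b₀ hb₀ (fun b => P (j b))
        (fun b b' e => hv _ _ ((h.embeds.vert_iff _ _).2 e))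
        (fun b b' e hn => hl _ _ (h.embeds.line_of_line e)
          fun H => hn ((h.embeds.line_iff hb₀ b).1 H))
      have hn := h.not_line hb₀
      have hc : ∀ x y, x ≠ y → (P (i (a x)) ↔ P (j (l y))) := fun x y hxy =>
        ⟨hl _ _ (hcr x y hxy) (hn _), hl _ _ (Γ.line.symm' (hcr x y hxy))
          fun H => hn (a x) (Γ.line.trans' H (Γ.line.symm' (hcr x y hxy)))⟩
      have hi : ∀ x x', P (i x) → P (i x') := by
        refine hΓ (fun x => P (i x)) (hv' P hv) ?_
        intro x y hxy
        by_cases hx : ∃ z, a z = x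
        · exact hi' P hj hc x y hxy hx
        · exact hl _ _ ((h.i_line _ _).2 (Or.inr ⟨fun z hz => hx ⟨z, hz⟩, hxy⟩)) (hn _)
      exact h.forall_of_parts hj hi (hc x₁ x₂ h12)
    · have hj : ∀ b b', P (j b) → P (j b') := by
        refine hγ (fun b => P (j b)) (fun b b' e => hv _ _ ((h.embeds.vert_iff _ _).2 e)) ?_
        intro b b' e
        by_cases hb' : γ.IsLeg b
        · rw [hb' _ e]
          exact id
        · refine hl _ _ (h.embeds.line_of_line e) fun H => ?_
          obtain ⟨c, hc, hc'⟩ := (h.embeds.line b hb' y).1 (Γ.line.symm' H)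
          exact hb ⟨c, fun H' => hb' (H'.of_line (γ.line.symm' hc')), hc⟩
      -- If one of the two new lines is removed, this looks in `Γ'` like removing `e`, while the
      -- other new line still attaches `γ`. Otherwise the removed line comes from a line of `Γ'`
      -- other than `e`, and `e` can be crossed through `γ`.
      by_cases hg : ∃ x, Γ.line (i (a x)) y
      · obtain ⟨x, hx⟩ := hg
        obtain ⟨x', hxx', hx'⟩ := h.exists_other x
        have hne : ∀ z, (∀ u, a u ≠ z) → ¬ Γ.line y (i z) := by
          intro z hz H
          rcases (h.line_a_iff hxx' (i z)).1 (Γ.line.trans' hx H) with H' | H'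
          · exact hz x (h.i_inj H').symm
          · exact h.disj _ _ H'
        have hi : ∀ x x', P (i x) → P (i x') := by
          refine hΓ' (a x) (h.not_isLeg_a x) (fun x => P (i x)) (hv' P hv) ?_
          intro z w hzw hn
          have hz : ∀ u, a u ≠ z := by
            rintro u rfl
            exact hn (Quotient.exact (((h.a_range _).2 ⟨x, rfl⟩).trans
              ((h.a_range _).2 ⟨u, rfl⟩).symm))
          exact hl _ _ ((h.i_line _ _).2 (Or.inr ⟨hz, hzw⟩)) (hne z hz)
        have hn : ¬ Γ.line y (i (a x')) := by
          intro H
          rcases (h.line_a_iff hxx' (i (a x'))).1 (Γ.line.trans' hx H) with H' | H'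
          · exact hxx' (h.a_inj (h.i_inj H')).symm
          · exact h.disj _ _ H'
        have hcr' := hcr x' x hxx'.symm
        exact h.forall_of_parts hj hi (u := a x') (w := l x) ⟨hl _ _ hcr' hn,
          hl _ _ (Γ.line.symm' hcr') fun H => hn (Γ.line.trans' H (Γ.line.symm' hcr'))⟩
      · have hc : ∀ x y, x ≠ y → (P (i (a x)) ↔ P (j (l y))) := fun x z hxz =>
          ⟨hl _ _ (hcr x z hxz) fun H => hg ⟨x, Γ.line.symm' H⟩,
            hl _ _ (Γ.line.symm' (hcr x z hxz)) fun H => hg ⟨x, Γ.line.trans' (hcr x z hxz)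
              (Γ.line.symm' H)⟩⟩
        have hy' : ∃ g₀, i g₀ = y := by
          rcases h.cover y with ⟨b, rfl⟩ | H
          · by_cases hb' : γ.IsLeg b
            · obtain ⟨z, rfl⟩ := (h.l_range b).1 hb'
              obtain ⟨w, hw, -⟩ := h.exists_other z
              exact absurd ⟨w, hcr w z hw.symm⟩ hg
            · exact absurd ⟨b, hb', rfl⟩ hb
          · exact H
        obtain ⟨g₀, rfl⟩ := hy'
        have hg₀ : ¬ Γ'.IsLeg g₀ := fun H => hy ((h.isLeg_iff _).2 ⟨g₀, rfl, H⟩)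
        have hg₁ : ∀ u, a u ≠ g₀ := by
          rintro u rfl
          exact hg ⟨u, Γ.line.refl' _⟩
        have hi : ∀ x x', P (i x) → P (i x') := by
          refine hΓ' g₀ hg₀ (fun x => P (i x)) (hv' P hv) ?_
          intro x y hxy hn
          by_cases hx : ∃ z, a z = x
          · exact hi' P hj hc x y hxy hx
          · refine hl _ _ ((h.i_line _ _).2 (Or.inr ⟨fun z hz => hx ⟨z, hz⟩, hxy⟩)) fun H => hn ?_
            rcases (h.i_line _ _).1 H with rfl | H
            · exact Γ'.line.refl' _
            · exact H.2
        exact h.forall_of_parts hj hi (hc x₁ x₂ h12)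

/-- A predicate on `Γ'` that is invariant under vertices is constant on `v`; giving all of `γ` this
value extends it to an invariant predicate on `Γ`. -/
theorem GluesVertex.quotient_cuts {v : Quotient Γ'.vert} {a : X → Γ'.H} {l : X → γ.H}
    {i : Γ'.H → Γ.H} {j : γ.H → Γ.H} (h : GluesVertex Γ Γ' γ v a l i j) (x₀ : X)
    (hΓ : Γ.CutConnected) (hΓ' : Γ.CutBridgeless) : Γ'.CutConnected ∧ Γ'.CutBridgeless := by
  have key : ∀ P : Γ'.H → Prop, (∀ x y, Γ'.vert x y → P x → P y) → ∃ Q : Γ.H → Prop,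
      (∀ x, Q (i x) ↔ P x) ∧ (∀ b, Q (j b) ↔ P (a x₀)) ∧ ∀ x y, Γ.vert x y → Q x → Q y := by
    intro P hP
    have hQ : ∃ Q : Γ.H → Prop, (∀ x, Q (i x) ↔ P x) ∧ (∀ b, Q (j b) ↔ P (a x₀)) := by
      refine ⟨fun y => ((∃ b, j b = y) ∧ P (a x₀)) ∨ ∃ x, i x = y ∧ P x, ?_, ?_⟩
      · intro x
        constructor
        · rintro (⟨hb, hP'⟩ | ⟨x', e, hx'⟩)
          · rw [← h.has_iff, ← (h.a_range (a x₀)).2 ⟨x₀, rfl⟩] at hb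
            exact hP _ _ (Γ'.vert.symm' (Quotient.exact hb)) hP'
          · rwa [← h.i_inj e]
        · exact fun hx => Or.inr ⟨x, rfl, hx⟩
      · intro b
        constructor
        · rintro (⟨hb, hP'⟩ | ⟨x', e, hx'⟩)
          · exact hP'
          · obtain ⟨z, rfl⟩ := h.meet _ _ e
            refine hP _ _ (Quotient.exact ?_) hx'
            rw [(h.a_range (a x₀)).2 ⟨x₀, rfl⟩, (h.a_range (a z)).2 ⟨z, rfl⟩]
        · exact fun hx => Or.inl ⟨⟨b, rfl⟩, hx⟩
    obtain ⟨Q, hQi, hQj⟩ := hQ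
    refine ⟨Q, hQi, hQj, ?_⟩
    intro x y hxy
    by_cases hx : ∃ b, j b = x
    · obtain ⟨b, rfl⟩ := hx
      obtain ⟨b', rfl, -⟩ := (h.embeds.vert _ _).1 hxy
      rw [hQj, hQj]
      exact id
    · have hy : ¬ ∃ b, j b = y := by
        rintro ⟨b, rfl⟩
        obtain ⟨b', hb, -⟩ := (h.embeds.vert _ _).1 (Γ.vert.symm' hxy)
        exact hx ⟨b', hb⟩
      obtain ⟨x, rfl⟩ := (h.cover x).resolve_left hx
      obtain ⟨y, rfl⟩ := (h.cover y).resolve_left hy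
      rw [hQi, hQi]
      exact hP _ _ ((h.i_vert x y (fun b e => hx ⟨b, e⟩) (fun b e => hy ⟨b, e⟩)).1 hxy)
  have hlines : ∀ Q : Γ.H → Prop, (∀ b b', Q (j b) → Q (j b')) → ∀ R : Γ.H → Prop,
      (∀ x y, Γ'.line x y → ¬ R (i x) → Q (i x) → Q (i y)) →
      ∀ x y, Γ.line x y → ¬ R x → Q x → Q y := by
    intro Q hj R hi x y hxy hR
    have hcov : ∀ y, (∃ b, ¬ γ.IsLeg b ∧ j b = y) ∨ ∃ x, i x = y := by
      intro y
      rcases h.cover y with ⟨b, rfl⟩ | H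
      · by_cases hb : γ.IsLeg b
        · obtain ⟨z, rfl⟩ := (h.l_range b).1 hb
          exact Or.inr ⟨_, h.glue z⟩
        · exact Or.inl ⟨b, hb, rfl⟩
      · exact Or.inr H
    rcases hcov x with ⟨b, hb, rfl⟩ | ⟨x, rfl⟩
    · obtain ⟨b', rfl, -⟩ := (h.embeds.line b hb y).1 hxy
      exact hj _ _
    · rcases hcov y with ⟨b, hb, rfl⟩ | ⟨y, rfl⟩
      · exact absurd (Γ.line.symm' hxy) (h.not_line hb x)
      · exact hi _ _ ((h.i_line _ _).1 hxy) hR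
  constructor
  · intro P hv hl x y
    obtain ⟨Q, hQi, hQj, hQv⟩ := key P hv
    rw [← hQi, ← hQi]
    refine hΓ Q hQv (fun x y hxy => hlines Q ?_ (fun _ => False) ?_ x y hxy id) _ _
    · intro b b'
      rw [hQj, hQj]
      exact id
    · intro x y hxy _
      rw [hQi, hQi]
      exact hl _ _ hxy
  · intro g₀ hg₀ P hv hl x y
    obtain ⟨Q, hQi, hQj, hQv⟩ := key P hv
    rw [← hQi, ← hQi]
    have hig : ¬ Γ.IsLeg (i g₀) := by
      intro H
      obtain ⟨z, e, hz⟩ := (h.isLeg_iff _).1 H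
      exact hg₀ (h.i_inj e ▸ hz)
    refine hΓ' (i g₀) hig Q hQv (hlines Q ?_ (fun x => Γ.line (i g₀) x) ?_) _ _
    · intro b b'
      rw [hQj, hQj]
      exact id
    · intro x y hxy hn
      rw [hQi, hQi]
      exact hl _ _ hxy fun H => hn ((h.i_line _ _).2 H)

/-- A predicate on `Γ'` is extended by a constant value on `γ`, which may be chosen freely because
`γ` shares no half-edges with `Γ'`. The value is that of the predicate at an end of `e` whose
connection to `γ` remains. -/
theorem GluesEdge.quotient_cuts {e : Quotient Γ'.line} {a : X → Γ'.H} {l : X → γ.H}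
    {i : Γ'.H → Γ.H} {j : γ.H → Γ.H} (h : GluesEdge Γ Γ' γ e a l i j)
    (hΓ : Γ.CutConnected) (hΓ' : Γ.CutBridgeless) : Γ'.CutConnected ∧ Γ'.CutBridgeless := by
  have key : ∀ (P : Γ'.H → Prop) (R : Prop), (∀ x y, Γ'.vert x y → P x → P y) →
      ∃ Q : Γ.H → Prop, (∀ x, Q (i x) ↔ P x) ∧ (∀ b, Q (j b) ↔ R) ∧
      ∀ x y, Γ.vert x y → Q x → Q y := by
    intro P R hP
    have hQ : ∃ Q : Γ.H → Prop, (∀ x, Q (i x) ↔ P x) ∧ (∀ b, Q (j b) ↔ R) := by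
      refine ⟨fun y => ((∃ b, j b = y) ∧ R) ∨ ∃ x, i x = y ∧ P x, ?_, ?_⟩
      · intro x
        constructor
        · rintro (⟨⟨b, hb⟩, hP'⟩ | ⟨x', e, hx'⟩)
          · exact absurd hb.symm (h.disj _ _)
          · rwa [← h.i_inj e]
        · exact fun hx => Or.inr ⟨x, rfl, hx⟩
      · intro b
        constructor
        · rintro (⟨hb, hP'⟩ | ⟨x', e, hx'⟩)
          · exact hP'
          · exact absurd e (h.disj _ _)
        · exact fun hx => Or.inl ⟨⟨b, rfl⟩, hx⟩
    obtain ⟨Q, hQi, hQj⟩ := hQ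
    refine ⟨Q, hQi, hQj, ?_⟩
    intro x y hxy
    rcases h.cover x with ⟨b, rfl⟩ | ⟨x, rfl⟩
    · obtain ⟨b', rfl, -⟩ := (h.embeds.vert _ _).1 hxy
      rw [hQj, hQj]
      exact id
    · rcases h.cover y with ⟨b, rfl⟩ | ⟨y, rfl⟩
      · obtain ⟨b', e, -⟩ := (h.embeds.vert _ _).1 (Γ.vert.symm' hxy)
        exact absurd e.symm (h.disj _ _)
      · rw [hQi, hQi]
        exact hP _ _ ((h.i_vert x y (fun b => (h.disj _ _).symm) (fun b => (h.disj _ _).symm)).1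
          hxy)
  have hlines : ∀ (Q : Γ.H → Prop) (N : Γ.H → Prop), (∀ x y, Γ.line x y → N x → N y) →
      (∀ b b', Q (j b) → Q (j b')) →
      (∀ x y, x ≠ y → ¬ N (i (a x)) → (Q (i (a x)) ↔ Q (j (l y)))) →
      (∀ x y, (∀ z, a z ≠ x) → Γ'.line x y → ¬ N (i x) → Q (i x) → Q (i y)) →
      ∀ x y, Γ.line x y → ¬ N x → Q x → Q y := by
    intro Q N hN hj hc hi x y hxy hR
    rcases h.cover x with ⟨b, rfl⟩ | ⟨x, rfl⟩
    · rcases h.cover y with ⟨b', rfl⟩ | ⟨y, rfl⟩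
      · exact hj _ _
      · obtain ⟨u, w, huw, rfl, rfl⟩ := (h.cross _ _).1 (Γ.line.symm' hxy)
        exact (hc _ _ huw fun H => hR (hN _ _ (Γ.line.symm' hxy) H)).2
    · rcases h.cover y with ⟨b, rfl⟩ | ⟨y, rfl⟩
      · obtain ⟨u, w, huw, rfl, rfl⟩ := (h.cross _ _).1 hxy
        exact (hc _ _ huw hR).1
      · rcases (h.i_line _ _).1 hxy with rfl | ⟨h1, h2⟩
        · exact id
        · exact hi _ _ h1 h2 hR
  have haa : ∀ x y, Γ'.line (a x) (a y) := fun x y =>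
    Quotient.exact (((h.a_range _).2 ⟨x, rfl⟩).trans ((h.a_range _).2 ⟨y, rfl⟩).symm)
  have hline : ∀ x y, Γ'.line x y → (∃ z, a z = x) → ∃ z, a z = y := by
    intro x y hxy hx
    rw [← h.a_range] at hx ⊢
    rw [← hx]
    exact Quotient.sound (Γ'.line.symm' hxy)
  constructor
  · intro P hv hl x y
    obtain ⟨x₁, -, -, -⟩ := h.exists_pair h.res_card
    obtain ⟨Q, hQi, hQj, hQv⟩ := key P (P (a x₁)) hv
    rw [← hQi, ← hQi]
    refine hΓ Q hQv (fun x y hxy => hlines Q (fun _ => False) (fun _ _ _ => id) ?_ ?_ ?_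
      x y hxy id) _ _
    · intro b b'
      rw [hQj, hQj]
      exact id
    · intro x y _ _
      rw [hQi, hQj]
      exact ⟨hl _ _ (haa _ _), hl _ _ (haa _ _)⟩
    · intro x y _ hxy _
      rw [hQi, hQi]
      exact hl _ _ hxy
  · intro g₀ hg₀ P hv hl x y
    have hig : ¬ Γ.IsLeg (i g₀) := by
      intro H
      obtain ⟨z, e, hz⟩ := (h.isLeg_iff _).1 H
      exact hg₀ (h.i_inj e ▸ hz)
    by_cases H : ∃ x, a x = g₀
    · obtain ⟨x₁, rfl⟩ := H
      obtain ⟨x₂, h12, hX⟩ := h.exists_other x₁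
      -- Here `e` itself is cut. In `Γ` only the new line at `a x₁` is cut, so `γ` has to take the
      -- value at the other end `a x₂`.
      obtain ⟨Q, hQi, hQj, hQv⟩ := key P (P (a x₂)) hv
      rw [← hQi, ← hQi]
      refine hΓ' (i (a x₁)) hig Q hQv (hlines Q (fun z => Γ.line (i (a x₁)) z)
        (fun x y h1 h2 => Γ.line.trans' h2 h1) ?_ ?_ ?_) _ _
      · intro b b'
        rw [hQj, hQj]
        exact id
      · intro u w huw hn
        rw [hQi, hQj]
        have : u ≠ x₁ := by
          rintro rfl
          exact hn (Γ.line.refl' _)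
        rw [hX u this]
      · intro u w hu huw _
        rw [hQi, hQi]
        refine hl _ _ huw fun H => ?_
        obtain ⟨z, hz⟩ := hline _ _ H ⟨x₁, rfl⟩
        exact hu z hz
    · obtain ⟨x₁, -, -, -⟩ := h.exists_pair h.res_card
      obtain ⟨Q, hQi, hQj, hQv⟩ := key P (P (a x₁)) hv
      rw [← hQi, ← hQi]
      refine hΓ' (i g₀) hig Q hQv (hlines Q (fun z => Γ.line (i g₀) z)
        (fun x y h1 h2 => Γ.line.trans' h2 h1) ?_ ?_ ?_) _ _
      · intro b b'
        rw [hQj, hQj]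
        exact id
      · intro u w huw _
        rw [hQi, hQj]
        have hna : ∀ u, ¬ Γ'.line g₀ (a u) := fun u H' =>
          H (hline _ _ (Γ'.line.symm' H') ⟨u, rfl⟩)
        exact ⟨hl _ _ (haa _ _) (hna _), hl _ _ (haa _ _) (hna _)⟩
      · intro u w hu huw hn
        rw [hQi, hQi]
        exact hl _ _ huw fun H' => hn ((h.i_line _ _).2 (Or.inr ⟨fun z hz => H ⟨z, hz⟩, H'⟩))

end Cuts

end FGraph

/-! ### Insertion and contraction preserve 1PI graphs -/

namespace FeynmanTheory

open FGraph

variable {T : FeynmanTheory} {Γ Γ' γ : FGraph T.FieldType} {X : Type}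

theorem disjoint_interactions_edges {τ : Multiset T.FieldType} (h : τ ∈ T.interactions)
    (h' : τ ∈ T.edges) : False := by
  have h1 := T.three_le_card _ h
  have h2 := card_of_mem_edges h'
  omega

theorem exists_label_of_res {U : Γ'.H → Prop} {a : X → Γ'.H} {l : X → γ.H} {i : Γ'.H → Γ.H}
    {j : γ.H → Γ.H} (h : GluesCore Γ Γ' γ U a l i j) (hγ : T.IsOnePI γ) : Nonempty X := by
  have h2 := hγ.two_le_legs
  unfold FGraph.res at h2
  rw [Multiset.card_map, Finset.card_val] at h2
  obtain ⟨b, hb⟩ := Finset.card_pos.1 (lt_of_lt_of_le two_pos h2)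
  obtain ⟨x, -⟩ := (h.l_range b).1 (by simpa using hb)
  exact ⟨x⟩

/-- Inserting a 1PI graph into a 1PI graph gives a 1PI graph. -/
theorem IsOnePI.of_glues {p : Γ'.Place} {a : X → Γ'.H} {l : X → γ.H} {i : Γ'.H → Γ.H}
    {j : γ.H → Γ.H} (h : Glues Γ Γ' γ p a l i j) (hΓ' : T.IsOnePI Γ') (hγ : T.IsOnePI γ) :
    T.IsOnePI Γ := by
  obtain ⟨x₀⟩ := exists_label_of_res h.core hγ
  have hres : 2 ≤ Γ.res.card := by
    rw [h.res_eq]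
    exact hΓ'.two_le_legs
  have h1 := hΓ'.card_vertexTypes_le
  have h2 := hγ.card_vertexTypes_le
  have hty := h.res_eq_type
  rcases p with v | e
  · have h : GluesVertex Γ Γ' γ v a l i j := h
    have hV := h.vertexTypes_add
    have hE := h.innerTypes_eq
    obtain ⟨hc, hb⟩ := h.cuts hγ.cutConnected hγ.cutBridgeless x₀ hΓ'.cutConnected
      hΓ'.cutBridgeless
    refine isOnePI_iff.2 ⟨?_, ?_, ⟨i (a x₀)⟩, hc, hb, ?_, hres⟩
    · intro τ hτ
      have : τ ∈ Γ'.vertexTypes + γ.vertexTypes := by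
        rw [← hV]
        exact Multiset.mem_add.2 (Or.inl hτ)
      rcases Multiset.mem_add.1 this with H | H
      · exact hΓ'.vertexTypes_mem _ H
      · exact hγ.vertexTypes_mem _ H
    · intro τ hτ
      rw [hE] at hτ
      rcases Multiset.mem_add.1 hτ with H | H
      · exact hΓ'.innerTypes_mem _ H
      · exact hγ.innerTypes_mem _ H
    · have := congrArg Multiset.card hV
      rw [hE]
      simp only [Multiset.card_add, Multiset.card_singleton] at this ⊢
      omega
  · have h : GluesEdge Γ Γ' γ e.1 a l i j := h
    have hV := h.vertexTypes_eq
    have hE := h.innerTypes_eq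
    obtain ⟨hc, hb⟩ := h.cuts hγ.cutConnected hγ.cutBridgeless hΓ'.cutConnected
      hΓ'.cutBridgeless
    refine isOnePI_iff.2 ⟨?_, ?_, ⟨i (a x₀)⟩, hc, hb, ?_, hres⟩
    · intro τ hτ
      rw [hV] at hτ
      rcases Multiset.mem_add.1 hτ with H | H
      · exact hΓ'.vertexTypes_mem _ H
      · exact hγ.vertexTypes_mem _ H
    · intro τ hτ
      rw [hE] at hτ
      rcases Multiset.mem_add.1 hτ with H | H
      · rcases Multiset.mem_add.1 H with H | H
        · exact hΓ'.innerTypes_mem _ H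
        · exact hγ.innerTypes_mem _ H
      · rw [Multiset.mem_singleton.1 H, hty]
        refine hΓ'.innerTypes_mem _ ?_
        rw [hΓ'.innerPairs.innerTypes_eq]
        exact Multiset.mem_map.2 ⟨e.1, e.2, rfl⟩
    · rw [hV, hE]
      simp only [Multiset.card_add, Multiset.card_singleton]
      omega

/-- Contracting a 1PI subgraph of a 1PI graph gives a 1PI graph, unless no lines remain. -/
theorem IsOnePI.quotient_of_glues {p : Γ'.Place} {a : X → Γ'.H} {l : X → γ.H} {i : Γ'.H → Γ.H}
    {j : γ.H → Γ.H} (h : Glues Γ Γ' γ p a l i j) (hΓ : T.IsOnePI Γ) (hγ : T.IsOnePI γ)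
    (hres : γ.res ∈ T.R) (hne : edgeSet j ≠ Γ.internalEdges) : T.IsOnePI Γ' := by
  obtain ⟨x₀⟩ := exists_label_of_res h.core hγ
  have hlegs : 2 ≤ Γ'.res.card := by
    rw [← h.res_eq]
    exact hΓ.two_le_legs
  have hty := h.res_eq_type
  have hpair : (∀ τ ∈ Γ'.innerTypes, τ ∈ T.edges) → Γ'.InnerPairs :=
    fun h τ hτ => card_of_mem_edges (h τ hτ)
  rcases p with v | e
  · have h : GluesVertex Γ Γ' γ v a l i j := h
    have hV := h.vertexTypes_add
    have hE := h.innerTypes_eq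
    obtain ⟨hc, hb⟩ := h.quotient_cuts x₀ hΓ.cutConnected hΓ.cutBridgeless
    have hinner : ∀ τ ∈ Γ'.innerTypes, τ ∈ T.edges := by
      intro τ hτ
      refine hΓ.innerTypes_mem τ ?_
      rw [hE]
      exact Multiset.mem_add.2 (Or.inl hτ)
    -- If only legs remained, every inner line of `Γ` would belong to `γ`.
    have hx : ∃ x, ¬ Γ'.IsLeg x := by
      by_contra! H
      refine hne (Finset.ext fun q => ?_)
      obtain ⟨y, rfl⟩ := Quotient.exists_rep q
      rw [hΓ.innerPairs.mem_internalEdges]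
      refine (h.embeds.mk_mem_edgeSet y).trans ?_
      constructor
      · rintro ⟨b, rfl, hb⟩
        exact h.embeds.not_isLeg hb
      · intro hy
        rcases h.cover y with ⟨b, rfl⟩ | ⟨x, rfl⟩
        · refine ⟨b, rfl, fun hb => hy ?_⟩
          obtain ⟨z, rfl⟩ := (h.l_range b).1 hb
          exact (h.isLeg_iff _).2 ⟨a z, h.glue z, H _⟩
        · exact absurd ((h.isLeg_iff _).2 ⟨x, rfl, H x⟩) hy
    obtain ⟨x, hx⟩ := hx
    -- Counting alone does not bound the loop number of the quotient from below; a remaining inner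
    -- line that is not a bridge does.
    refine isOnePI_iff.2 ⟨?_, hinner, ⟨x⟩, hc, hb,
      card_vertexTypes_le_of_bridgeless (hpair hinner) hb x hx, hlegs⟩
    intro τ hτ
    have : τ ∈ Γ.vertexTypes + {Γ'.vertexType v} := by
      rw [hV]
      exact Multiset.mem_add.2 (Or.inl hτ)
    rcases Multiset.mem_add.1 this with H | H
    · exact hΓ.vertexTypes_mem _ H
    · rw [Multiset.mem_singleton.1 H]
      have hty' : γ.res = Γ'.vertexType v := hty
      rw [← hty']
      rcases Finset.mem_union.1 hres with H | H
      · exact H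
      · exact absurd (card_of_mem_edges H) h.res_card
  · have h : GluesEdge Γ Γ' γ e.1 a l i j := h
    have hV := h.vertexTypes_eq
    have hE := h.innerTypes_eq
    obtain ⟨hc, hb⟩ := h.quotient_cuts hΓ.cutConnected hΓ.cutBridgeless
    have hinner : ∀ τ ∈ Γ'.innerTypes, τ ∈ T.edges := by
      intro τ hτ
      refine hΓ.innerTypes_mem τ ?_
      rw [hE]
      exact Multiset.mem_add.2 (Or.inl (Multiset.mem_add.2 (Or.inl hτ)))
    refine isOnePI_iff.2 ⟨?_, hinner, ⟨a x₀⟩, hc, hb,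
      card_vertexTypes_le_of_bridgeless (hpair hinner) hb (a x₀) (h.not_isLeg_a x₀), hlegs⟩
    intro τ hτ
    refine hΓ.vertexTypes_mem τ ?_
    rw [hV]
    exact Multiset.mem_add.2 (Or.inl hτ)

theorem IsOnePI.loops_eq_typeSum (h : T.IsOnePI Γ) :
    (Γ.loops : ℤ) = 1 - Γ.typeSum (fun _ => (1 : ℤ)) := by
  have := h.loops_add
  unfold FGraph.typeSum
  simp only [Multiset.map_const', Multiset.sum_replicate, nsmul_eq_mul, mul_one]
  omega

theorem IsOnePI.loops_of_glues {p : Γ'.Place} {a : X → Γ'.H} {l : X → γ.H} {i : Γ'.H → Γ.H}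
    {j : γ.H → Γ.H} (h : Glues Γ Γ' γ p a l i j) (hΓ : T.IsOnePI Γ) (hΓ' : T.IsOnePI Γ')
    (hγ : T.IsOnePI γ) : Γ.loops = Γ'.loops + γ.loops := by
  have h1 := hΓ.loops_eq_typeSum
  have h2 := hΓ'.loops_eq_typeSum
  have h3 := hγ.loops_eq_typeSum
  have h4 := h.typeSum_add (fun _ => (1 : ℤ))
  omega

end FeynmanTheory

/-! ### Construction of the glued graph -/

namespace FGraph

variable {F : Type} {X : Type} {Γ' γ : FGraph F}

/-- The half-edges are those of `Γ'` and the half-edges of `γ` that are not legs, the leg `l x`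
being represented by `a x`. Vertices and lines are the fibres of maps `κ` and `μ` to the disjoint
unions of those of the parts, so that no equivalence relation has to be checked. -/
theorem exists_glues_vertex (v : Quotient Γ'.vert) {a : X → Γ'.H} {l : X → γ.H}
    (a_inj : Function.Injective a) (a_range : ∀ h, Quotient.mk _ h = v ↔ ∃ x, a x = h)
    (l_inj : Function.Injective l) (l_range : ∀ b, γ.IsLeg b ↔ ∃ x, l x = b)
    (l_field : ∀ x, γ.field (l x) = Γ'.field (a x)) (hres : γ.res.card ≠ 2) :
    ∃ (Γ : FGraph F) (i : Γ'.H → Γ.H) (j : γ.H → Γ.H), GluesVertex Γ Γ' γ v a l i j := by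
  let H : Type := Γ'.H ⊕ {b : γ.H // ¬ γ.IsLeg b}
  let j : γ.H → H := fun b => if h : γ.IsLeg b then Sum.inl (a ((l_range b).1 h).choose)
    else Sum.inr ⟨b, h⟩
  have jl : ∀ x, j (l x) = Sum.inl (a x) := by
    intro x
    have h : γ.IsLeg (l x) := (l_range _).2 ⟨x, rfl⟩
    simp only [j, dif_pos h]
    rw [l_inj ((l_range (l x)).1 h).choose_spec]
  have jn : ∀ b (h : ¬ γ.IsLeg b), j b = Sum.inr ⟨b, h⟩ := fun b h => dif_neg h
  let κ : H → Quotient Γ'.vert ⊕ Quotient γ.vert := Sum.elim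
    (fun h => if hx : ∃ x, a x = h then Sum.inr (Quotient.mk _ (l hx.choose))
      else Sum.inl (Quotient.mk _ h)) (fun b => Sum.inr (Quotient.mk _ b.1))
  have κa : ∀ x, κ (Sum.inl (a x)) = Sum.inr (Quotient.mk _ (l x)) := by
    intro x
    have hx : ∃ y, a y = a x := ⟨x, rfl⟩
    simp only [κ, Sum.elim_inl, dif_pos hx]
    rw [a_inj hx.choose_spec]
  have κn : ∀ h, (¬ ∃ x, a x = h) → κ (Sum.inl h) = Sum.inl (Quotient.mk _ h) :=
    fun h hx => dif_neg hx
  have κj : ∀ b, κ (j b) = Sum.inr (Quotient.mk _ b) := by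
    intro b
    by_cases h : γ.IsLeg b
    · obtain ⟨x, rfl⟩ := (l_range b).1 h
      rw [jl, κa]
    · rw [jn b h]
      rfl
  let μ : H → Quotient Γ'.line ⊕ Quotient γ.line := Sum.elim
    (fun h => Sum.inl (Quotient.mk _ h)) (fun b => Sum.inr (Quotient.mk _ b.1))
  let Γ : FGraph F :=
    { H := H
      fin := inferInstanceAs (Fintype (Γ'.H ⊕ {b : γ.H // ¬ γ.IsLeg b}))
      field := Sum.elim Γ'.field (fun b => γ.field b.1)
      vert := Setoid.ker κ
      line := Setoid.ker μ }
  have j_inj : Function.Injective j := by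
    intro b b' e
    by_cases h : γ.IsLeg b <;> by_cases h' : γ.IsLeg b'
    · obtain ⟨x, rfl⟩ := (l_range b).1 h
      obtain ⟨x', rfl⟩ := (l_range b').1 h'
      rw [jl, jl] at e
      rw [a_inj (Sum.inl_injective e)]
    · obtain ⟨x, rfl⟩ := (l_range b).1 h
      rw [jl, jn b' h'] at e
      exact absurd e (by simp)
    · obtain ⟨x', rfl⟩ := (l_range b').1 h'
      rw [jl, jn b h] at e
      exact absurd e (by simp)
    · rw [jn b h, jn b' h'] at e
      exact congrArg Subtype.val (Sum.inr_injective e)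
  have emb : Embeds γ Γ j := by
    refine ⟨j_inj, ?_, ?_, ?_⟩
    · intro b
      by_cases h : γ.IsLeg b
      · obtain ⟨x, rfl⟩ := (l_range b).1 h
        rw [jl, l_field]
        rfl
      · rw [jn b h]
        rfl
    · intro b h
      change κ (j b) = κ h ↔ _
      rw [κj]
      constructor
      · intro e
        have : ∃ b', j b' = h := by
          rcases h with h | ⟨b', hb'⟩
          · by_cases hx : ∃ x, a x = h
            · obtain ⟨x, rfl⟩ := hx
              exact ⟨l x, jl x⟩
            · rw [κn h hx] at e
              exact absurd e (by simp)
          · exact ⟨b', jn b' hb'⟩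
        obtain ⟨b', rfl⟩ := this
        rw [κj] at e
        exact ⟨b', rfl, Quotient.exact (Sum.inr_injective e)⟩
      · rintro ⟨b', rfl, e⟩
        rw [κj]
        exact congrArg Sum.inr (Quotient.sound e)
    · intro b hb h
      change μ (j b) = μ h ↔ _
      rw [jn b hb]
      constructor
      · intro e
        rcases h with h | ⟨b', hb'⟩
        · exact absurd e (by simp [μ])
        · exact ⟨b', jn b' hb', Quotient.exact (Sum.inr_injective e)⟩
      · rintro ⟨b', rfl, e⟩
        have hb' : ¬ γ.IsLeg b' := fun h => hb (h.of_line (γ.line.symm' e))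
        rw [jn b' hb']
        exact congrArg Sum.inr (Quotient.sound e)
  have hout : ∀ h, (∀ b, j b ≠ Sum.inl h) → ¬ ∃ x, a x = h := by
    rintro h H ⟨x, rfl⟩
    exact H (l x) (jl x)
  refine ⟨Γ, Sum.inl, j, GluesVertex.mk ⟨emb, a_inj, a_range, l_inj, l_range, l_field,
    Sum.inl_injective, fun _ => rfl, ?_, ?_⟩ hres ?_ ?_ ?_⟩
  · rintro (h | ⟨b, hb⟩)
    · exact Or.inr ⟨h, rfl⟩
    · exact Or.inl ⟨b, jn b hb⟩
  · intro h h' hh hh'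
    change κ (Sum.inl h) = κ (Sum.inl h') ↔ _
    rw [κn h (hout h hh), κn h' (hout h' hh')]
    exact ⟨fun e => Quotient.exact (Sum.inl_injective e), fun e => congrArg Sum.inl (Quotient.sound e)⟩
  · intro x
    exact (jl x).symm
  · intro h b e
    by_cases hb : γ.IsLeg b
    · obtain ⟨x, rfl⟩ := (l_range b).1 hb
      rw [jl] at e
      exact ⟨x, (Sum.inl_injective e).symm⟩
    · rw [jn b hb] at e
      exact absurd e (by simp)
  · intro h h'
    exact ⟨fun e => Quotient.exact (Sum.inl_injective e), fun e => congrArg Sum.inl (Quotient.sound e)⟩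

/-- All half-edges of both graphs are kept. The involution `σ` exchanges the two labels, and `μ`
puts `a x` on the line of the leg `l (σ x)`; this splits `e` into two lines. -/
theorem exists_glues_edge (e : Quotient Γ'.line) {a : X → Γ'.H} {l : X → γ.H}
    (a_inj : Function.Injective a) (a_range : ∀ h, Quotient.mk _ h = e ↔ ∃ x, a x = h)
    (l_inj : Function.Injective l) (l_range : ∀ b, γ.IsLeg b ↔ ∃ x, l x = b)
    (l_field : ∀ x, γ.field (l x) = Γ'.field (a x)) (hres : γ.res.card = 2) :
    ∃ (Γ : FGraph F) (i : Γ'.H → Γ.H) (j : γ.H → Γ.H), GluesEdge Γ Γ' γ e a l i j := by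
  have hσ : ∀ x : X, ∃ y, x ≠ y ∧ ∀ z, z ≠ x → z = y := by
    intro x
    obtain ⟨u, v, hne, huv⟩ := exists_pair_of_legs l_inj l_range hres
    rcases huv x with rfl | rfl
    · exact ⟨v, hne, fun z hz => (huv z).resolve_left hz⟩
    · exact ⟨u, hne.symm, fun z hz => (huv z).resolve_right hz⟩
  choose σ hσ hσ' using hσ
  let κ : Γ'.H ⊕ γ.H → Quotient Γ'.vert ⊕ Quotient γ.vert :=
    Sum.elim (fun h => Sum.inl (Quotient.mk _ h)) (fun b => Sum.inr (Quotient.mk _ b))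
  let μ : Γ'.H ⊕ γ.H → Quotient Γ'.line ⊕ Quotient γ.line := Sum.elim
    (fun h => if hx : ∃ x, a x = h then Sum.inr (Quotient.mk _ (l (σ hx.choose)))
      else Sum.inl (Quotient.mk _ h)) (fun b => Sum.inr (Quotient.mk _ b))
  have μa : ∀ x, μ (Sum.inl (a x)) = Sum.inr (Quotient.mk _ (l (σ x))) := by
    intro x
    have hx : ∃ y, a y = a x := ⟨x, rfl⟩
    simp only [μ, Sum.elim_inl, dif_pos hx]
    rw [a_inj hx.choose_spec]
  have μn : ∀ h, (¬ ∃ x, a x = h) → μ (Sum.inl h) = Sum.inl (Quotient.mk _ h) :=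
    fun h hx => dif_neg hx
  have leg_iff : ∀ x b, Quotient.mk γ.line (l x) = Quotient.mk γ.line b ↔ l x = b := by
    intro x b
    constructor
    · intro e
      exact ((l_range _).2 ⟨x, rfl⟩ b (Quotient.exact e)).symm
    · intro e
      rw [e]
  let Γ : FGraph F :=
    { H := Γ'.H ⊕ γ.H
      fin := inferInstance
      field := Sum.elim Γ'.field γ.field
      vert := Setoid.ker κ
      line := Setoid.ker μ }
  have emb : Embeds γ Γ Sum.inr := by
    refine ⟨Sum.inr_injective, fun _ => rfl, ?_, ?_⟩
    · intro b h
      constructor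
      · intro e
        rcases h with h | b'
        · exact absurd (show Sum.inr _ = Sum.inl _ from e) (by simp)
        · exact ⟨b', rfl, Quotient.exact (Sum.inr_injective e)⟩
      · rintro ⟨b', rfl, e⟩
        exact congrArg Sum.inr (Quotient.sound e)
    · intro b hb h
      constructor
      · intro e
        have e : μ (Sum.inr b) = μ h := e
        rcases h with h | b'
        · by_cases hx : ∃ x, a x = h
          · obtain ⟨x, rfl⟩ := hx
            rw [μa] at e
            have := (leg_iff _ _).1 (Sum.inr_injective e).symm
            exact absurd ((l_range b).2 ⟨_, this⟩) hb
          · rw [μn h hx] at e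
            exact absurd (show Sum.inr _ = Sum.inl _ from e) (by simp)
        · exact ⟨b', rfl, Quotient.exact (Sum.inr_injective e)⟩
      · rintro ⟨b', rfl, e⟩
        exact congrArg Sum.inr (Quotient.sound e)
  refine ⟨Γ, Sum.inl, Sum.inr, GluesEdge.mk ⟨emb, a_inj, a_range, l_inj, l_range, l_field,
    Sum.inl_injective, fun _ => rfl, ?_, ?_⟩ hres ?_ ?_ ?_ ?_⟩
  · rintro (h | b)
    · exact Or.inr ⟨h, rfl⟩
    · exact Or.inl ⟨b, rfl⟩
  · intro h h' _ _
    exact ⟨fun e => Quotient.exact (Sum.inl_injective e), fun e => congrArg Sum.inl (Quotient.sound e)⟩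
  · intro h b
    exact Sum.inl_ne_inr
  · intro h b
    change μ (Sum.inl h) = μ (Sum.inr b) ↔ _
    constructor
    · intro e
      by_cases hx : ∃ x, a x = h
      · obtain ⟨x, rfl⟩ := hx
        rw [μa] at e
        exact ⟨x, σ x, hσ x, rfl, (leg_iff _ _).1 (Sum.inr_injective e)⟩
      · rw [μn h hx] at e
        exact absurd (show Sum.inl _ = Sum.inr _ from e) (by simp)
    · rintro ⟨x, y, hxy, rfl, rfl⟩
      rw [μa, hσ' x y hxy.symm]
      rfl
  · intro x y e
    exact l_inj ((leg_iff _ _).1 (Sum.inr_injective e))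
  · intro h h'
    change μ (Sum.inl h) = μ (Sum.inl h') ↔ _
    by_cases hx : ∃ x, a x = h
    · obtain ⟨x, rfl⟩ := hx
      rw [μa]
      constructor
      · intro e
        refine Or.inl ?_
        by_cases hx' : ∃ x, a x = h'
        · obtain ⟨x', rfl⟩ := hx'
          rw [μa] at e
          have e' := l_inj ((leg_iff _ _).1 (Sum.inr_injective e))
          by_contra H
          have hne : x ≠ x' := fun h => H (by rw [h])
          have h1 := hσ' x x' hne.symm
          exact hσ x' (by rw [← e', ← h1])
        · rw [μn h' hx'] at e
          exact absurd e (by simp)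
      · rintro (rfl | ⟨h1, -⟩)
        · rw [μa]
        · exact absurd rfl (h1 x)
    · rw [μn h hx]
      constructor
      · intro e
        refine Or.inr ⟨fun x hx' => hx ⟨x, hx'⟩, ?_⟩
        by_cases hx' : ∃ x, a x = h'
        · obtain ⟨x', rfl⟩ := hx'
          rw [μa] at e
          exact absurd e (by simp)
        · rw [μn h' hx'] at e
          exact Quotient.exact (Sum.inl_injective e)
      · rintro (rfl | ⟨-, h2⟩)
        · rw [μn h hx]
        · have hx' : ¬ ∃ x, a x = h' := by
            rw [← a_range] at hx ⊢
            rwa [← (Quotient.sound h2 : Quotient.mk Γ'.line h = Quotient.mk Γ'.line h')]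
          rw [μn h' hx']
          exact congrArg Sum.inl (Quotient.sound h2)

end FGraph

/-! ### Every proper 1PI subgraph with residue in `R` comes from a gluing -/

namespace FeynmanTheory

open FGraph

variable {T : FeynmanTheory} {Γ Γ' γ : FGraph T.FieldType}

theorem exists_glues {X : Type} (hΓ' : T.IsOnePI Γ') (p : Γ'.Place) {a : X → Γ'.H} {l : X → γ.H}
    (a_inj : Function.Injective a) (a_range : ∀ h, p.Has h ↔ ∃ x, a x = h)
    (l_inj : Function.Injective l) (l_range : ∀ b, γ.IsLeg b ↔ ∃ x, l x = b)
    (l_field : ∀ x, γ.field (l x) = Γ'.field (a x)) (hres : γ.res = p.type) :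
    ∃ (Γ : FGraph T.FieldType) (i : Γ'.H → Γ.H) (j : γ.H → Γ.H), Glues Γ Γ' γ p a l i j := by
  rcases p with v | e
  · refine exists_glues_vertex v a_inj a_range l_inj l_range l_field ?_
    rw [hres]
    have := T.three_le_card _ (hΓ'.vertices v)
    have h2 : Place.type (Sum.inl v : Γ'.Place) = Γ'.vertexType v := rfl
    rw [h2]
    omega
  · refine exists_glues_edge e.1 a_inj a_range l_inj l_range l_field ?_
    rw [hres]
    have := e.2
    simp only [internalEdges, Finset.mem_filter, Finset.mem_univ, true_and] at this
    exact this

/-- The place is the vertex formed by the legs of `γ`, and `m` reads its half-edges back as legs.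
The labelling `a` is quantified last because one place and one `m` must serve all labellings, in
particular those induced by isomorphisms with the quotient. -/
theorem exists_label_vertex {j : γ.H → Γ.H} (hΓ : T.IsOnePI Γ) (hγ : T.IsOnePI γ)
    (hj : Embeds γ Γ j) (hres : γ.res.card ≠ 2) :
    ∃ (p : (Γ.contract (edgeSet j : Set (Quotient Γ.line))).Place)
      (m : (Γ.contract (edgeSet j : Set (Quotient Γ.line))).H → γ.H),
      ∀ {X : Type} (a : X → (Γ.contract (edgeSet j : Set (Quotient Γ.line))).H),
        Function.Injective a → (∀ h, p.Has h ↔ ∃ x, a x = h) →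
        Glues Γ (Γ.contract (edgeSet j : Set (Quotient Γ.line))) γ p a (fun x => m (a x))
          Subtype.val j := by
  have hbiv : ∀ h, ¬ Γ.IsBivalent (edgeSet j : Set (Quotient Γ.line)) h := by
    intro h
    rw [hj.isBivalent_iff hγ.cutConnected hΓ.three_le_card_vertex]
    exact fun h => hres h.2
  obtain ⟨b₀, hb₀⟩ : ∃ b, γ.IsLeg b := by
    by_contra! H
    have := hγ.two_le_legs
    unfold FGraph.res at this
    rw [Finset.filter_false_of_mem (fun b _ => H b)] at this
    simp at this
  have hmem : ∀ b, γ.IsLeg b → Quotient.mk Γ.line (j b) ∉ edgeSet j := by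
    intro b hb H
    obtain ⟨b', e, hb'⟩ := (hj.mk_mem_edgeSet _).1 H
    exact hb' (hj.inj e ▸ hb)
  have hcomp := hj.comp_iff hγ.cutConnected
  have hline : ∀ h h', (Γ.line ⊔ Γ.through (edgeSet j : Set (Quotient Γ.line))) h h' ↔
      Γ.line h h' := by
    intro h h'
    have : Γ.line ⊔ Γ.through (edgeSet j : Set (Quotient Γ.line)) = Γ.line := by
      refine sup_eq_left.2 ?_
      rintro x y (rfl | ⟨-, h⟩)
      · exact Γ.line.refl' _
      · exact absurd h (hbiv _)
    rw [this]
  let v₀ : (Γ.contract (edgeSet j : Set (Quotient Γ.line))).H := ⟨j b₀, hmem b₀ hb₀, hbiv _⟩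
  have hhas : ∀ h : (Γ.contract (edgeSet j : Set (Quotient Γ.line))).H,
      Quotient.mk (Γ.contract (edgeSet j : Set (Quotient Γ.line))).vert h = Quotient.mk _ v₀ ↔
      ∃ b, j b = h.1 := by
    intro h
    rw [Quotient.eq]
    refine (hcomp h.1 (j b₀)).trans ?_
    constructor
    · rintro (h1 | ⟨h1, h2⟩)
      · exact h1.1
      · obtain ⟨b, hb, -⟩ := (hj.vert _ _).1 (Γ.vert.symm' h2)
        exact ⟨b, hb⟩
    · intro h1
      exact Or.inl ⟨h1, b₀, rfl⟩
  let m : (Γ.contract (edgeSet j : Set (Quotient Γ.line))).H → γ.H :=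
    fun h => if H : ∃ b, j b = h.1 then H.choose else b₀
  have hm : ∀ h, (∃ b, j b = h.1) → j (m h) = h.1 := by
    intro h H
    simp only [m, dif_pos H]
    exact H.choose_spec
  refine ⟨Sum.inl (Quotient.mk _ v₀), m, ?_⟩
  intro X a a_inj a_range
  have ha : ∀ x, j (m (a x)) = (a x).1 := fun x => hm _ ((hhas _).1 ((a_range _).2 ⟨x, rfl⟩))
  refine GluesVertex.mk ⟨hj, a_inj, a_range, ?_, ?_, ?_, Subtype.val_injective, fun _ => rfl, ?_,
    ?_⟩ hres ?_ ?_ ?_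
  · intro x y e
    have e : m (a x) = m (a y) := e
    exact a_inj (Subtype.ext (by rw [← ha, ← ha, e]))
  · intro b
    constructor
    · intro hb
      let h : (Γ.contract (edgeSet j : Set (Quotient Γ.line))).H := ⟨j b, hmem b hb, hbiv _⟩
      obtain ⟨x, hx⟩ := (a_range h).1 ((hhas h).2 ⟨b, rfl⟩)
      refine ⟨x, hj.inj ?_⟩
      rw [ha, hx]
    · rintro ⟨x, rfl⟩
      by_contra hb
      exact (a x).2.1 (by rw [← ha]; exact (hj.mk_mem_edgeSet _).2 ⟨_, rfl, hb⟩)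
  · intro x
    rw [← hj.field, ha]
    rfl
  · intro h
    by_cases H : ∃ b, j b = h
    · exact Or.inl H
    · refine Or.inr ⟨⟨h, fun h1 => H ?_, hbiv _⟩, rfl⟩
      obtain ⟨b, hb, -⟩ := (hj.mk_mem_edgeSet _).1 h1
      exact ⟨b, hb⟩
  · intro h h' hh hh'
    symm
    refine (hcomp h.1 h'.1).trans ?_
    constructor
    · rintro (⟨⟨b, hb⟩, -⟩ | ⟨-, h2⟩)
      · exact absurd hb (hh b)
      · exact h2
    · exact fun h2 => Or.inr ⟨fun ⟨b, hb⟩ => hh b hb, h2⟩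
  · intro x
    exact (ha x).symm
  · intro h b e
    exact (a_range h).1 ((hhas h).2 ⟨b, e.symm⟩)
  · intro h h'
    exact (hline h.1 h'.1).symm

/-- A half-edge of type `f` can only be joined to one of type `conj f`; `conj_conj` covers the pair
written in the other order. -/
theorem eq_of_pair_mem_edges {f g g' : T.FieldType} (h : ({f, g} : Multiset T.FieldType) ∈ T.edges)
    (h' : ({f, g'} : Multiset T.FieldType) ∈ T.edges) : g = g' := by
  have key : ∀ g, ({f, g} : Multiset T.FieldType) ∈ T.edges → g = T.conj f := by
    intro g h
    simp only [edges, Finset.mem_image, Finset.mem_univ, true_and] at h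
    obtain ⟨e, he⟩ := h
    simp only [Multiset.insert_eq_cons, Multiset.cons_eq_cons, Multiset.singleton_inj] at he
    rcases he with ⟨rfl, h5⟩ | ⟨-, cs, h1, h2⟩
    · exact h5.symm
    · rw [Multiset.singleton_eq_cons_iff] at h1 h2
      rw [h2.1, ← h1.1, T.conj_conj]
  rw [key g h, key g' h']

/-- A leg of a proper subgraph with two legs is joined to a half-edge outside the subgraph. -/
theorem exists_outer_neighbour {j : γ.H → Γ.H} (hΓ : T.IsOnePI Γ)
    (hj : Embeds γ Γ j) (hne : edgeSet j ≠ Γ.internalEdges) {b₁ b₂ : γ.H}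
    (hlegs : ∀ b, γ.IsLeg b ↔ b = b₁ ∨ b = b₂) :
    ∃ n, (¬ ∃ b, j b = n) ∧ Γ.line (j b₁) n := by
  by_contra! H
  have hv : ∀ x y, Γ.vert x y → (∃ b, j b = x) → ∃ b, j b = y := by
    rintro x y hxy ⟨b, rfl⟩
    obtain ⟨b', hb', -⟩ := (hj.vert _ _).1 hxy
    exact ⟨b', hb'⟩
  have hl : ∀ x y, Γ.line x y → ¬ Γ.line (j b₂) x → (∃ b, j b = x) → ∃ b, j b = y := by
    rintro x y hxy hn ⟨b, rfl⟩
    by_cases hb : γ.IsLeg b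
    · rcases (hlegs b).1 hb with rfl | rfl
      · by_contra hy
        exact H y (fun b hb => hy ⟨b, hb⟩) hxy
      · exact absurd (Γ.line.refl' _) hn
    · obtain ⟨b', hb', -⟩ := (hj.line b hb y).1 hxy
      exact ⟨b', hb'⟩
  -- Without an outer neighbour of `b₁`, the half-edges of `γ` can be left only through the line at
  -- `b₂`. This line is not a bridge, so `γ` has all half-edges of `Γ`. If `b₂` is a leg of `Γ`,
  -- connectedness suffices.
  have hall : ∀ y, ∃ b, j b = y := by
    intro y
    by_cases hb₂ : Γ.IsLeg (j b₂)
    · refine hΓ.cutConnected (fun x => ∃ b, j b = x) hv ?_ (j b₁) y ⟨b₁, rfl⟩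
      intro x y hxy hx
      by_cases h : Γ.line (j b₂) x
      · have e := hb₂ x h
        have e' := hb₂ y (Γ.line.trans' h hxy)
        rwa [e', ← e]
      · exact hl x y hxy h hx
    · exact hΓ.cutBridgeless (j b₂) hb₂ (fun x => ∃ b, j b = x) hv hl (j b₁) y ⟨b₁, rfl⟩
  have hleg : ∀ y, Γ.IsLeg y → y = j b₁ ∨ y = j b₂ := by
    intro y hy
    obtain ⟨b, rfl⟩ := hall y
    by_cases hb : γ.IsLeg b
    · rcases (hlegs b).1 hb with rfl | rfl
      · exact Or.inl rfl
      · exact Or.inr rfl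
    · exact absurd hy (hj.not_isLeg hb)
  have h2 := hΓ.two_le_legs
  unfold FGraph.res at h2
  rw [Multiset.card_map, Finset.card_val] at h2
  -- As `Γ` has at least two legs, both `b₁` and `b₂` remain legs of `Γ`, and all inner lines of `Γ`
  -- then belong to `γ`, contrary to properness.
  have hsub : Finset.univ.filter Γ.IsLeg = {j b₁, j b₂} := by
    apply Finset.eq_of_subset_of_card_le
    · intro y hy
      simpa using hleg y (by simpa using hy)
    · exact Finset.card_le_two.trans h2
  have hl1 : ∀ b, γ.IsLeg b → Γ.IsLeg (j b) := by
    intro b hb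
    have : j b ∈ Finset.univ.filter Γ.IsLeg := by
      rw [hsub]
      rcases (hlegs b).1 hb with rfl | rfl <;> simp
    simpa using this
  refine hne (Finset.ext fun q => ?_)
  obtain ⟨y, rfl⟩ := Quotient.exists_rep q
  obtain ⟨b, rfl⟩ := hall y
  rw [hΓ.innerPairs.mem_internalEdges]
  refine (hj.mk_mem_edgeSet _).trans ?_
  constructor
  · rintro ⟨b', e, hb'⟩
    rw [← e]
    exact hj.not_isLeg hb'
  · exact fun h => ⟨b, rfl, fun hb => h (hl1 b hb)⟩

/-- The legs `b₁` and `b₂` have neighbours `n₁` and `n₂` outside `γ`. Contraction removes all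
half-edges of `γ` and leaves a line joining `n₁` and `n₂`, which is the place of the insertion. -/
theorem exists_label_edge {j : γ.H → Γ.H} (hΓ : T.IsOnePI Γ) (hγ : T.IsOnePI γ)
    (hj : Embeds γ Γ j) (hne : edgeSet j ≠ Γ.internalEdges) (hres : γ.res ∈ T.edges) :
    ∃ (p : (Γ.contract (edgeSet j : Set (Quotient Γ.line))).Place)
      (m : (Γ.contract (edgeSet j : Set (Quotient Γ.line))).H → γ.H),
      ∀ {X : Type} (a : X → (Γ.contract (edgeSet j : Set (Quotient Γ.line))).H),
        Function.Injective a → (∀ h, p.Has h ↔ ∃ x, a x = h) →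
        Glues Γ (Γ.contract (edgeSet j : Set (Quotient Γ.line))) γ p a (fun x => m (a x))
          Subtype.val j := by
  have hres2 := card_of_mem_edges hres
  have hbiv := hj.isBivalent_iff hγ.cutConnected hΓ.three_le_card_vertex
  have hcomp := hj.comp_iff hγ.cutConnected
  obtain ⟨b₁, b₂, hb12, hlegs, hresb⟩ : ∃ b₁ b₂, b₁ ≠ b₂ ∧
      (∀ b, γ.IsLeg b ↔ b = b₁ ∨ b = b₂) ∧ γ.res = {γ.field b₁, γ.field b₂} := by
    have h2 := hres2
    unfold FGraph.res at h2
    rw [Multiset.card_map, Finset.card_val, Finset.card_eq_two] at h2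
    obtain ⟨b, b', hne, hs⟩ := h2
    refine ⟨b, b', hne, ?_, ?_⟩
    · intro c
      have : c ∈ Finset.univ.filter γ.IsLeg ↔ c ∈ ({b, b'} : Finset γ.H) := by rw [hs]
      simpa using this
    · unfold FGraph.res
      rw [hs, Finset.insert_val_of_notMem (by simpa using hne)]
      simp
  obtain ⟨n₁, hn₁, hl₁⟩ := exists_outer_neighbour hΓ hj hne hlegs
  obtain ⟨n₂, hn₂, hl₂⟩ := exists_outer_neighbour hΓ hj hne
    (fun b => (hlegs b).trans or_comm)
  have hpart : ∀ b n, (¬ ∃ b, j b = n) → Γ.line (j b) n → (∀ y, Γ.line (j b) y → y = j b ∨ y = n) ∧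
      Γ.lineType (Quotient.mk _ (j b)) = {γ.field b, Γ.field n} := by
    intro b n hn hl
    obtain ⟨n', -, -, h3, h4⟩ := hΓ.innerPairs.exists_partner
      (InnerPairs.not_isLeg hl fun e => hn ⟨b, e.symm⟩)
    obtain rfl := (h3 n hl).resolve_left fun e => hn ⟨b, e.symm⟩
    rw [← hj.field]
    exact ⟨h3, h4⟩
  obtain ⟨hp₁, ht₁⟩ := hpart b₁ n₁ hn₁ hl₁
  obtain ⟨hp₂, ht₂⟩ := hpart b₂ n₂ hn₂ hl₂
  have hn12 : n₁ ≠ n₂ := by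
    rintro rfl
    rcases hp₁ _ (Γ.line.trans' hl₁ (Γ.line.symm' hl₂)) with h | h
    · exact hb12 (hj.inj h).symm
    · exact hn₁ ⟨_, h⟩
  have hE : ∀ b n, (¬ ∃ b, j b = n) → Γ.line (j b) n →
      Γ.lineType (Quotient.mk _ (j b)) ∈ T.edges := by
    intro b n hn hl
    refine hΓ.innerTypes_mem _ (mem_blockTypes.2 ⟨j b, ?_, rfl⟩)
    exact InnerPairs.not_isLeg hl fun e => hn ⟨b, e.symm⟩
  have hf₁ : Γ.field n₁ = γ.field b₂ := by
    have h1 := hE b₁ n₁ hn₁ hl₁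
    rw [ht₁] at h1
    rw [hresb] at hres
    exact eq_of_pair_mem_edges h1 hres
  have hf₂ : Γ.field n₂ = γ.field b₁ := by
    have h1 := hE b₂ n₂ hn₂ hl₂
    rw [ht₂] at h1
    rw [hresb, Multiset.pair_comm] at hres
    exact eq_of_pair_mem_edges h1 hres
  have hout : ∀ h : (Γ.contract (edgeSet j : Set (Quotient Γ.line))).H, ¬ ∃ b, j b = h.1 :=
    fun h H => h.2.2 ((hbiv _).2 ⟨H, hres2⟩)
  have hin : ∀ h, (¬ ∃ b, j b = h) → Quotient.mk Γ.line h ∉ (edgeSet j : Set (Quotient Γ.line)) ∧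
      ¬ Γ.IsBivalent (edgeSet j : Set (Quotient Γ.line)) h := by
    intro h H
    refine ⟨fun h1 => H ?_, fun h1 => H ((hbiv _).1 h1).1⟩
    obtain ⟨b, hb, -⟩ := (hj.mk_mem_edgeSet _).1 h1
    exact ⟨b, hb⟩
  -- the lines of the contracted graph
  have hline : ∀ h h', (¬ ∃ b, j b = h) → (¬ ∃ b, j b = h') →
      ((Γ.line ⊔ Γ.through (edgeSet j : Set (Quotient Γ.line))) h h' ↔
        ((h = n₁ ∨ h = n₂) ∧ (h' = n₁ ∨ h' = n₂)) ∨ (¬ (h = n₁ ∨ h = n₂) ∧ Γ.line h h')) := by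
    intro h h' hh hh'
    constructor
    -- The class of the join that runs through `γ` consists of `γ`, `n₁` and `n₂`. The map `κ`
    -- collapses it to `none` and keeps all other lines apart, which bounds the join from above.
    · let C : Γ.H → Prop := fun x => (∃ b, j b = x) ∨ x = n₁ ∨ x = n₂
      have hC : ∀ x y, Γ.line x y → C x → C y := by
        rintro x y hxy (⟨b, rfl⟩ | rfl | rfl)
        · by_cases hb : γ.IsLeg b
          · rcases (hlegs b).1 hb with rfl | rfl
            · rcases hp₁ y hxy with rfl | rfl
              · exact Or.inl ⟨_, rfl⟩
              · exact Or.inr (Or.inl rfl)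
            · rcases hp₂ y hxy with rfl | rfl
              · exact Or.inl ⟨_, rfl⟩
              · exact Or.inr (Or.inr rfl)
          · obtain ⟨b', hb', -⟩ := (hj.line b hb y).1 hxy
            exact Or.inl ⟨b', hb'⟩
        · rcases hp₁ y (Γ.line.trans' hl₁ hxy) with rfl | rfl
          · exact Or.inl ⟨_, rfl⟩
          · exact Or.inr (Or.inl rfl)
        · rcases hp₂ y (Γ.line.trans' hl₂ hxy) with rfl | rfl
          · exact Or.inl ⟨_, rfl⟩
          · exact Or.inr (Or.inr rfl)
      let κ : Γ.H → Option (Quotient Γ.line) := fun x => if C x then none else some (Quotient.mk _ x)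
      have hle : Γ.line ⊔ Γ.through (edgeSet j : Set (Quotient Γ.line)) ≤ Setoid.ker κ := by
        refine sup_le ?_ ?_
        · intro x y hxy
          change κ x = κ y
          by_cases hx : C x
          · simp only [κ, if_pos hx, if_pos (hC x y hxy hx)]
          · have hy : ¬ C y := fun hy => hx (hC y x (Γ.line.symm' hxy) hy)
            simp only [κ, if_neg hx, if_neg hy]
            exact congrArg some (Quotient.sound hxy)
        · rintro x y (rfl | ⟨h1, h2⟩)
          · rfl
          · have hx := ((hbiv _).1 h2).1
            have hy : ∃ b, j b = y := by
              rcases (hcomp x y).1 h1 with h3 | h3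
              · exact h3.2
              · exact absurd hx h3.1
            change κ x = κ y
            simp only [κ]
            rw [if_pos (Or.inl hx), if_pos (Or.inl hy)]
      intro H
      have e : κ h = κ h' := hle H
      by_cases hc : C h <;> by_cases hc' : C h'
      · exact Or.inl ⟨hc.resolve_left hh, hc'.resolve_left hh'⟩
      · simp only [κ, if_pos hc, if_neg hc'] at e
        exact absurd e (by simp)
      · simp only [κ, if_neg hc, if_pos hc'] at e
        exact absurd e (by simp)
      · simp only [κ, if_neg hc, if_neg hc'] at e
        exact Or.inr ⟨fun H => hc (Or.inr H), Quotient.exact (Option.some_injective _ e)⟩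
    · have key : (Γ.line ⊔ Γ.through (edgeSet j : Set (Quotient Γ.line))) n₁ n₂ := by
        have h1 : Γ.through (edgeSet j : Set (Quotient Γ.line)) (j b₁) (j b₂) :=
          Or.inr ⟨(hcomp _ _).2 (Or.inl ⟨⟨_, rfl⟩, _, rfl⟩), (hbiv _).2 ⟨⟨_, rfl⟩, hres2⟩⟩
        refine Setoid.trans' _ ((le_sup_left : Γ.line ≤ _) (Γ.line.symm' hl₁))
          (Setoid.trans' _ ((le_sup_right : Γ.through _ ≤ _) h1)
          ((le_sup_left : Γ.line ≤ _) hl₂))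
      rintro (⟨rfl | rfl, rfl | rfl⟩ | ⟨-, h2⟩)
      · exact Setoid.refl' _ _
      · exact key
      · exact Setoid.symm' _ key
      · exact Setoid.refl' _ _
      · exact (le_sup_left : Γ.line ≤ _) h2
  let N₁ : (Γ.contract (edgeSet j : Set (Quotient Γ.line))).H := ⟨n₁, hin n₁ hn₁⟩
  let N₂ : (Γ.contract (edgeSet j : Set (Quotient Γ.line))).H := ⟨n₂, hin n₂ hn₂⟩
  have hN12 : N₁ ≠ N₂ := fun e => hn12 (congrArg Subtype.val e)
  have hNline : ∀ h, (Γ.contract (edgeSet j : Set (Quotient Γ.line))).line N₁ h ↔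
      h = N₁ ∨ h = N₂ := by
    intro h
    refine (hline n₁ h.1 hn₁ (hout h)).trans ?_
    constructor
    · rintro (⟨-, h2 | h2⟩ | ⟨h1, -⟩)
      · exact Or.inl (Subtype.ext h2)
      · exact Or.inr (Subtype.ext h2)
      · exact absurd (Or.inl rfl) h1
    · rintro (rfl | rfl)
      · exact Or.inl ⟨Or.inl rfl, Or.inl rfl⟩
      · exact Or.inl ⟨Or.inl rfl, Or.inr rfl⟩
  have hmem : Quotient.mk _ N₁ ∈
      (Γ.contract (edgeSet j : Set (Quotient Γ.line))).internalEdges := by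
    rw [mk_mem_internalEdges_iff]
    have : Finset.univ.filter (fun x =>
        (Γ.contract (edgeSet j : Set (Quotient Γ.line))).line N₁ x) = {N₁, N₂} := by
      ext x
      simp [hNline]
    rw [this, Finset.card_pair hN12]
  have hhas : ∀ h : (Γ.contract (edgeSet j : Set (Quotient Γ.line))).H,
      Quotient.mk (Γ.contract (edgeSet j : Set (Quotient Γ.line))).line h = Quotient.mk _ N₁ ↔
      h = N₁ ∨ h = N₂ := by
    intro h
    rw [← hNline]
    exact ⟨fun e => Setoid.symm' _ (Quotient.exact e), fun e => Quotient.sound (Setoid.symm' _ e)⟩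
  -- The assignment is crossed: `n₁` is the neighbour of `b₁`, but it has the field type of `b₂`,
  -- since both types are conjugate to that of `b₁`.
  let m : (Γ.contract (edgeSet j : Set (Quotient Γ.line))).H → γ.H :=
    fun h => if h = N₁ then b₂ else b₁
  have hm₁ : m N₁ = b₂ := if_pos rfl
  have hm₂ : m N₂ = b₁ := if_neg hN12.symm
  refine ⟨Sum.inr ⟨Quotient.mk _ N₁, hmem⟩, m, ?_⟩
  intro X a a_inj a_range
  have ha : ∀ x, a x = N₁ ∨ a x = N₂ := fun x => (hhas _).1 ((a_range _).2 ⟨x, rfl⟩)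
  obtain ⟨x₁, hx₁⟩ := (a_range N₁).1 ((hhas _).2 (Or.inl rfl))
  obtain ⟨x₂, hx₂⟩ := (a_range N₂).1 ((hhas _).2 (Or.inr rfl))
  have hX : ∀ x, x = x₁ ∨ x = x₂ := by
    intro x
    rcases ha x with h | h
    · exact Or.inl (a_inj (h.trans hx₁.symm))
    · exact Or.inr (a_inj (h.trans hx₂.symm))
  have hx12 : x₁ ≠ x₂ := by
    rintro rfl
    exact hN12 (hx₁.symm.trans hx₂)
  have hma₁ : m (a x₁) = b₂ := by rw [hx₁, hm₁]
  have hma₂ : m (a x₂) = b₁ := by rw [hx₂, hm₂]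
  refine GluesEdge.mk ⟨hj, a_inj, a_range, ?_, ?_, ?_, Subtype.val_injective, fun _ => rfl, ?_,
    ?_⟩ hres2 ?_ ?_ ?_ ?_
  · intro x y e
    have e : m (a x) = m (a y) := e
    rcases hX x with rfl | rfl <;> rcases hX y with rfl | rfl
    · rfl
    · rw [hma₁, hma₂] at e
      exact absurd e.symm hb12
    · rw [hma₁, hma₂] at e
      exact absurd e hb12
    · rfl
  · intro b
    rw [hlegs]
    constructor
    · rintro (rfl | rfl)
      · exact ⟨x₂, hma₂⟩
      · exact ⟨x₁, hma₁⟩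
    · rintro ⟨x, rfl⟩
      rcases hX x with rfl | rfl
      · exact Or.inr hma₁
      · exact Or.inl hma₂
  · intro x
    rcases hX x with rfl | rfl
    · rw [hma₁, hx₁]
      exact hf₁.symm
    · rw [hma₂, hx₂]
      exact hf₂.symm
  · intro h
    by_cases H : ∃ b, j b = h
    · exact Or.inl H
    · exact Or.inr ⟨⟨h, hin h H⟩, rfl⟩
  · intro h h' hh hh'
    symm
    refine (hcomp h.1 h'.1).trans ?_
    constructor
    · rintro (⟨⟨b, hb⟩, -⟩ | ⟨-, h2⟩)
      · exact absurd hb (hh b)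
      · exact h2
    · exact fun h2 => Or.inr ⟨fun ⟨b, hb⟩ => hh b hb, h2⟩
  · intro h b e
    exact hout h ⟨b, e.symm⟩
  · intro h b
    constructor
    · intro H
      have hb : γ.IsLeg b := by
        by_contra hb
        obtain ⟨b', e, -⟩ := (hj.line b hb _).1 (Γ.line.symm' H)
        exact hout h ⟨b', e⟩
      rcases (hlegs b).1 hb with rfl | rfl
      · rcases hp₁ _ (Γ.line.symm' H) with e | e
        · exact absurd ⟨_, e.symm⟩ (hout h)
        · exact ⟨x₁, x₂, hx12, hx₁.trans (Subtype.ext e.symm), hma₂⟩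
      · rcases hp₂ _ (Γ.line.symm' H) with e | e
        · exact absurd ⟨_, e.symm⟩ (hout h)
        · exact ⟨x₂, x₁, hx12.symm, hx₂.trans (Subtype.ext e.symm), hma₁⟩
    · rintro ⟨x, y, hxy, rfl, rfl⟩
      rcases hX x with rfl | rfl <;> rcases hX y with rfl | rfl
      · exact absurd rfl hxy
      · rw [hma₂, hx₁]
        exact Γ.line.symm' hl₁
      · rw [hma₁, hx₂]
        exact Γ.line.symm' hl₂
      · exact absurd rfl hxy
  · have key : ¬ Γ.line (j b₁) (j b₂) := by
      intro H
      rcases hp₁ _ H with e | e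
      · exact hb12 (hj.inj e).symm
      · exact hn₁ ⟨_, e⟩
    intro x y e
    rcases hX x with rfl | rfl <;> rcases hX y with rfl | rfl
    · rfl
    · rw [hma₁, hma₂] at e
      exact absurd (Γ.line.symm' e) key
    · rw [hma₁, hma₂] at e
      exact absurd e key
    · rfl
  · intro h h'
    have hna : (∀ x, a x ≠ h) ↔ ¬ (h.1 = n₁ ∨ h.1 = n₂) := by
      constructor
      · rintro H (e | e)
        · exact H x₁ (hx₁.trans (Subtype.ext e.symm))
        · exact H x₂ (hx₂.trans (Subtype.ext e.symm))
      · rintro H x rfl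
        rcases ha x with e | e
        · exact H (Or.inl (congrArg Subtype.val e))
        · exact H (Or.inr (congrArg Subtype.val e))
    have hcl : (Γ.contract (edgeSet j : Set (Quotient Γ.line))).line h h' ↔ _ :=
      hline h.1 h'.1 (hout h) (hout h')
    rw [hna, hcl]
    constructor
    · intro H
      by_cases hh : h.1 = n₁ ∨ h.1 = n₂
      · refine Or.inl (Subtype.ext ?_)
        rcases hh with e | e
        · have := hp₁ h'.1 (Γ.line.trans' hl₁ (e ▸ H))
          rw [e]
          exact (this.resolve_left fun e => hout h' ⟨_, e.symm⟩).symm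
        · have := hp₂ h'.1 (Γ.line.trans' hl₂ (e ▸ H))
          rw [e]
          exact (this.resolve_left fun e => hout h' ⟨_, e.symm⟩).symm
      · exact Or.inr ⟨hh, Or.inr ⟨hh, H⟩⟩
    · rintro (rfl | ⟨hh, ⟨h1, -⟩ | ⟨-, h2⟩⟩)
      · exact Γ.line.refl' _
      · exact absurd h1 hh
      · exact h2

/-- A 1PI graph arises by gluing a proper 1PI subgraph into the contracted graph. -/
theorem exists_label {j : γ.H → Γ.H} (hΓ : T.IsOnePI Γ) (hγ : T.IsOnePI γ) (hres : γ.res ∈ T.R)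
    (hj : Embeds γ Γ j) (hne : edgeSet j ≠ Γ.internalEdges) :
    ∃ (p : (Γ.contract (edgeSet j : Set (Quotient Γ.line))).Place)
      (m : (Γ.contract (edgeSet j : Set (Quotient Γ.line))).H → γ.H),
      ∀ {X : Type} (a : X → (Γ.contract (edgeSet j : Set (Quotient Γ.line))).H),
        Function.Injective a → (∀ h, p.Has h ↔ ∃ x, a x = h) →
        Glues Γ (Γ.contract (edgeSet j : Set (Quotient Γ.line))) γ p a (fun x => m (a x))
          Subtype.val j := by
  rcases Finset.mem_union.1 hres with h | h
  · refine exists_label_vertex hΓ hγ hj ?_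
    have := T.three_le_card _ h
    omega
  · exact exists_label_edge hΓ hγ hj hne h

end FeynmanTheory

/-! ### Labelling places by their types -/

namespace FGraph

variable {F : Type}

theorem exists_label_map {α : Type} (s : Finset α) (f : α → F) (τ : Multiset F)
    (h : τ = s.val.map f) : ∃ a : τ.ToType → α, Function.Injective a ∧
      (∀ y, y ∈ s ↔ ∃ x, a x = y) ∧ ∀ x, f (a x) = x.1 := by
  subst h
  let e := Multiset.mapEquiv s.val f
  refine ⟨fun x => (e.symm x).1, ?_, ?_, ?_⟩
  · intro x y hxy
    refine e.symm.injective ?_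
    -- A finset has no multiplicities, so the copy index of an element of `ToType` vanishes and the
    -- element is determined by its value.
    have hc : ∀ z : s.val.ToType, z.2.1 = 0 := by
      intro z
      have h1 := z.2.2
      have h2 := Multiset.nodup_iff_count_le_one.1 s.nodup z.1
      omega
    have key : ∀ u v : s.val.ToType, u.1 = v.1 → u = v := by
      rintro ⟨u, m, hm⟩ ⟨v, n, hn⟩ (rfl : u = v)
      obtain rfl : m = 0 := hc ⟨u, m, hm⟩
      obtain rfl : n = 0 := hc ⟨u, n, hn⟩
      rfl
    exact key _ _ hxy
  · intro y
    constructor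
    · intro hy
      have : 0 < s.val.count y := Multiset.count_pos.2 hy
      exact ⟨e ⟨y, ⟨0, this⟩⟩, congrArg Sigma.fst (e.symm_apply_apply _)⟩
    · rintro ⟨x, rfl⟩
      exact Multiset.coe_mem
  · intro x
    have := Multiset.mapEquiv_apply s.val f (e.symm x)
    rw [← this]
    change ((e (e.symm x) : (s.val.map f).ToType) : F) = x.1
    rw [Equiv.apply_symm_apply]

theorem Place.exists_label {Γ : FGraph F} (p : Γ.Place) : ∃ a : p.type.ToType → Γ.H,
    Function.Injective a ∧ (∀ h, p.Has h ↔ ∃ x, a x = h) ∧ ∀ x, Γ.field (a x) = x.1 := by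
  obtain ⟨a, h1, h2, h3⟩ := exists_label_map (Finset.univ.filter p.Has) Γ.field p.type p.type_eq
  exact ⟨a, h1, fun h => by rw [← h2]; simp, h3⟩

/-- A chosen labelling of the half-edges of a place by its type. -/
noncomputable def Place.label {Γ : FGraph F} (p : Γ.Place) : p.type.ToType → Γ.H :=
  p.exists_label.choose

theorem Place.label_injective {Γ : FGraph F} (p : Γ.Place) : Function.Injective p.label :=
  p.exists_label.choose_spec.1

theorem Place.has_iff_label {Γ : FGraph F} (p : Γ.Place) (h : Γ.H) :
    p.Has h ↔ ∃ x, p.label x = h :=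
  p.exists_label.choose_spec.2.1 h

theorem Place.field_label {Γ : FGraph F} (p : Γ.Place) (x : p.type.ToType) :
    Γ.field (p.label x) = x.1 :=
  p.exists_label.choose_spec.2.2 x

theorem Place.map_refl {Γ : FGraph F} (p : Γ.Place) : p.map (Iso.refl Γ) = p := by
  rcases p with v | ⟨e, he⟩
  · obtain ⟨x, rfl⟩ := Quotient.exists_rep v
    rfl
  · obtain ⟨x, rfl⟩ := Quotient.exists_rep e
    rfl

instance (Γ Γ' : FGraph F) : Finite (Iso Γ Γ') := by
  unfold Iso
  infer_instance

/-- The half-edges of a connected subgraph form the component of any of its inner half-edges, and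
that component depends only on the edge set. -/
theorem Embeds.range_iff {γ γ' Γ : FGraph F} {j : γ.H → Γ.H} {j' : γ'.H → Γ.H}
    (hj : Embeds γ Γ j) (hj' : Embeds γ' Γ j') (hc : γ.CutConnected) (hc' : γ'.CutConnected)
    (he : edgeSet j = edgeSet j') {b₀ : γ.H} (hb₀ : ¬ γ.IsLeg b₀) (h : Γ.H) :
    (∃ b, j b = h) ↔ ∃ b, j' b = h := by
  obtain ⟨c₀, hc₀, -⟩ := (hj'.mk_mem_edgeSet (j b₀)).1 (by
    rw [← he]
    exact (hj.mk_mem_edgeSet _).2 ⟨b₀, rfl, hb₀⟩)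
  have h1 := hj.comp_iff hc (j b₀) h
  have h2 := hj'.comp_iff hc' (j b₀) h
  rw [he, h2] at h1
  have e1 : ∃ b, j b = j b₀ := ⟨b₀, rfl⟩
  have e2 : ∃ b, j' b = j b₀ := ⟨c₀, hc₀⟩
  simpa [e1, e2] using h1.symm

theorem edgeSet_comp_iso {γ γ' Γ : FGraph F} (j : γ.H → Γ.H) (ψ : Iso γ γ') :
    edgeSet (γ := γ') (fun b => j (ψ.1.symm b)) = edgeSet j := by
  unfold edgeSet
  ext q
  simp only [Finset.mem_filter, Finset.mem_univ, true_and]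
  constructor
  · rintro ⟨b, hb, hq⟩
    obtain ⟨b, rfl⟩ := ψ.1.surjective b
    exact ⟨b, fun h => hb ((ψ.isLeg_iff _).2 h), by simpa using hq⟩
  · rintro ⟨b, hb, hq⟩
    exact ⟨ψ.1 b, fun h => hb ((ψ.isLeg_iff _).1 h), by simpa using hq⟩

end FGraph

/-! ### Counting isomorphisms with labelled legs -/

namespace FeynmanTheory

open FGraph

variable {T : FeynmanTheory} {r : Multiset T.FieldType}

/-- Isomorphisms that respect the labelled legs. -/
def LegIso (C C' : T.Contribution r) : Type :=
  {φ : FGraph.Iso C.graph C'.graph // ∀ x, φ.1 (C.leg x) = C'.leg x}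

instance (C C' : T.Contribution r) : Finite (LegIso C C') := by
  unfold LegIso
  infer_instance

theorem sym_eq_card (C : T.Contribution r) : C.sym = Nat.card (LegIso C C) := rfl

/-- The identity. -/
def LegIso.refl (C : T.Contribution r) : LegIso C C := ⟨Iso.refl _, fun _ => rfl⟩

/-- The composition. -/
def LegIso.trans {C C' C'' : T.Contribution r} (φ : LegIso C C') (ψ : LegIso C' C'') :
    LegIso C C'' :=
  ⟨φ.1.trans ψ.1, fun x => by rw [← ψ.2 x, ← φ.2 x]; rfl⟩

/-- The inverse. -/
def LegIso.symm {C C' : T.Contribution r} (φ : LegIso C C') : LegIso C' C :=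
  ⟨φ.1.symm, fun x => by rw [← φ.2 x]; exact φ.1.1.symm_apply_apply _⟩

theorem mk_eq_mk_iff {C C' : T.Contribution r} :
    Quotient.mk (T.contributionSetoid r) C = Quotient.mk _ C' ↔ Nonempty (LegIso C C') := by
  rw [Quotient.eq]
  exact ⟨fun ⟨φ, h⟩ => ⟨⟨φ, h⟩⟩, fun ⟨φ⟩ => ⟨φ.1, φ.2⟩⟩

/-- Composition with `θ⁻¹` identifies the isomorphisms with the automorphisms of `C`. -/
theorem card_legIso_left {C C' : T.Contribution r} (θ : LegIso C C') :
    Nat.card (LegIso C C') = C.sym := by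
  rw [sym_eq_card]
  refine Nat.card_congr ⟨fun φ => φ.trans θ.symm, fun φ => φ.trans θ, ?_, ?_⟩
  · intro φ
    refine Subtype.ext (Subtype.ext (Equiv.ext fun x => ?_))
    exact θ.1.1.apply_symm_apply _
  · intro φ
    refine Subtype.ext (Subtype.ext (Equiv.ext fun x => ?_))
    exact θ.1.1.symm_apply_apply _

theorem card_legIso_right {C C' : T.Contribution r} (θ : LegIso C C') :
    Nat.card (LegIso C C') = C'.sym := by
  rw [sym_eq_card]
  refine Nat.card_congr ⟨fun φ => θ.symm.trans φ, fun φ => θ.trans φ, ?_, ?_⟩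
  · intro φ
    refine Subtype.ext (Subtype.ext (Equiv.ext fun x => ?_))
    exact congrArg φ.1.1 (θ.1.1.symm_apply_apply x)
  · intro φ
    refine Subtype.ext (Subtype.ext (Equiv.ext fun x => ?_))
    exact congrArg φ.1.1 (θ.1.1.apply_symm_apply x)

theorem sym_eq_of_legIso {C C' : T.Contribution r} (θ : LegIso C C') : C.sym = C'.sym := by
  rw [← card_legIso_left θ, card_legIso_right θ]

theorem sym_pos (C : T.Contribution r) : 0 < C.sym := by
  rw [sym_eq_card]
  have : Nonempty (LegIso C C) := ⟨LegIso.refl C⟩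
  exact Nat.card_pos

/-- The coproduct of a generator is defined through the chosen graph of its unlabelled class. Moving
the leg labels to that very graph makes it unnecessary to show that `graphCoproduct` is invariant
under isomorphisms. -/
theorem exists_rep (x : T.M r) : ∃ C : T.Contribution r,
    Quotient.mk (T.contributionSetoid r) C = x ∧
    C.graph = (Quotient.mk T.onePISetoid ⟨x.out.graph, x.out.onePI⟩).out.1 := by
  obtain ⟨φ⟩ : Nonempty (FGraph.Iso x.out.graph
      (Quotient.mk T.onePISetoid ⟨x.out.graph, x.out.onePI⟩).out.1) :=
    T.onePISetoid.symm' (Quotient.mk_out (s := T.onePISetoid) ⟨x.out.graph, x.out.onePI⟩)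
  let C : T.Contribution r :=
    { graph := (Quotient.mk T.onePISetoid ⟨x.out.graph, x.out.onePI⟩).out.1
      onePI := (Quotient.mk T.onePISetoid ⟨x.out.graph, x.out.onePI⟩).out.2
      leg := fun z => φ.1 (x.out.leg z)
      leg_injective := φ.1.injective.comp x.out.leg_injective
      range_leg := by
        intro h
        obtain ⟨h, rfl⟩ := φ.1.surjective h
        rw [φ.isLeg_iff, x.out.range_leg]
        simp
      field_leg := fun z => by rw [φ.2.1, x.out.field_leg] }
  refine ⟨C, ?_, rfl⟩
  exact (mk_eq_mk_iff.2 ⟨LegIso.symm ⟨φ, fun _ => rfl⟩⟩).trans (Quotient.out_eq x)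

/-- A representative whose graph is the representative used for the coproduct. -/
noncomputable def rep (x : T.M r) : T.Contribution r := (exists_rep x).choose

theorem mk_rep (x : T.M r) : Quotient.mk (T.contributionSetoid r) (rep x) = x :=
  (exists_rep x).choose_spec.1

theorem rep_graph (x : T.M r) : (rep x).graph =
    (Quotient.mk T.onePISetoid ⟨x.out.graph, x.out.onePI⟩).out.1 :=
  (exists_rep x).choose_spec.2

theorem nonempty_legIso_rep_out (x : T.M r) : Nonempty (LegIso (rep x) x.out) := by
  rw [← mk_eq_mk_iff, mk_rep, Quotient.out_eq]

/-- The number of labelled isomorphisms to the members of a set of isomorphism classes, weighted by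
the symmetry factors. -/
theorem sum_card_legIso {K : Type*} [Field K] [CharZero K] (s : Finset (T.M r))
    (C : T.Contribution r) :
    ∑ x ∈ s, ((rep x).sym : K)⁻¹ * (Nat.card (LegIso C (rep x)) : K) =
      if Quotient.mk (T.contributionSetoid r) C ∈ s then 1 else 0 := by
  have key : ∀ x, ((rep x).sym : K)⁻¹ * (Nat.card (LegIso C (rep x)) : K) =
      if Quotient.mk (T.contributionSetoid r) C = x then 1 else 0 := by
    intro x
    split_ifs with h
    · rw [← mk_rep x] at h
      obtain ⟨θ⟩ := mk_eq_mk_iff.1 h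
      rw [card_legIso_right θ]
      exact inv_mul_cancel₀ (Nat.cast_ne_zero.2 (sym_pos _).ne')
    · have : IsEmpty (LegIso C (rep x)) := by
        rw [← not_nonempty_iff, ← mk_eq_mk_iff, mk_rep]
        exact h
      rw [Nat.card_of_isEmpty]
      simp
  rw [Finset.sum_congr rfl fun x _ => key x, Finset.sum_ite_eq]

theorem Contribution.res_eq (C : T.Contribution r) : C.graph.res = r := by
  unfold FGraph.res
  have h1 : (Finset.univ.filter C.graph.IsLeg).val = (Finset.univ : Finset r.ToType).val.map C.leg := by
    rw [← Finset.image_val_of_injOn C.leg_injective.injOn]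
    congr 1
    ext h
    simp [C.range_leg]
  rw [h1, Multiset.map_map]
  have h2 : (C.graph.field ∘ C.leg) = fun x : r.ToType => x.1 := funext C.field_leg
  rw [h2]
  exact Multiset.map_univ_coe r

/-- The ways in which `G` arises from `Y` by inserting `Z` at the place `p`. -/
def Gluing (G Y : T.Contribution r) (p : Y.graph.Place) (Z : T.Contribution p.type) : Type :=
  {ij : (Y.graph.H → G.graph.H) × (Z.graph.H → G.graph.H) //
    Glues G.graph Y.graph Z.graph p p.label Z.leg ij.1 ij.2 ∧ ∀ x, ij.1 (Y.leg x) = G.leg x}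

instance (G Y : T.Contribution r) (p : Y.graph.Place) (Z : T.Contribution p.type) :
    Finite (Gluing G Y p Z) := by
  unfold Gluing
  infer_instance

/-- The insertion of `Z` at the place `p` of `Y`. -/
theorem exists_insertion (Y : T.Contribution r) (p : Y.graph.Place) (Z : T.Contribution p.type) :
    ∃ C : T.Contribution r, C.graph.loops = Y.graph.loops + Z.graph.loops ∧
      ∀ G, Nat.card (Gluing G Y p Z) = Nat.card (LegIso C G) := by
  obtain ⟨Γ, i, j, h⟩ := exists_glues Y.onePI p p.label_injective p.has_iff_label Z.leg_injective
    Z.range_leg (fun x => by rw [Z.field_leg, p.field_label]) Z.res_eq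
  have h1 : T.IsOnePI Γ := IsOnePI.of_glues h Y.onePI Z.onePI
  let C : T.Contribution r :=
    { graph := Γ
      onePI := h1
      leg := fun x => i (Y.leg x)
      leg_injective := h.core.i_inj.comp Y.leg_injective
      range_leg := by
        intro y
        rw [h.isLeg_iff]
        constructor
        · rintro ⟨x, rfl, hx⟩
          obtain ⟨z, rfl⟩ := (Y.range_leg x).1 hx
          exact ⟨z, rfl⟩
        · rintro ⟨z, rfl⟩
          exact ⟨_, rfl, (Y.range_leg _).2 ⟨z, rfl⟩⟩
      field_leg := fun x => by rw [h.core.i_field, Y.field_leg] }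
  refine ⟨C, IsOnePI.loops_of_glues h h1 Y.onePI Z.onePI, fun G => ?_⟩
  symm
  -- Composing the gluing maps of `C` with an isomorphism gives a gluing into `G`; uniqueness of the
  -- glued graph shows that every gluing arises so, and from one isomorphism only since the maps
  -- cover `C`.
  refine Nat.card_eq_of_bijective (fun θ : LegIso C G => (⟨(fun x => θ.1.1 (i x),
    fun b => θ.1.1 (j b)), ?_, ?_⟩ : Gluing G Y p Z)) ⟨?_, ?_⟩
  · have := h.transport θ.1 (Iso.refl _) (Iso.refl _)
    rw [Place.map_refl] at this
    exact this
  · exact θ.2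
  · intro θ θ' e
    have e1 := congrArg (fun w => w.1.1) e
    have e2 := congrArg (fun w => w.1.2) e
    refine Subtype.ext (Subtype.ext (Equiv.ext fun y => ?_))
    rcases h.core.cover y with ⟨b, rfl⟩ | ⟨x, rfl⟩
    · exact congrFun e2 b
    · exact congrFun e1 x
  · rintro ⟨⟨i', j'⟩, h', hl⟩
    obtain ⟨θ, h2, h3⟩ := h.exists_iso h'
    refine ⟨⟨θ, fun x => ?_⟩, Subtype.ext (Prod.ext (funext h2) (funext h3))⟩
    rw [← hl x]
    exact h2 _

end FeynmanTheory

/-! ### Bounds on the number of half-edges -/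

namespace FGraph

variable {F : Type}

theorem sum_card_blockTypes {Γ : FGraph F} {s : Setoid Γ.H} {U : Γ.H → Prop}
    (hU : ∀ x y, s x y → U x → U y) :
    ((Γ.blockTypes s U).map Multiset.card).sum = (Finset.univ.filter U).card := by
  unfold blockTypes
  rw [Multiset.map_map]
  have h1 := Finset.card_eq_sum_card_fiberwise (s := Finset.univ.filter U)
    (t := Finset.univ.filter (fun q : Quotient s => ∃ h, U h ∧ Quotient.mk s h = q))
    (f := fun h => Quotient.mk s h) (by
      intro h hh
      simp only [Finset.coe_filter, Finset.mem_univ, true_and, Set.mem_ofPred_eq] at hh ⊢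
      exact ⟨h, hh, rfl⟩)
  rw [h1]
  change Finset.sum _ _ = _
  refine Finset.sum_congr rfl fun q hq => ?_
  simp only [Finset.mem_filter, Finset.mem_univ, true_and] at hq
  obtain ⟨x, hx, rfl⟩ := hq
  simp only [Function.comp_apply, block, Multiset.card_map, Finset.card_val]
  congr 1
  ext y
  simp only [Finset.mem_filter, Finset.mem_univ, true_and]
  exact ⟨fun e => ⟨hU x y (s.symm' (Quotient.exact e)) hx, e⟩, fun e => e.2⟩

theorem card_halfEdges (Γ : FGraph F) (hp : Γ.InnerPairs) :
    Fintype.card Γ.H = 2 * Γ.innerTypes.card + Γ.res.card := by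
  have h1 := sum_card_blockTypes (Γ := Γ) (s := Γ.line) (U := fun h => ¬ Γ.IsLeg h)
    (fun x y hxy hx hy => hx (hy.of_line (Γ.line.symm' hxy)))
  have h2 : (Γ.innerTypes.map Multiset.card) = Multiset.replicate Γ.innerTypes.card 2 := by
    rw [← Multiset.map_const']
    exact Multiset.map_congr rfl hp
  have h3 := Finset.card_filter_add_card_filter_not (s := (Finset.univ : Finset Γ.H)) Γ.IsLeg
  change (Γ.innerTypes.map Multiset.card).sum = _ at h1
  rw [h2, Multiset.sum_replicate] at h1
  unfold res
  rw [Multiset.card_map, Finset.card_val, ← Finset.card_univ, ← h3]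
  have h4 : (Finset.univ.filter fun h => ¬ Γ.IsLeg h).card = Γ.innerTypes.card * 2 := by
    rw [← smul_eq_mul, h1]
    congr!
  have h5 : (Finset.univ.filter fun h => ¬ Γ.IsLeg h).card =
      (@Finset.filter _ (fun h => ¬ Γ.IsLeg h) (fun _ => instDecidableNot) Finset.univ).card := by
    congr!
  rw [← h5, h4]
  omega

theorem three_mul_card_vertexTypes_le (Γ : FGraph F) (h : ∀ τ ∈ Γ.vertexTypes, 3 ≤ τ.card) :
    3 * Γ.vertexTypes.card ≤ Fintype.card Γ.H := by
  have h1 := sum_card_blockTypes (Γ := Γ) (s := Γ.vert) (U := fun _ => True) (fun _ _ _ h => h)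
  change (Γ.vertexTypes.map Multiset.card).sum = _ at h1
  rw [Finset.filter_true, Finset.card_univ] at h1
  rw [← h1]
  have := Multiset.card_nsmul_le_sum (s := Γ.vertexTypes.map Multiset.card) (a := 3) (by
    intro x hx
    obtain ⟨τ, hτ, rfl⟩ := Multiset.mem_map.1 hx
    exact h τ hτ)
  rw [Multiset.card_map, smul_eq_mul] at this
  omega

end FGraph

/-! ### Finiteness, and the two counts of gluings -/

namespace FeynmanTheory

open FGraph

variable {T : FeynmanTheory} {r : Multiset T.FieldType}

/-- For `H` half-edges, `E` inner lines, `V` vertices and `L` loops one has `H = 2E + |r|`, `E = L +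
V - 1` and `3V ≤ H`. Elimination of `E` and `V` gives `H ≤ 6L - 6 + 3|r|`; here it matters that
vertices have at least three legs. -/
theorem Contribution.card_le (C : T.Contribution r) :
    Fintype.card C.graph.H ≤ 6 * C.graph.loops + 3 * r.card := by
  have h1 := card_halfEdges C.graph C.onePI.innerPairs
  have h2 := three_mul_card_vertexTypes_le C.graph
    (fun τ hτ => T.three_le_card _ (C.onePI.vertexTypes_mem τ hτ))
  have h3 := C.onePI.loops_add
  rw [C.res_eq] at h1
  omega

theorem finite_setoid (α : Type) [Finite α] : Finite (Setoid α) :=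
  Finite.of_injective (fun s : Setoid α => fun a b : α => s a b) (by
    intro s t h
    exact Setoid.ext fun a b => Iff.of_eq (congrFun (congrFun h a) b))

/-- With boundedly many half-edges, every class is realized by one of finitely many structures on
some `Fin n`. This makes the `∑ᶠ` in `c` an actual sum instead of its default value `0`. -/
theorem finite_loops_eq (r : Multiset T.FieldType) (k : ℕ) :
    {x : T.M r | x.out.graph.loops = k}.Finite := by
  let Code : Type := Σ n : Fin (6 * k + 3 * r.card + 1),
    (Fin n.1 → T.FieldType) × Setoid (Fin n.1) × Setoid (Fin n.1) × (r.ToType → Fin n.1)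
  have : ∀ n, Finite (Setoid (Fin n)) := fun n => finite_setoid _
  have hfin : Finite Code := by
    dsimp only [Code]
    infer_instance
  let g : Code → FGraph T.FieldType := fun c => ⟨Fin c.1.1, inferInstance, c.2.1, c.2.2.1, c.2.2.2.1⟩
  let Good : Code → Prop := fun c => T.IsOnePI (g c) ∧ Function.Injective c.2.2.2.2 ∧
    (∀ h, (g c).IsLeg h ↔ ∃ x, c.2.2.2.2 x = h) ∧ ∀ x, c.2.1 (c.2.2.2.2 x) = x.1
  let f : {c : Code // Good c} → T.M r := fun c => Quotient.mk _
    { graph := g c.1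
      onePI := c.2.1
      leg := c.1.2.2.2.2
      leg_injective := c.2.2.1
      range_leg := c.2.2.2.1
      field_leg := c.2.2.2.2 }
  refine (Set.finite_range f).subset ?_
  intro x hx
  have hcard := Contribution.card_le x.out
  have hx : x.out.graph.loops = k := hx
  rw [hx] at hcard
  let e := Fintype.equivFin x.out.graph.H
  let c : Code := ⟨⟨Fintype.card x.out.graph.H, by omega⟩, fun h => x.out.graph.field (e.symm h),
    x.out.graph.vert.comap e.symm, x.out.graph.line.comap e.symm, fun z => e (x.out.leg z)⟩
  let φ : FGraph.Iso x.out.graph (g c) := ⟨e, fun h => congrArg x.out.graph.field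
      (e.symm_apply_apply h), fun a b => by
        change x.out.graph.vert (e.symm (e a)) (e.symm (e b)) ↔ _
        rw [e.symm_apply_apply, e.symm_apply_apply], fun a b => by
        change x.out.graph.line (e.symm (e a)) (e.symm (e b)) ↔ _
        rw [e.symm_apply_apply, e.symm_apply_apply]⟩
  have hc : Good c := by
    refine ⟨x.out.onePI.of_iso φ, e.injective.comp x.out.leg_injective, ?_, ?_⟩
    · intro h
      obtain ⟨h, rfl⟩ := φ.1.surjective h
      rw [φ.isLeg_iff, x.out.range_leg]
      constructor
      · rintro ⟨z, rfl⟩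
        exact ⟨z, rfl⟩
      · rintro ⟨z, hz⟩
        exact ⟨z, e.injective hz⟩
    · intro z
      exact (congrArg x.out.graph.field (e.symm_apply_apply _)).trans (x.out.field_leg z)
  refine ⟨⟨c, hc⟩, ?_⟩
  refine Eq.trans ?_ (Quotient.out_eq x)
  exact mk_eq_mk_iff.2 ⟨LegIso.symm ⟨φ, fun _ => rfl⟩⟩

/-- The graphs with `k` loops that contribute to `r`. -/
noncomputable def loopClasses (r : Multiset T.FieldType) (k : ℕ) : Finset (T.M r) :=
  (finite_loops_eq r k).toFinset

theorem loops_eq_of_legIso {C C' : T.Contribution r} (θ : LegIso C C') :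
    C'.graph.loops = C.graph.loops := C.onePI.loops_eq_of_iso θ.1

theorem mem_loopClasses {k : ℕ} {x : T.M r} :
    x ∈ loopClasses r k ↔ (rep x).graph.loops = k := by
  obtain ⟨θ⟩ := nonempty_legIso_rep_out x
  unfold loopClasses
  rw [Set.Finite.mem_toFinset, ← loops_eq_of_legIso θ]
  rfl

theorem mk_mem_loopClasses {k : ℕ} {C : T.Contribution r} :
    Quotient.mk (T.contributionSetoid r) C ∈ loopClasses r k ↔ C.graph.loops = k := by
  obtain ⟨θ⟩ := mk_eq_mk_iff.1 (mk_rep (Quotient.mk (T.contributionSetoid r) C))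
  rw [mem_loopClasses, ← loops_eq_of_legIso θ]

/-- The insertions with a given set of inserted lines. -/
abbrev GluingAt (G Y : T.Contribution r) (p : Y.graph.Place) (Z : T.Contribution p.type)
    (S : Finset (Quotient G.graph.line)) : Type :=
  {w : Gluing G Y p Z // edgeSet w.1.2 = S}

section

variable {K : Type*} [Field K] [CharZero K]

/-- Gluings into `G` are isomorphisms from the inserted graph to `G`. Only one class contributes,
and the number of isomorphisms there equals its symmetry factor. -/
theorem sum_card_gluing (Y : T.Contribution r) (p : Y.graph.Place) (Z : T.Contribution p.type) :
    ∑ x ∈ loopClasses r (Y.graph.loops + Z.graph.loops),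
      ((rep x).sym : K)⁻¹ * (Nat.card (Gluing (rep x) Y p Z) : K) = 1 := by
  obtain ⟨C, h1, h2⟩ := exists_insertion Y p Z
  simp only [h2]
  rw [sum_card_legIso, if_pos (mk_mem_loopClasses.2 h1)]

/-- Each proper 1PI subgraph arises from one insertion, up to isomorphism. -/
theorem sum_card_gluingAt (G : T.Contribution r) {γ : FGraph T.FieldType} (hγ : T.IsOnePI γ)
    (hres : γ.res ∈ T.R) {j : γ.H → G.graph.H} (hj : Embeds γ G.graph j)
    (hne : edgeSet j ≠ G.graph.internalEdges) :
    ∑ q ∈ Finset.HasAntidiagonal.antidiagonal G.graph.loops, ∑ y ∈ loopClasses r q.1,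
      ((rep y).sym : K)⁻¹ * ∑ p : (rep y).graph.Place, ∑ z ∈ loopClasses p.type q.2,
        ((rep z).sym : K)⁻¹ * (Nat.card (GluingAt G (rep y) p (rep z) (edgeSet j)) : K) = 1 := by
  obtain ⟨p₀, m, hm⟩ := exists_label G.onePI hγ hres hj hne
  have h₀ := hm p₀.label p₀.label_injective p₀.has_iff_label
  have hC : T.IsOnePI (G.graph.contract (edgeSet j : Set (Quotient G.graph.line))) :=
    IsOnePI.quotient_of_glues h₀ G.onePI hγ hres hne
  have hleg : ∀ x, ∃ y : (G.graph.contract (edgeSet j : Set (Quotient G.graph.line))).H,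
      y.1 = G.leg x := by
    intro x
    obtain ⟨y, hy, -⟩ := (h₀.isLeg_iff _).1 ((G.range_leg _).2 ⟨x, rfl⟩)
    exact ⟨y, hy⟩
  choose lg hlg using hleg
  let C₀ : T.Contribution r :=
    { graph := G.graph.contract (edgeSet j : Set (Quotient G.graph.line))
      onePI := hC
      leg := lg
      leg_injective := by
        intro x y e
        exact G.leg_injective (by rw [← hlg, ← hlg, e])
      range_leg := by
        intro h
        rw [← h₀.isLeg_i_iff, G.range_leg]
        constructor
        · rintro ⟨x, hx⟩
          exact ⟨x, Subtype.ext ((hlg x).trans hx)⟩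
        · rintro ⟨x, rfl⟩
          exact ⟨x, (hlg x).symm⟩
      field_leg := by
        intro x
        rw [← G.field_leg, ← hlg]
        rfl }
  have hloops : C₀.graph.loops + γ.loops = G.graph.loops :=
    (IsOnePI.loops_of_glues h₀ G.onePI hC hγ).symm
  obtain ⟨b₀, hb₀⟩ := hγ.exists_not_isLeg
  -- a gluing consists of an isomorphism with the contracted graph and one with the subgraph
  let A : ∀ (Y : T.Contribution r) (_ : LegIso C₀ Y) (p : Y.graph.Place)
      (Z : T.Contribution p.type), Type := fun Y φ p Z => {ψ : FGraph.Iso γ Z.graph //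
    Glues G.graph Y.graph Z.graph p p.label Z.leg (fun y => (φ.1.1.symm y).1)
      (fun z => j (ψ.1.symm z))}
  have hcard : ∀ (Y : T.Contribution r) (p : Y.graph.Place) (Z : T.Contribution p.type),
      Nat.card (GluingAt G Y p Z (edgeSet j)) = Nat.card (Σ φ : LegIso C₀ Y, A Y φ p Z) := by
    intro Y p Z
    symm
    refine Nat.card_eq_of_bijective (fun w : Σ φ : LegIso C₀ Y, A Y φ p Z =>
      (⟨⟨(fun y => (w.1.1.1.symm y).1, fun z => j (w.2.1.1.symm z)), w.2.2, ?_⟩, ?_⟩ :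
        GluingAt G Y p Z (edgeSet j))) ⟨?_, ?_⟩
    · intro x
      change (w.1.1.1.symm (Y.leg x)).1 = _
      rw [← w.1.2 x, Equiv.symm_apply_apply]
      exact hlg x
    · exact edgeSet_comp_iso j w.2.1
    · rintro ⟨φ, ψ⟩ ⟨φ', ψ'⟩ e
      have e1 := congrArg (fun w => w.1.1.1) e
      have e2 := congrArg (fun w => w.1.1.2) e
      have : φ = φ' := by
        refine Subtype.ext (Subtype.ext ?_)
        rw [← Equiv.symm_bijective.injective.eq_iff]
        exact Equiv.ext fun y => Subtype.ext (congrFun e1 y)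
      subst this
      have : ψ = ψ' := by
        refine Subtype.ext (Subtype.ext ?_)
        rw [← Equiv.symm_bijective.injective.eq_iff]
        exact Equiv.ext fun y => hj.inj (congrFun e2 y)
      rw [this]
    · rintro ⟨⟨⟨i', j'⟩, h', hl⟩, hS⟩
      have h' : Glues G.graph Y.graph Z.graph p p.label Z.leg i' j' := h'
      have hS : edgeSet j' = edgeSet j := hS
      have hj' := h'.core.embeds
      -- Equal edge sets give equal half-edges, so the two embedded subgraphs are isomorphic over
      -- `G`. After this identification, uniqueness of the quotient provides the isomorphism `φ`.
      obtain ⟨ψ, hψ⟩ := hj.exists_iso hj'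
        (hj.range_iff hj' hγ.cutConnected Z.onePI.cutConnected hS.symm hb₀) hS.symm
      have h2 := h'.transport (Iso.refl _) (Iso.refl _) ψ.symm
      rw [Place.map_refl] at h2
      have hjj : (fun b => (Iso.refl G.graph).1 (j' ((Iso.symm ψ).1.symm b))) = j := funext hψ
      rw [hjj] at h2
      obtain ⟨φ, hφ, -⟩ := h₀.exists_quotient_iso h2
      have hφ : ∀ x, i' (φ.1 x) = x.1 := hφ
      have hi' : i' = fun y => (φ.1.symm y).1 := by
        funext y
        rw [← hφ, Equiv.apply_symm_apply]
      have hj'' : j' = fun z => j (ψ.1.symm z) := by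
        funext z
        rw [← hψ, Equiv.apply_symm_apply]
      refine ⟨⟨⟨φ, ?_⟩, ⟨ψ, ?_⟩⟩, ?_⟩
      · intro x
        refine h'.core.i_inj ?_
        rw [hφ, show i' (Y.leg x) = G.leg x from hl x]
        exact hlg x
      · rw [← hi', ← hj'']
        exact h'
      · exact Subtype.ext (Subtype.ext (Prod.ext hi'.symm hj''.symm))
  -- Once `φ` is fixed, it carries a labelling to the legs of `γ`, and what remains to be counted
  -- are the isomorphisms from `γ` with these labels. Their weighted number is `1` if the loop
  -- number fits.
  have hA : ∀ (Y : T.Contribution r) (φ : LegIso C₀ Y) (k : ℕ),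
      ∑ p : Y.graph.Place, ∑ z ∈ loopClasses p.type k,
        ((rep z).sym : K)⁻¹ * (Nat.card (A Y φ p (rep z)) : K) = if γ.loops = k then 1 else 0 := by
    intro Y φ k
    have hpl : ∀ x, p₀.Has x ↔ ∃ z, φ.1.1.symm ((p₀.map φ.1).label z) = x := by
      intro x
      rw [← Place.has_map φ.1 p₀ x, Place.has_iff_label]
      constructor
      · rintro ⟨z, hz⟩
        exact ⟨z, by rw [hz, Equiv.symm_apply_apply]⟩
      · rintro ⟨z, rfl⟩
        exact ⟨z, (Equiv.apply_symm_apply _ _).symm⟩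
    have h₁ := hm (fun z => φ.1.1.symm ((p₀.map φ.1).label z))
      (φ.1.1.symm.injective.comp (Place.label_injective _)) hpl
    let C₁ : T.Contribution (p₀.map φ.1).type :=
      { graph := γ
        onePI := hγ
        leg := fun z => m (φ.1.1.symm ((p₀.map φ.1).label z))
        leg_injective := h₁.core.l_inj
        range_leg := h₁.core.l_range
        field_leg := by
          intro z
          rw [h₁.core.l_field, ← φ.1.2.1, Equiv.apply_symm_apply, Place.field_label] }
    have htr : ∀ Z : T.Contribution (p₀.map φ.1).type, ∀ ψ : FGraph.Iso γ Z.graph,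
        Glues G.graph Y.graph Z.graph (p₀.map φ.1) (p₀.map φ.1).label (fun z => ψ.1 (C₁.leg z))
          (fun y => (φ.1.1.symm y).1) (fun z => j (ψ.1.symm z)) := by
      intro Z ψ
      have h2 := h₁.transport (Iso.refl _) φ.1 ψ
      have e : (fun z => φ.1.1 (φ.1.1.symm ((p₀.map φ.1).label z))) = (p₀.map φ.1).label :=
        funext fun z => Equiv.apply_symm_apply _ _
      rw [e] at h2
      exact h2
    -- The place is determined by the subgraph, so only the image of `p₀` admits a gluing.
    rw [Finset.sum_eq_single (p₀.map φ.1)]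
    · have hAC : ∀ Z, Nat.card (A Y φ (p₀.map φ.1) Z) = Nat.card (LegIso C₁ Z) := by
        intro Z
        refine Nat.card_congr (Equiv.subtypeEquivRight fun ψ => ?_)
        constructor
        · intro h2 z
          exact (htr Z ψ).label_eq h2 z
        · intro h2
          have e : (fun z => ψ.1 (C₁.leg z)) = Z.leg := funext h2
          rw [← e]
          exact htr Z ψ
      simp only [hAC]
      rw [sum_card_legIso]
      exact if_congr mk_mem_loopClasses rfl rfl
    · intro p _ hp
      refine Finset.sum_eq_zero fun z _ => ?_
      have : IsEmpty (A Y φ p (rep z)) := by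
        refine ⟨fun ⟨ψ, h2⟩ => hp ?_⟩
        exact h2.place_eq (h₀.transport (Iso.refl _) φ.1 ψ)
      rw [Nat.card_of_isEmpty]
      simp
    · intro h
      exact absurd (Finset.mem_univ _) h
  have hY : ∀ (Y : T.Contribution r) (k : ℕ),
      ∑ p : Y.graph.Place, ∑ z ∈ loopClasses p.type k,
        ((rep z).sym : K)⁻¹ * (Nat.card (GluingAt G Y p (rep z) (edgeSet j)) : K) =
      (Nat.card (LegIso C₀ Y) : K) * if γ.loops = k then 1 else 0 := by
    intro Y k
    have : Fintype (LegIso C₀ Y) := Fintype.ofFinite _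
    have h2 : ∀ p : Y.graph.Place, ∀ Z : T.Contribution p.type,
        (Nat.card (GluingAt G Y p Z (edgeSet j)) : K) =
          ∑ φ : LegIso C₀ Y, (Nat.card (A Y φ p Z) : K) := by
      intro p Z
      have : ∀ φ, Finite (A Y φ p Z) := by
        intro φ
        dsimp only [A]
        infer_instance
      rw [hcard, Nat.card_sigma, Nat.cast_sum]
    simp only [h2, Finset.mul_sum]
    have h3 : ∀ p : Y.graph.Place, ∑ z ∈ loopClasses p.type k, ∑ φ : LegIso C₀ Y,
        ((rep z).sym : K)⁻¹ * (Nat.card (A Y φ p (rep z)) : K) =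
        ∑ φ : LegIso C₀ Y, ∑ z ∈ loopClasses p.type k,
          ((rep z).sym : K)⁻¹ * (Nat.card (A Y φ p (rep z)) : K) := fun p => Finset.sum_comm
    simp only [h3]
    rw [Finset.sum_comm]
    simp only [hA]
    rw [Finset.sum_const, Finset.card_univ, ← Nat.card_eq_fintype_card, nsmul_eq_mul]
  simp only [hY]
  -- Only the splitting of the loop number into those of the quotient and of `γ` contributes, and
  -- there the isomorphisms from the quotient have weighted number `1`.
  rw [Finset.sum_eq_single (C₀.graph.loops, γ.loops)]
  · simp only [if_true, mul_one]
    rw [sum_card_legIso, if_pos (mk_mem_loopClasses.2 rfl)]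
  · rintro ⟨k, k'⟩ hk hne
    rw [Finset.HasAntidiagonal.mem_antidiagonal] at hk
    by_cases h : γ.loops = k'
    · exfalso
      refine hne ?_
      rw [Prod.mk.injEq]
      omega
    · simp [if_neg h]
  · intro h
    exact absurd (Finset.HasAntidiagonal.mem_antidiagonal.2 hloops) h

end

end FeynmanTheory

/-! ### The linearized coproduct as a sum over insertions -/

namespace FeynmanTheory

open FGraph

variable {T : FeynmanTheory} {r : Multiset T.FieldType}

section Subgraphs

variable {Γ Γ' γ : FGraph T.FieldType} {X : Type}

/-- The connected subgraphs over which the coproduct sums. -/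
noncomputable def connectedDivergent (T : FeynmanTheory) (Γ : FGraph T.FieldType) :
    Finset (Finset (Quotient Γ.line)) :=
  (T.divergentSubgraphs Γ).filter
    (fun S => (Γ.components (S : Set (Quotient Γ.line))).card = 1)

theorem not_isLeg_of_mem_divergentSubgraphs (hΓ : T.IsOnePI Γ) {S : Finset (Quotient Γ.line)}
    (hS : S ∈ T.divergentSubgraphs Γ) (h : Γ.H)
    (hh : Quotient.mk Γ.line h ∈ (S : Set (Quotient Γ.line))) : ¬ Γ.IsLeg h := by
  have h1 := (Finset.mem_ssubsets.1 (Finset.mem_filter.1 hS).1).1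
  exact hΓ.innerPairs.mem_internalEdges.1 (h1 hh)

theorem edgeSet_component_subset (hΓ : T.IsOnePI Γ) {S : Finset (Quotient Γ.line)}
    (hS : S ∈ T.divergentSubgraphs Γ) (c : Quotient (Γ.comp (S : Set (Quotient Γ.line)))) :
    edgeSet (γ := Γ.component (S : Set (Quotient Γ.line)) c) (Γ := Γ) Subtype.val ⊆ S := by
  intro q hq
  obtain ⟨h, rfl⟩ := Quotient.exists_rep q
  exact ((mk_mem_edgeSet_component (not_isLeg_of_mem_divergentSubgraphs hΓ hS) c h).1 hq).2

theorem edgeSet_component_ne (hΓ : T.IsOnePI Γ) {S : Finset (Quotient Γ.line)}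
    (hS : S ∈ T.divergentSubgraphs Γ) (c : Quotient (Γ.comp (S : Set (Quotient Γ.line)))) :
    edgeSet (γ := Γ.component (S : Set (Quotient Γ.line)) c) (Γ := Γ) Subtype.val ≠
      Γ.internalEdges := by
  intro e
  have h1 := Finset.mem_ssubsets.1 (Finset.mem_filter.1 hS).1
  have h2 := edgeSet_component_subset hΓ hS c
  rw [e] at h2
  exact h1.2 h2

theorem edgeSet_component_eq (hΓ : T.IsOnePI Γ) {S : Finset (Quotient Γ.line)}
    (hS : S ∈ T.divergentSubgraphs Γ) {c : Quotient (Γ.comp (S : Set (Quotient Γ.line)))}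
    (hc : Γ.components (S : Set (Quotient Γ.line)) = {c}) :
    edgeSet (γ := Γ.component (S : Set (Quotient Γ.line)) c) (Γ := Γ) Subtype.val = S := by
  refine Finset.Subset.antisymm (edgeSet_component_subset hΓ hS c) ?_
  intro q hq
  obtain ⟨h, rfl⟩ := Quotient.exists_rep q
  refine (mk_mem_edgeSet_component (not_isLeg_of_mem_divergentSubgraphs hΓ hS) c h).2 ⟨?_, hq⟩
  rw [← Finset.mem_singleton, ← hc]
  simp only [components, Finset.mem_filter, Finset.mem_univ, true_and]
  exact ⟨h, rfl, hq⟩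

theorem _root_.FGraph.Glues.edgeSet_ne {F : Type} {Γ Γ' γ : FGraph F} {p : Γ'.Place}
    {a : X → Γ'.H} {l : X → γ.H}
    {i : Γ'.H → Γ.H} {j : γ.H → Γ.H} (h : Glues Γ Γ' γ p a l i j) {x : Γ'.H} (hx : ¬ Γ'.IsLeg x) :
    Quotient.mk Γ.line (i x) ∉ edgeSet j := by
  intro hm
  obtain ⟨b, hb, hl⟩ := (h.core.embeds.mk_mem_edgeSet _).1 hm
  rcases p with v | e
  · obtain ⟨z, rfl⟩ := GluesVertex.meet h x b hb.symm
    have : b = l z := h.core.embeds.inj (hb.trans (GluesVertex.glue h z))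
    exact hl ((h.core.l_range b).2 ⟨z, this.symm⟩)
  · exact GluesEdge.disj h x b hb.symm

theorem edgeSet_mem_connectedDivergent {p : Γ'.Place} {a : X → Γ'.H} {l : X → γ.H}
    {i : Γ'.H → Γ.H} {j : γ.H → Γ.H} (h : Glues Γ Γ' γ p a l i j) (hΓ : T.IsOnePI Γ)
    (hΓ' : T.IsOnePI Γ') (hγ : T.IsOnePI γ) (hres : γ.res ∈ T.R) :
    edgeSet j ∈ T.connectedDivergent Γ := by
  have hj := h.core.embeds
  obtain ⟨b₀, hb₀⟩ := hγ.exists_not_isLeg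
  obtain ⟨x₀, hx₀⟩ := hΓ'.exists_not_isLeg
  have hcomp := hj.components_eq hγ.cutConnected hb₀
  refine Finset.mem_filter.2 ⟨Finset.mem_filter.2 ⟨Finset.mem_ssubsets.2 ⟨?_, ?_⟩, ?_, ?_⟩, ?_⟩
  · intro q hq
    obtain ⟨y, rfl⟩ := Quotient.exists_rep q
    obtain ⟨b, rfl, hb⟩ := (hj.mk_mem_edgeSet y).1 hq
    exact hΓ.innerPairs.mem_internalEdges.2 (hj.not_isLeg hb)
  · intro hs
    refine h.edgeSet_ne hx₀ (hs ?_)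
    refine hΓ.innerPairs.mem_internalEdges.2 ?_
    rwa [h.isLeg_i_iff]
  · exact ⟨_, (hj.mk_mem_edgeSet _).2 ⟨b₀, rfl, hb₀⟩⟩
  · intro c hc
    rw [hcomp, Finset.mem_singleton] at hc
    obtain ⟨φ, -⟩ := hj.exists_component_iso hγ.cutConnected b₀
    rw [hc, φ.res_eq]
    exact ⟨hγ.of_iso φ, hres⟩
  · rw [hcomp, Finset.card_singleton]

variable {K : Type*} [Field K]

/-- The only component is isomorphic to `γ`. The contracted graph and `Γ'` are both quotients of `Γ`
for the same embedding `j`, hence isomorphic. -/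
theorem prod_gen_tmul_gen_contract {p : Γ'.Place} {a : X → Γ'.H} {l : X → γ.H}
    {i : Γ'.H → Γ.H} {j : γ.H → Γ.H} (h : Glues Γ Γ' γ p a l i j) (hΓ : T.IsOnePI Γ)
    (hΓ' : T.IsOnePI Γ') (hγ : T.IsOnePI γ) (hres : γ.res ∈ T.R) :
    (∏ c ∈ Γ.components (edgeSet j : Set (Quotient Γ.line)),
        T.gen K (Γ.component (edgeSet j : Set (Quotient Γ.line)) c)) ⊗ₜ[K]
      T.gen K (Γ.contract (edgeSet j : Set (Quotient Γ.line))) = T.gen K γ ⊗ₜ[K] T.gen K Γ' := by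
  have hj := h.core.embeds
  obtain ⟨b₀, hb₀⟩ := hγ.exists_not_isLeg
  obtain ⟨x₀, hx₀⟩ := hΓ'.exists_not_isLeg
  obtain ⟨φ, -⟩ := hj.exists_component_iso hγ.cutConnected b₀
  rw [hj.components_eq hγ.cutConnected hb₀, Finset.prod_singleton, ← gen_eq_of_iso φ]
  have hne : edgeSet j ≠ Γ.internalEdges := by
    intro e
    refine h.edgeSet_ne hx₀ ?_
    rw [e]
    refine hΓ.innerPairs.mem_internalEdges.2 ?_
    rwa [h.isLeg_i_iff]
  obtain ⟨p₀, m, hm⟩ := exists_label hΓ hγ hres hj hne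
  obtain ⟨ψ, -⟩ := (hm p₀.label p₀.label_injective p₀.has_iff_label).exists_quotient_iso h
  rw [gen_eq_of_iso ψ]

theorem isHomogeneous_gen (Γ : FGraph T.FieldType) : (T.gen K Γ).IsHomogeneous 1 := by
  unfold gen
  split_ifs
  · exact MvPolynomial.isHomogeneous_X _ _
  · exact MvPolynomial.isHomogeneous_zero _ _ _

theorem Plin_of_isHomogeneous {x : T.Hopf K} {m : ℕ} (h : x.IsHomogeneous m) :
    T.Plin K x = if m = 1 then x else 0 := by
  simp only [eq_comm (a := m)]
  exact MvPolynomial.homogeneousComponent_of_mem h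

theorem Plin_gen (Γ : FGraph T.FieldType) : T.Plin K (T.gen K Γ) = T.gen K Γ := by
  rw [Plin_of_isHomogeneous (isHomogeneous_gen Γ), if_pos rfl]

theorem Plin_one : T.Plin K 1 = 0 := by
  rw [Plin_of_isHomogeneous (MvPolynomial.isHomogeneous_one _ _), if_neg (by norm_num)]

theorem Plin_prod_gen {ι : Type*} (s : Finset ι) (g : ι → FGraph T.FieldType) :
    T.Plin K (∏ c ∈ s, T.gen K (g c)) = if s.card = 1 then ∏ c ∈ s, T.gen K (g c) else 0 := by
  have h := MvPolynomial.IsHomogeneous.prod s (fun c => T.gen K (g c)) (fun _ => 1)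
    (fun c _ => isHomogeneous_gen (g c))
  rw [Plin_of_isHomogeneous h]
  simp

/-- The left factor of a term is a product of as many generators as the subgraph has components, so
`Plin` keeps only connected subgraphs; `Γ ⊗ 1` and `1 ⊗ Γ` vanish because `Plin` kills `1`. -/
theorem map_Plin_graphCoproduct (Γ : FGraph T.FieldType) :
    TensorProduct.map (T.Plin K) (T.Plin K) (T.graphCoproduct K Γ) =
      ∑ S ∈ T.connectedDivergent Γ,
        (∏ c ∈ Γ.components (S : Set (Quotient Γ.line)),
          T.gen K (Γ.component (S : Set (Quotient Γ.line)) c)) ⊗ₜ[K]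
        T.gen K (Γ.contract (S : Set (Quotient Γ.line))) := by
  unfold graphCoproduct connectedDivergent
  rw [map_add, map_add, map_sum, Finset.sum_filter]
  simp only [TensorProduct.map_tmul, Plin_one, Plin_gen, Plin_prod_gen, TensorProduct.tmul_zero,
    TensorProduct.zero_tmul, add_zero, zero_add]
  refine Finset.sum_congr rfl fun S _ => ?_
  split_ifs with h
  · rfl
  · rw [TensorProduct.zero_tmul]

theorem coproduct_gen_out (q : T.OnePI) :
    T.coproduct K (T.gen K q.out.1) = T.graphCoproduct K q.out.1 := by
  have h : T.gen K q.out.1 = MvPolynomial.X q := by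
    unfold gen
    rw [dif_pos q.out.2]
    exact congrArg _ (Quotient.out_eq q)
  rw [h]
  exact MvPolynomial.aeval_X _ _

theorem Plin2_gen_rep (x : T.M r) :
    T.Plin2 K (T.gen K (rep x).graph) =
      TensorProduct.map (T.Plin K) (T.Plin K) (T.graphCoproduct K (rep x).graph) := by
  rw [rep_graph]
  change TensorProduct.map (T.Plin K) (T.Plin K) (T.coproduct K (T.gen K _)) = _
  rw [coproduct_gen_out]

end Subgraphs

theorem IsOnePI.place_type_mem {Γ : FGraph T.FieldType} (h : T.IsOnePI Γ) (p : Γ.Place) :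
    p.type ∈ T.R := by
  rcases p with v | e
  · exact Finset.mem_union_left _ (h.vertices v)
  · refine Finset.mem_union_right _ ?_
    rcases h.lines e.1 with ⟨f, hf⟩ | h1
    · have h2 : (Γ.lineType e.1).card = 2 := (Finset.mem_filter.1 e.2).2
      rw [hf, Multiset.card_singleton] at h2
      omega
    · exact h1

section

variable {K : Type*} [Field K] [CharZero K]

/-- The term is multiplied by `1`, written as the weighted number of gluings along `S`. Whenever
such a gluing of `Z` into `Y` exists, the term equals `Z ⊗ Y`. -/
theorem connectedDivergent_term_eq (G : T.Contribution r) {S : Finset (Quotient G.graph.line)}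
    (hS : S ∈ T.connectedDivergent G.graph) :
    (∏ c ∈ G.graph.components (S : Set (Quotient G.graph.line)),
        T.gen K (G.graph.component (S : Set (Quotient G.graph.line)) c)) ⊗ₜ[K]
      T.gen K (G.graph.contract (S : Set (Quotient G.graph.line))) =
    ∑ q ∈ Finset.HasAntidiagonal.antidiagonal G.graph.loops, ∑ y ∈ loopClasses r q.1,
      ∑ p : (rep y).graph.Place, ∑ z ∈ loopClasses p.type q.2,
        (((rep y).sym : K)⁻¹ * (((rep z).sym : K)⁻¹ *
          (Nat.card (GluingAt G (rep y) p (rep z) S) : K))) •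
        (T.gen K (rep z).graph ⊗ₜ[K] T.gen K (rep y).graph) := by
  obtain ⟨hD, hcard⟩ := Finset.mem_filter.1 hS
  obtain ⟨c, hc⟩ := Finset.card_eq_one.1 hcard
  obtain ⟨hγ, hres⟩ := (Finset.mem_filter.1 hD).2.2 c (by rw [hc]; exact Finset.mem_singleton_self c)
  have key := sum_card_gluingAt (K := K) G hγ hres
    (embeds_component (S : Set (Quotient G.graph.line)) c) (edgeSet_component_ne G.onePI hD c)
  rw [edgeSet_component_eq G.onePI hD hc] at key
  set t := (∏ c ∈ G.graph.components (S : Set (Quotient G.graph.line)),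
        T.gen K (G.graph.component (S : Set (Quotient G.graph.line)) c)) ⊗ₜ[K]
      T.gen K (G.graph.contract (S : Set (Quotient G.graph.line))) with ht
  rw [← one_smul K t, ← key]
  simp only [Finset.mul_sum, Finset.sum_smul]
  refine Finset.sum_congr rfl fun q _ => Finset.sum_congr rfl fun y _ =>
    Finset.sum_congr rfl fun p _ => Finset.sum_congr rfl fun z _ => ?_
  by_cases he : IsEmpty (GluingAt G (rep y) p (rep z) S)
  · rw [Nat.card_of_isEmpty]
    simp
  · obtain ⟨w⟩ := not_isEmpty_iff.1 he
    rcases w with ⟨⟨⟨i, j⟩, ⟨hg, hl⟩⟩, hj⟩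
    have hj : edgeSet j = S := hj
    subst hj
    congr 1
    refine prod_gen_tmul_gen_contract hg G.onePI (rep y).onePI (rep z).onePI ?_
    rw [(rep z).res_eq]
    exact (rep y).onePI.place_type_mem p

/-- Every gluing singles out a connected divergent subgraph of `G`, namely the image of `Z`; the
gluings are sorted by its edge set. -/
theorem sum_card_gluingAt_connectedDivergent (G Y : T.Contribution r) (p : Y.graph.Place)
    (Z : T.Contribution p.type) :
    ∑ S ∈ T.connectedDivergent G.graph, Nat.card (GluingAt G Y p Z S) =
      Nat.card (Gluing G Y p Z) := by
  have : Fintype (Gluing G Y p Z) := Fintype.ofFinite _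
  rw [Nat.card_eq_fintype_card, ← Finset.card_univ,
    Finset.card_eq_sum_card_fiberwise (s := Finset.univ) (t := T.connectedDivergent G.graph)
      (f := fun w : Gluing G Y p Z => edgeSet w.1.2)]
  · refine Finset.sum_congr rfl fun S _ => ?_
    rw [Nat.card_eq_fintype_card, Fintype.card_subtype]
  · intro w _
    refine edgeSet_mem_connectedDivergent w.2.1 G.onePI Y.onePI Z.onePI ?_
    rw [Z.res_eq]
    exact Y.onePI.place_type_mem p

/-- The linearized coproduct of the sum of all graphs with `k` loops: all ways to insert a graph
into a place of another one. -/
theorem sum_Plin2_gen (r : Multiset T.FieldType) (k : ℕ) :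
    ∑ x ∈ loopClasses r k, ((rep x).sym : K)⁻¹ • T.Plin2 K (T.gen K (rep x).graph) =
      ∑ q ∈ Finset.HasAntidiagonal.antidiagonal k, ∑ y ∈ loopClasses r q.1,
        ((rep y).sym : K)⁻¹ • ∑ p : (rep y).graph.Place,
          (∑ z ∈ loopClasses p.type q.2, ((rep z).sym : K)⁻¹ • T.gen K (rep z).graph) ⊗ₜ[K]
            T.gen K (rep y).graph := by
  have h1 : ∀ x ∈ loopClasses r k, ((rep x).sym : K)⁻¹ • T.Plin2 K (T.gen K (rep x).graph) =
      ∑ q ∈ Finset.HasAntidiagonal.antidiagonal k, ∑ y ∈ loopClasses r q.1,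
        ∑ p : (rep y).graph.Place, ∑ z ∈ loopClasses p.type q.2,
          (((rep y).sym : K)⁻¹ * ((rep z).sym : K)⁻¹ *
            (((rep x).sym : K)⁻¹ * (Nat.card (Gluing (rep x) (rep y) p (rep z)) : K))) •
          (T.gen K (rep z).graph ⊗ₜ[K] T.gen K (rep y).graph) := by
    intro x hx
    rw [Plin2_gen_rep, map_Plin_graphCoproduct,
      Finset.sum_congr rfl fun S hS => connectedDivergent_term_eq (rep x) hS,
      mem_loopClasses.1 hx, Finset.sum_comm, Finset.smul_sum]
    refine Finset.sum_congr rfl fun q _ => ?_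
    rw [Finset.sum_comm, Finset.smul_sum]
    refine Finset.sum_congr rfl fun y _ => ?_
    rw [Finset.sum_comm, Finset.smul_sum]
    refine Finset.sum_congr rfl fun p _ => ?_
    rw [Finset.sum_comm, Finset.smul_sum]
    refine Finset.sum_congr rfl fun z _ => ?_
    rw [← Finset.sum_smul, ← Finset.mul_sum, ← Finset.mul_sum, ← Nat.cast_sum,
      sum_card_gluingAt_connectedDivergent, smul_smul]
    congr 1
    ring
  rw [Finset.sum_congr rfl h1, Finset.sum_comm]
  refine Finset.sum_congr rfl fun q hq => ?_
  rw [Finset.sum_comm]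
  refine Finset.sum_congr rfl fun y hy => ?_
  rw [Finset.sum_comm, Finset.smul_sum]
  refine Finset.sum_congr rfl fun p _ => ?_
  rw [Finset.sum_comm, TensorProduct.sum_tmul, Finset.smul_sum]
  refine Finset.sum_congr rfl fun z hz => ?_
  -- With the sum over `G` innermost, its weighted number of gluings is `1`, and only the weights of
  -- `Y` and `Z` are left.
  have h2 := sum_card_gluing (K := K) (rep y) p (rep z)
  rw [mem_loopClasses.1 hy, mem_loopClasses.1 hz, Finset.HasAntidiagonal.mem_antidiagonal.1 hq]
    at h2
  rw [← Finset.sum_smul, ← Finset.mul_sum, h2, mul_one, ← TensorProduct.smul_tmul', smul_smul]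

end

end FeynmanTheory

/-! ### Linear parts of products and of the series of graphs -/

namespace FeynmanTheory

open FGraph

variable {T : FeynmanTheory} {r : Multiset T.FieldType} {K : Type*} [Field K]

section LinearPart

theorem Plin_mul_X (x : T.Hopf K) (i : T.OnePI) :
    T.Plin K (x * MvPolynomial.X i) = MvPolynomial.constantCoeff x • MvPolynomial.X i := by
  ext m
  unfold Plin
  rw [MvPolynomial.coeff_homogeneousComponent, MvPolynomial.coeff_mul_X', MvPolynomial.coeff_smul,
    MvPolynomial.coeff_X]
  by_cases hm : Finsupp.single i 1 = m
  · subst hm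
    rw [if_pos (by simp), if_pos (by simp), if_pos rfl, tsub_self]
    simp [MvPolynomial.constantCoeff_eq]
  · rw [if_neg hm, smul_zero]
    split_ifs with h1 h2
    · exfalso
      refine hm ?_
      have h3 : Finsupp.single i 1 ≤ m :=
        Finsupp.single_le_iff.2 (Nat.one_le_iff_ne_zero.2 (Finsupp.mem_support_iff.1 h2))
      have h4 := congrArg Finsupp.degree (add_tsub_cancel_of_le h3)
      rw [map_add, h1, Finsupp.degree_single] at h4
      have h5 : m - Finsupp.single i 1 = 0 := by
        rw [← Finsupp.degree_eq_zero_iff]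
        omega
      exact le_antisymm h3 (tsub_eq_zero_iff_le.1 h5)
    · rfl
    · rfl

/-- This Leibniz rule makes `Plin` a derivation over the augmentation. On series of augmentation `1`
it therefore acts like a logarithmic derivative. -/
theorem Plin_mul (x y : T.Hopf K) : T.Plin K (x * y) =
    MvPolynomial.constantCoeff x • T.Plin K y + MvPolynomial.constantCoeff y • T.Plin K x := by
  induction x using MvPolynomial.induction_on generalizing y with
  | C a =>
    have h1 : T.Plin K (MvPolynomial.C a) = 0 := by
      rw [Plin_of_isHomogeneous (MvPolynomial.isHomogeneous_C _ _), if_neg (by norm_num)]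
    rw [h1, smul_zero, add_zero, MvPolynomial.constantCoeff_C, ← MvPolynomial.smul_eq_C_mul,
      map_smul]
  | add p q hp hq =>
    rw [add_mul, map_add, hp, hq, map_add, map_add, add_smul, smul_add]
    abel
  | mul_X p i _ =>
    rw [mul_right_comm, Plin_mul_X, Plin_mul_X, map_mul, map_mul, MvPolynomial.constantCoeff_X,
      mul_zero, zero_smul, zero_add, smul_smul, mul_comm]

/-- The part of degree zero in the graphs. -/
noncomputable def augmentation (T : FeynmanTheory) (K : Type*) [Field K] :
    PowerSeries (T.Hopf K) →+* PowerSeries (T.Hopf K) :=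
  PowerSeries.map (MvPolynomial.C.comp MvPolynomial.constantCoeff)

theorem coeff_linPart (A : PowerSeries (T.Hopf K)) (k : ℕ) :
    PowerSeries.coeff k (T.linPart K A) = T.Plin K (PowerSeries.coeff k A) :=
  PowerSeries.coeff_mk _ _

theorem linPart_mul (A B : PowerSeries (T.Hopf K)) : T.linPart K (A * B) =
    T.augmentation K A * T.linPart K B + T.linPart K A * T.augmentation K B := by
  ext1 k
  rw [coeff_linPart, map_add, PowerSeries.coeff_mul, PowerSeries.coeff_mul, PowerSeries.coeff_mul,
    map_sum, ← Finset.sum_add_distrib]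
  refine Finset.sum_congr rfl fun p _ => ?_
  rw [Plin_mul, coeff_linPart, coeff_linPart, augmentation, PowerSeries.coeff_map,
    PowerSeries.coeff_map, MvPolynomial.smul_eq_C_mul, MvPolynomial.smul_eq_C_mul,
    mul_comm (MvPolynomial.C (MvPolynomial.constantCoeff (PowerSeries.coeff p.2 B)))]
  rfl

theorem linPart_one : T.linPart K 1 = 0 := by
  ext1 k
  rw [coeff_linPart, PowerSeries.coeff_one, map_zero]
  split_ifs
  · exact Plin_one
  · exact map_zero _

theorem linPart_mul_of_one {A B : PowerSeries (T.Hopf K)} (hA : T.augmentation K A = 1)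
    (hB : T.augmentation K B = 1) : T.linPart K (A * B) = T.linPart K A + T.linPart K B := by
  rw [linPart_mul, hA, hB, one_mul, mul_one, add_comm]

theorem augmentation_prod {ι : Type*} (s : Finset ι) (A : ι → PowerSeries (T.Hopf K))
    (h : ∀ i ∈ s, T.augmentation K (A i) = 1) : T.augmentation K (∏ i ∈ s, A i) = 1 := by
  rw [map_prod]
  exact Finset.prod_eq_one h

theorem linPart_prod {ι : Type*} (s : Finset ι) (A : ι → PowerSeries (T.Hopf K))
    (h : ∀ i ∈ s, T.augmentation K (A i) = 1) :
    T.linPart K (∏ i ∈ s, A i) = ∑ i ∈ s, T.linPart K (A i) := by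
  induction s using Finset.induction_on with
  | empty => simpa using linPart_one
  | insert a s ha ih =>
    have hs : ∀ i ∈ s, T.augmentation K (A i) = 1 :=
      fun i hi => h i (Finset.mem_insert_of_mem hi)
    rw [Finset.prod_insert ha, Finset.sum_insert ha,
      linPart_mul_of_one (h a (Finset.mem_insert_self _ _)) (augmentation_prod s A hs), ih hs]

theorem linPart_pow {A : PowerSeries (T.Hopf K)} (hA : T.augmentation K A = 1) (m : ℕ) :
    T.linPart K (A ^ m) = m • T.linPart K A := by
  have := linPart_prod (Finset.range m) (fun _ => A) (fun _ _ => hA)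
  rwa [Finset.prod_const, Finset.sum_const, Finset.card_range] at this

end LinearPart

section Green

theorem c_eq (r : Multiset T.FieldType) (k : ℕ) :
    T.c K r k = ∑ x ∈ loopClasses r k, ((rep x).sym : K)⁻¹ • T.gen K (rep x).graph := by
  have key : ∀ x : T.M r, (if x.out.graph.loops = k then
      ((x.out.sym : K)⁻¹) • T.gen K x.out.graph else 0) =
      if x ∈ loopClasses r k then ((rep x).sym : K)⁻¹ • T.gen K (rep x).graph else 0 := by
    intro x
    obtain ⟨θ⟩ := nonempty_legIso_rep_out x
    rw [sym_eq_of_legIso θ, gen_eq_of_iso θ.1]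
    refine if_congr ?_ rfl rfl
    rw [mem_loopClasses, loops_eq_of_legIso θ]
  unfold c
  simp only [key]
  rw [finsum_eq_sum_of_support_subset (s := loopClasses r k)]
  · exact Finset.sum_congr rfl fun x hx => if_pos hx
  · intro x hx
    by_contra h
    exact hx (if_neg h)

theorem Plin_c (r : Multiset T.FieldType) (k : ℕ) : T.Plin K (T.c K r k) = T.c K r k := by
  rw [c_eq, map_sum]
  refine Finset.sum_congr rfl fun x _ => ?_
  rw [map_smul, Plin_gen]

theorem constantCoeff_gen (Γ : FGraph T.FieldType) :
    MvPolynomial.constantCoeff (T.gen K Γ) = 0 := by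
  unfold gen
  split_ifs
  · exact MvPolynomial.constantCoeff_X (R := K) _
  · exact map_zero _

theorem constantCoeff_c (r : Multiset T.FieldType) (k : ℕ) :
    MvPolynomial.constantCoeff (T.c K r k) = 0 := by
  rw [c_eq, map_sum]
  refine Finset.sum_eq_zero fun x _ => ?_
  rw [MvPolynomial.constantCoeff_smul, constantCoeff_gen, smul_zero]

theorem c_zero (r : Multiset T.FieldType) : T.c K r 0 = 0 := by
  rw [c_eq]
  refine Finset.sum_eq_zero fun x hx => ?_
  have h1 := mem_loopClasses.1 hx
  have h2 := (rep x).onePI.one_le_loops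
  omega

/-- The sign of the graphs in the series of an amplitude. -/
noncomputable def greenSign (K : Type*) [Field K] (r : Multiset T.FieldType) : K :=
  if r.card = 2 then -1 else 1

theorem coeff_green (r : Multiset T.FieldType) (k : ℕ) :
    PowerSeries.coeff k (T.green K r) = (if k = 0 then 1 else 0) + greenSign K r • T.c K r k := by
  have h : (PowerSeries.coeff k (PowerSeries.mk fun k => if k = 0 then 0 else T.c K r k)) =
      T.c K r k := by
    rw [PowerSeries.coeff_mk]
    split_ifs with h
    · rw [h, c_zero]
    · rfl
  unfold green greenSign
  rw [map_add, PowerSeries.coeff_one]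
  split_ifs with h1 h2
  all_goals first
    | rw [neg_one_mul, map_neg, h, neg_one_smul]
    | rw [one_mul, h, one_smul]

theorem coeff_linPart_green (r : Multiset T.FieldType) (k : ℕ) :
    PowerSeries.coeff k (T.linPart K (T.green K r)) = greenSign K r • T.c K r k := by
  rw [coeff_linPart, coeff_green, map_add, map_smul, Plin_c]
  split_ifs
  · rw [Plin_one, zero_add]
  · rw [map_zero, zero_add]

theorem augmentation_green (r : Multiset T.FieldType) :
    T.augmentation K (T.green K r) = 1 := by
  ext1 k
  rw [augmentation, PowerSeries.coeff_map, coeff_green, map_add, PowerSeries.coeff_one,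
    RingHom.comp_apply, RingHom.comp_apply, MvPolynomial.constantCoeff_smul, constantCoeff_c,
    smul_zero, map_zero, add_zero]
  split_ifs
  · simp
  · simp

theorem green_mul_greenInv (r : Multiset T.FieldType) : T.green K r * T.greenInv K r = 1 := by
  refine PowerSeries.mul_invOfUnit _ _ ?_
  rw [← PowerSeries.coeff_zero_eq_constantCoeff_apply, coeff_green, c_zero, smul_zero]
  simp

theorem augmentation_greenInv (r : Multiset T.FieldType) :
    T.augmentation K (T.greenInv K r) = 1 := by
  have := congrArg (T.augmentation K) (green_mul_greenInv (K := K) r)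
  rwa [map_mul, augmentation_green, one_mul, map_one] at this

theorem linPart_greenInv (r : Multiset T.FieldType) :
    T.linPart K (T.greenInv K r) = - T.linPart K (T.green K r) := by
  have := congrArg (T.linPart K) (green_mul_greenInv (K := K) r)
  rw [linPart_mul_of_one (augmentation_green r) (augmentation_greenInv r), linPart_one] at this
  exact (neg_eq_of_add_eq_zero_right this).symm

theorem augmentation_insertion (Γ : FGraph T.FieldType) :
    T.augmentation K (T.insertion K Γ) = 1 := by
  unfold insertion
  rw [map_mul, augmentation_prod _ _ fun v _ => augmentation_green _,
    augmentation_prod _ _ fun e _ => augmentation_greenInv _, one_mul]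

/-- All factors of `X_Γ` have augmentation `1`: vertices contribute with a plus sign and the
inverted series of the edges with a minus sign. This is why `typeSum` stands for `P_lin X_Γ` in what
follows. -/
theorem linPart_insertion {Γ : FGraph T.FieldType} (hΓ : T.IsOnePI Γ) :
    T.linPart K (T.insertion K Γ) = Γ.typeSum (fun τ => T.linPart K (T.green K τ)) := by
  unfold insertion typeSum
  rw [linPart_mul_of_one (augmentation_prod _ _ fun v _ => augmentation_green _)
    (augmentation_prod _ _ fun e _ => augmentation_greenInv _),
    linPart_prod _ _ (fun v _ => augmentation_green _),
    linPart_prod _ _ (fun v _ => augmentation_greenInv _), vertexTypes_eq,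
    hΓ.innerPairs.innerTypes_eq, Multiset.map_map, Multiset.map_map, sub_eq_add_neg]
  congr 1
  simp only [linPart_greenInv, Finset.sum_neg_distrib]
  rfl

theorem augmentation_charge (Γ : FGraph T.FieldType) : T.augmentation K (T.charge K Γ) = 1 := by
  unfold charge
  rw [map_mul, augmentation_greenInv, augmentation_insertion, one_mul]

theorem linPart_charge {Γ : FGraph T.FieldType} (hΓ : T.IsOnePI Γ) :
    T.linPart K (T.charge K Γ) = Γ.typeSum (fun τ => T.linPart K (T.green K τ)) -
      T.linPart K (T.green K Γ.res) := by
  unfold charge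
  rw [linPart_mul_of_one (augmentation_greenInv _) (augmentation_insertion _), linPart_greenInv,
    linPart_insertion hΓ]
  abel

theorem sum_place {A : Type*} [AddCommMonoid A] (Γ : FGraph T.FieldType) (f : Γ.Place → A) :
    ∑ p, f p = ∑ v, f (Sum.inl v) + ∑ e, f (Sum.inr e) := Fintype.sum_sum_type f

/-- The sum over all possibilities to insert graphs into the places of `Γ`. -/
theorem sum_place_c {Γ : FGraph T.FieldType} (hΓ : T.IsOnePI Γ) (k : ℕ) :
    ∑ p : Γ.Place, T.c K p.type k =
      PowerSeries.coeff k (Γ.typeSum (fun τ => T.linPart K (T.green K τ))) := by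
  unfold typeSum
  rw [vertexTypes_eq, hΓ.innerPairs.innerTypes_eq, Multiset.map_map, Multiset.map_map, map_sub]
  change _ = PowerSeries.coeff k (∑ v, T.linPart K (T.green K (Γ.vertexType v))) -
    PowerSeries.coeff k (∑ e ∈ Γ.internalEdges, T.linPart K (T.green K (Γ.lineType e)))
  rw [map_sum, map_sum, sum_place, sub_eq_add_neg, ← Finset.sum_neg_distrib]
  congr 1
  · refine Finset.sum_congr rfl fun v _ => ?_
    rw [coeff_linPart_green, greenSign, if_neg, one_smul]
    · rfl
    · have := T.three_le_card _ (hΓ.vertices v)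
      omega
  -- Two signs cancel: edges stand in the denominator of `X_Γ`, and the series of a propagator
  -- carries a minus sign.
  · rw [← Finset.sum_coe_sort Γ.internalEdges]
    refine Finset.sum_congr rfl fun e _ => ?_
    rw [coeff_linPart_green, greenSign, if_pos (Finset.mem_filter.1 e.2).2, neg_one_smul, neg_neg]
    rfl

end Green

/-! ### The relations for arbitrary 1PI graphs -/

section Relations

/-- `P_lin X_Γ = P_lin Γ^r + |Γ| P_lin Q`, modulo the relations. -/
theorem coeff_typeSum_mem_linRelations {γ : FGraph T.FieldType} (hγ : T.IsSkeleton K γ)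
    (hγ₁ : γ.loops = 1) {Γ : FGraph T.FieldType} (hΓ : T.IsOnePI Γ) (hres : Γ.res ∈ T.R) (k : ℕ) :
    PowerSeries.coeff k (Γ.typeSum (fun τ => T.linPart K (T.green K τ)) -
      T.linPart K (T.green K Γ.res) - Γ.loops • T.linPart K (T.charge K γ)) ∈
        T.linRelations K := by
  obtain ⟨N, hN⟩ : ∃ N, Γ.loops ≤ N := ⟨_, le_rfl⟩
  induction N generalizing Γ with
  | zero =>
    have := hΓ.one_le_loops
    omega
  | succ N ih =>
    -- The coproduct of a generator is known only on the chosen representatives, so `Γ` is replaced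
    -- by one; types, residue and loop number do not change.
    obtain ⟨q, ⟨φ⟩⟩ : ∃ q : T.OnePI, Nonempty (FGraph.Iso Γ q.out.1) :=
      ⟨Quotient.mk T.onePISetoid ⟨Γ, hΓ⟩,
        T.onePISetoid.symm' (Quotient.mk_out (s := T.onePISetoid) ⟨Γ, hΓ⟩)⟩
    rw [← φ.typeSum_eq, ← φ.res_eq, ← hΓ.loops_eq_of_iso φ]
    rw [← φ.res_eq] at hres
    rw [← hΓ.loops_eq_of_iso φ] at hN
    have hq := q.out.2
    -- A graph without divergent subgraphs is primitive, hence a skeleton, and the claim is the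
    -- linear part of one of the generating relations.
    by_cases hD : T.divergentSubgraphs q.out.1 = ∅
    · have hs : T.IsSkeleton K q.out.1 := by
        refine ⟨hq, ?_, hres⟩
        rw [coproduct_gen_out, graphCoproduct, hD, Finset.sum_empty, add_zero]
      refine ⟨PowerSeries.coeff k (T.insertion K q.out.1 -
        T.green K q.out.1.res * T.charge K γ ^ q.out.1.loops), ?_, ?_⟩
      · exact Ideal.subset_span ⟨_, γ, k, hs, hγ, hγ₁, rfl⟩
      · rw [map_sub, map_sub, ← coeff_linPart, ← coeff_linPart, ← map_sub, linPart_insertion hq,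
          linPart_mul_of_one (augmentation_green _) (by rw [map_pow, augmentation_charge, one_pow]),
          linPart_pow (augmentation_charge _)]
        congr 1
        abel
    -- Otherwise one component of a divergent subgraph is contracted. Component and quotient have
    -- fewer loops, and the expression in the claim is the sum of theirs: the term `P_lin Γ^{res}`
    -- of the component is the correction in `Glues.typeSum_add`.
    · obtain ⟨S, hS⟩ := Finset.nonempty_iff_ne_empty.2 hD
      have h1 := (Finset.mem_filter.1 hS).2
      obtain ⟨e, he⟩ := h1.1
      obtain ⟨h, rfl⟩ := Quotient.exists_rep e
      obtain ⟨hc, hr⟩ := h1.2 (Quotient.mk _ h) (by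
        simp only [components, Finset.mem_filter, Finset.mem_univ, true_and]
        exact ⟨h, rfl, he⟩)
      have hj := embeds_component (S : Set (Quotient q.out.1.line)) (Quotient.mk _ h)
      have hne := edgeSet_component_ne hq hS (Quotient.mk _ h)
      obtain ⟨p, m, hm⟩ := exists_label hq hc hr hj hne
      have hg := hm p.label p.label_injective p.has_iff_label
      have hΓ' := IsOnePI.quotient_of_glues hg hq hc hr hne
      have hl := IsOnePI.loops_of_glues hg hq hΓ' hc
      have hl1 := hΓ'.one_le_loops
      have hl2 := hc.one_le_loops
      have hts := hg.typeSum_add (fun τ => T.linPart K (T.green K τ))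
      rw [hg.res_eq] at hres
      have m1 := ih hΓ' hres (by omega)
      have m2 := ih hc hr (by omega)
      have := (T.linRelations K).add_mem m1 m2
      rw [← map_add] at this
      convert this using 2
      rw [hl, hg.res_eq, add_smul, eq_sub_of_add_eq hts]
      abel

end Relations

end FeynmanTheory

/-! ### The formula for the linearized coproduct -/

namespace FeynmanTheory

open FGraph

variable {T : FeynmanTheory} {r : Multiset T.FieldType} {K : Type*} [Field K]

theorem coeff_euler_green (r : Multiset T.FieldType) (k : ℕ) :
    PowerSeries.coeff k (T.euler K (T.green K r)) =
      (k : K) • PowerSeries.coeff k (T.linPart K (T.green K r)) := by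
  unfold euler
  cases k with
  | zero => simp
  | succ k =>
    rw [PowerSeries.coeff_succ_X_mul, PowerSeries.coeff_derivative, coeff_green, if_neg (by omega),
      zero_add, coeff_linPart_green, mul_comm, ← Nat.cast_succ, ← nsmul_eq_mul,
      Nat.cast_smul_eq_nsmul]

theorem Plin2_one : T.Plin2 K 1 = 0 := by
  change TensorProduct.map (T.Plin K) (T.Plin K) (T.coproduct K 1) = 0
  rw [map_one, Algebra.TensorProduct.one_def, TensorProduct.map_tmul, Plin_one,
    TensorProduct.zero_tmul]

theorem reduce_tmul_eq {x x' : T.Hopf K} (h : x - x' ∈ T.linRelations K) (y : T.Hopf K) :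
    T.reduce K (x ⊗ₜ[K] y) = T.reduce K (x' ⊗ₜ[K] y) := by
  unfold reduce
  rw [TensorProduct.map_tmul, TensorProduct.map_tmul]
  congr 1
  exact (Submodule.Quotient.eq _).2 h

section

variable [CharZero K]

theorem Plin2_c (r : Multiset T.FieldType) (k : ℕ) :
    T.Plin2 K (T.c K r k) =
      ∑ q ∈ Finset.HasAntidiagonal.antidiagonal k, ∑ y ∈ loopClasses r q.1,
        ((rep y).sym : K)⁻¹ • (PowerSeries.coeff q.2 ((rep y).graph.typeSum
          (fun τ => T.linPart K (T.green K τ))) ⊗ₜ[K] T.gen K (rep y).graph) := by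
  rw [c_eq, map_sum]
  simp only [map_smul]
  rw [sum_Plin2_gen]
  refine Finset.sum_congr rfl fun q _ => Finset.sum_congr rfl fun y _ => ?_
  rw [← sum_place_c (rep y).onePI, TensorProduct.sum_tmul]
  simp only [c_eq]

/-- Modulo the relations the left factor depends on `Y` only through its loop number `q.1`. It can
thus be pulled out of the sum over `Y`, which recombines to `c`. -/
theorem reduce_Plin2_c {γ : FGraph T.FieldType} (hγ : T.IsSkeleton K γ) (hγ₁ : γ.loops = 1)
    (hr : r ∈ T.R) (k : ℕ) :
    T.reduce K (T.Plin2 K (T.c K r k)) =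
      T.reduce K (∑ q ∈ Finset.HasAntidiagonal.antidiagonal k,
        (PowerSeries.coeff q.2 (T.linPart K (T.green K r)) +
          (q.1 : K) • PowerSeries.coeff q.2 (T.linPart K (T.charge K γ))) ⊗ₜ[K] T.c K r q.1) := by
  rw [Plin2_c, map_sum, map_sum]
  refine Finset.sum_congr rfl fun q _ => ?_
  rw [c_eq, TensorProduct.tmul_sum, map_sum, map_sum]
  refine Finset.sum_congr rfl fun y hy => ?_
  rw [TensorProduct.tmul_smul, map_smul, map_smul]
  congr 1
  refine reduce_tmul_eq ?_ _
  have h := coeff_typeSum_mem_linRelations hγ hγ₁ (rep y).onePI (by rwa [(rep y).res_eq]) q.2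
  rw [(rep y).res_eq, mem_loopClasses.1 hy, map_sub, map_sub, map_nsmul] at h
  rwa [Nat.cast_smul_eq_nsmul, ← sub_sub]

theorem reduce_Plin2_green {γ : FGraph T.FieldType} (hγ : T.IsSkeleton K γ) (hγ₁ : γ.loops = 1)
    (hr : r ∈ T.R) (k : ℕ) :
    T.reduce K (T.Plin2 K (PowerSeries.coeff k (T.green K r))) =
      T.reduce K
        (T.tensorCoeff K (T.linPart K (T.green K r)) (T.linPart K (T.green K r)) k +
          T.tensorCoeff K (T.linPart K (T.charge K γ)) (T.euler K (T.green K r)) k) := by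
  have h0 : T.Plin2 K (if k = 0 then 1 else 0) = 0 := by
    split_ifs
    · exact Plin2_one
    · exact map_zero _
  rw [coeff_green, map_add, h0, zero_add, map_smul, map_smul, reduce_Plin2_c hγ hγ₁ hr, ← map_smul]
  congr 1
  unfold tensorCoeff
  -- The antidiagonal is swapped because `q.1` counted the loops of the right tensor factor so far.
  -- The sign of the series of `r` is absorbed by the right factor, and `q.1` turns into the Euler
  -- derivative.
  rw [Finset.smul_sum, ← Finset.sum_add_distrib,
    ← Finset.Nat.sum_antidiagonal_swap (n := k)]
  refine Finset.sum_congr rfl fun q _ => ?_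
  rw [coeff_euler_green, Prod.snd_swap, Prod.fst_swap, coeff_linPart_green r q.2,
    TensorProduct.add_tmul, TensorProduct.tmul_smul, TensorProduct.tmul_smul,
    TensorProduct.tmul_smul, smul_add, TensorProduct.smul_tmul', TensorProduct.smul_tmul',
    smul_comm]
  congr 1

end

/-! ### The combinatorial β-function -/

section Beta

theorem typeSum_eq_sum_interactions {A : Type*} [AddCommGroup A] {Γ : FGraph T.FieldType}
    (hΓ : T.IsOnePI Γ) (f : Multiset T.FieldType → A) :
    Γ.typeSum f = ∑ v ∈ T.interactions,
        (Finset.univ.filter (fun w : Quotient Γ.vert => Γ.vertexType w = v)).card • f v -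
      ∑ e ∈ T.edges, (Γ.internalEdges.filter (fun l => Γ.lineType l = e)).card • f e := by
  unfold typeSum
  rw [vertexTypes_eq, hΓ.innerPairs.innerTypes_eq, Multiset.map_map, Multiset.map_map]
  congr 1
  · change ∑ v, f (Γ.vertexType v) = _
    rw [← Finset.sum_fiberwise_of_maps_to (fun v _ => hΓ.vertices v)]
    refine Finset.sum_congr rfl fun v _ => ?_
    rw [← Finset.sum_const]
    exact Finset.sum_congr rfl fun w hw => by rw [(Finset.mem_filter.1 hw).2]
  · change ∑ e ∈ Γ.internalEdges, f (Γ.lineType e) = _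
    have hm : ∀ e ∈ Γ.internalEdges, Γ.lineType e ∈ T.edges := by
      intro e he
      refine hΓ.innerTypes_mem _ ?_
      rw [hΓ.innerPairs.innerTypes_eq]
      exact Multiset.mem_map.2 ⟨e, he, rfl⟩
    rw [← Finset.sum_fiberwise_of_maps_to hm]
    refine Finset.sum_congr rfl fun v _ => ?_
    rw [← Finset.sum_const]
    exact Finset.sum_congr rfl fun w hw => by rw [(Finset.mem_filter.1 hw).2]

/-- Interactions have at least three legs and propagators two, so `R` is a disjoint union and
exactly one of the sums contains `f r`. -/
theorem sum_ite_res {A : Type*} [AddCommGroup A] (hr : r ∈ T.R) (f : Multiset T.FieldType → A) :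
    ∑ v ∈ T.interactions, (if r = v then f v else 0) +
      ∑ e ∈ T.edges, (if r = e then f e else 0) = f r := by
  rw [Finset.sum_ite_eq, Finset.sum_ite_eq]
  rcases Finset.mem_union.1 hr with h | h
  · rw [if_pos h, if_neg fun h' => disjoint_interactions_edges h h', add_zero]
  · rw [if_pos h, if_neg fun h' => disjoint_interactions_edges h' h, zero_add]

/-- By the logarithmic behaviour of `Plin`, the coefficient of each `P_lin Γ^τ` is its exponent in
the charge: the number of vertices, or minus the number of edges, of type `τ`, diminished by one if
`τ` is the residue. The equality holds in the free algebra, without dividing by the relations. -/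
theorem linPart_charge_eq_betaComb [CharZero K] {γ : FGraph T.FieldType} (hγ : T.IsOnePI γ)
    (hres : γ.res ∈ T.R) {n : ℤ} {nv ne : Multiset T.FieldType → ℚ}
    (hn : T.IsChargeExponent γ n nv ne) : T.linPart K (T.charge K γ) = T.betaComb K n nv ne := by
  have hv : ∀ v ∈ T.interactions, (n : K) * (nv v : K) =
      ((Finset.univ.filter (fun w : Quotient γ.vert => γ.vertexType w = v)).card : K) -
        (if γ.res = v then 1 else 0) := by
    intro v h
    have := congrArg (fun x : ℚ => (x : K)) (hn.vertex v h)
    simp only [Rat.cast_mul, Rat.cast_sub, Rat.cast_intCast, Rat.cast_natCast, apply_ite Rat.cast,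
      Rat.cast_one, Rat.cast_zero] at this
    exact this
  have he : ∀ e ∈ T.edges, (n : K) * ((1 / 2 : K) * (ne e : K)) =
      ((γ.internalEdges.filter (fun l => γ.lineType l = e)).card : K) +
        (if γ.res = e then 1 else 0) := by
    intro e h
    have := congrArg (fun x : ℚ => (x : K)) (hn.edge e h)
    simp only [Rat.cast_mul, Rat.cast_add, Rat.cast_intCast, Rat.cast_natCast, Rat.cast_div,
      Rat.cast_ofNat, apply_ite Rat.cast, Rat.cast_one, Rat.cast_zero] at this
    rw [← this]
    ring
  rw [linPart_charge hγ, typeSum_eq_sum_interactions hγ,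
    ← sum_ite_res hres fun τ => T.linPart K (T.green K τ)]
  unfold betaComb
  rw [smul_sub, Finset.smul_sum, Finset.smul_sum, Finset.smul_sum]
  have h1 : ∀ v ∈ T.interactions, (n : K) • (nv v : K) • T.linPart K (T.green K v) =
      (Finset.univ.filter (fun w : Quotient γ.vert => γ.vertexType w = v)).card •
        T.linPart K (T.green K v) - (if γ.res = v then T.linPart K (T.green K v) else 0) := by
    intro v h
    rw [smul_smul, hv v h, sub_smul, Nat.cast_smul_eq_nsmul, ite_smul, one_smul, zero_smul]
  have h2 : ∀ e ∈ T.edges, (n : K) • (1 / 2 : K) • (ne e : K) • T.linPart K (T.green K e) =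
      (γ.internalEdges.filter (fun l => γ.lineType l = e)).card •
        T.linPart K (T.green K e) + (if γ.res = e then T.linPart K (T.green K e) else 0) := by
    intro e h
    rw [smul_smul, smul_smul, mul_assoc, he e h, add_smul, Nat.cast_smul_eq_nsmul, ite_smul,
      one_smul, zero_smul]
  rw [Finset.sum_congr rfl h1, Finset.sum_congr rfl h2, Finset.sum_sub_distrib,
    Finset.sum_add_distrib]
  abel

end Beta

end FeynmanTheory

theorem theorem3 (K : Type*) [Field K] [CharZero K] (T : FeynmanTheory)
    (γ : FGraph T.FieldType) (hγ : T.IsSkeleton K γ) (hγ₁ : γ.loops = 1)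
    (n : ℤ) (nv ne : Multiset T.FieldType → ℚ) (hn : T.IsChargeExponent γ n nv ne) :
    (∀ r ∈ T.R, ∀ k : ℕ,
      T.reduce K (T.Plin2 K (PowerSeries.coeff k (T.green K r))) =
        T.reduce K
          (T.tensorCoeff K (T.linPart K (T.green K r)) (T.linPart K (T.green K r)) k +
            T.tensorCoeff K (T.linPart K (T.charge K γ)) (T.euler K (T.green K r)) k)) ∧
    T.linPart K (T.charge K γ) = T.betaComb K n nv ne := by
  exact ⟨fun _ hr k => FeynmanTheory.reduce_Plin2_green hγ hγ₁ hr k,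
    FeynmanTheory.linPart_charge_eq_betaComb hγ.onePI hγ.res_mem hn⟩
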